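/- Let $\mathcal H$ be a complex Hilbert space, let $T$ be a self-adjoint (possibly unbounded) operator in $\mathcal H$ with $T^{-1}\in\mathcal B(\mathcal H)$, and let $S$ be a closed operator in $\mathcal H$ with $\operatorname{dom}(S)\cap\operatorname{dom}(S^*)\supseteq\operatorname{dom}(T)$. Products of operators are taken on their maximal domains. For a self-adjoint operator $A$ with spectral measure $E_A$ put $A^z=\int\lambda^z\,dE_A(\lambda)$, where $\lambda^z=e^{z\ln\lambda}$ for $\lambda>0$, $\lambda^z=e^{z(\ln|\lambda|+i\pi)}$ for $\lambda<0$, and $0^0=1$. Let $|S|=(S^*S)^{1/2}$, $|S^*|=(SS^*)^{1/2}$, and let $U_S$ be the partial isometry with $\ker U_S=\ker S$ in the polar decomposition $S=U_S|S|$. Then $ST^{-1},\,S^*T^{-1}\in\mathcal B(\mathcal H)$, and for every $z\in\mathbb C$ with $0\le\operatorname{Re}z\le1$ the operator $T^{-z}ST^{-1+z}$ is defined on $\operatorname{dom}(T)$ and, with domain $\operatorname{dom}(T)$, is closable, with closure $$\overline{T^{-z}ST^{-1+z}}=T^{-i\operatorname{Im}z}\big[|S^*|^{\operatorname{Re}z}\,(T^{-\operatorname{Re}z})^*\big]^*\,U_S\,|S|^{1-\operatorname{Re}z}\,T^{-1+\operatorname{Re}z}\,T^{i\operatorname{Im}z}\in\mathcal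 B(\mathcal H).$$ If $T\ge0$, then $(T^{-\operatorname{Re}z})^*$ can be replaced by $T^{-\operatorname{Re}z}$ in this formula. Moreover, for every $k\in(0,\infty)$ and every such $z$, $$\big\|\overline{T^{-z}ST^{-1+z}}\big\|\le\|ST^{-1}\|^{1-\operatorname{Re}z}\,\|S^*T^{-1}\|^{\operatorname{Re}z}\,e^{k|\operatorname{Im}z|^2+k\operatorname{Re}z(1-\operatorname{Re}z)+k^{-1}\pi^2},$$ and if $T\ge0$ the exponential factor can be replaced by $1$. Finally, for every $x\in[0,1]$, $$\big\|\overline{T^{-x}ST^{-1+x}}\big\|\le\|ST^{-1}\|^{1-x}\,\|S^*T^{-1}\|^{x}\,e^{2\pi\sqrt{x(1-x)}},$$ and if $T\ge0$ the exponential factor can be replaced by $1$. -/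

import Mathlib

open MeasureTheory Filter Topology
open scoped ENNReal LinearPMap

noncomputable section

variable {H : Type*} [NormedAddCommGroup H] [InnerProductSpace ℂ H] [CompleteSpace H]

/-! ### Operator products, bounded operators -/

/-- A bounded operator, regarded as an everywhere defined partial operator. -/
def ofCLM (B : H →L[ℂ] H) : H →ₗ.[ℂ] H := (B : H →ₗ[ℂ] H).toPMap ⊤

/-- The maximally defined product `A B`, with domain `{f ∈ dom B | B f ∈ dom A}`. -/
def opMul (A B : H →ₗ.[ℂ] H) : H →ₗ.[ℂ] H where
  domain :=
    { carrier := {f | ∃ h : f ∈ B.domain, B ⟨f, h⟩ ∈ A.domain}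
      zero_mem' := ⟨B.domain.zero_mem, by
        have : B ⟨0, B.domain.zero_mem⟩ = 0 := B.map_zero
        rw [this]; exact A.domain.zero_mem⟩
      add_mem' := by
        rintro f g ⟨hf, hf'⟩ ⟨hg, hg'⟩
        refine ⟨B.domain.add_mem hf hg, ?_⟩
        have : B ⟨f + g, B.domain.add_mem hf hg⟩ = B ⟨f, hf⟩ + B ⟨g, hg⟩ :=
          B.map_add ⟨f, hf⟩ ⟨g, hg⟩
        rw [this]; exact A.domain.add_mem hf' hg'
      smul_mem' := by
        rintro c f ⟨hf, hf'⟩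
        refine ⟨B.domain.smul_mem c hf, ?_⟩
        have : B ⟨c • f, B.domain.smul_mem c hf⟩ = c • B ⟨f, hf⟩ := B.map_smul c ⟨f, hf⟩
        rw [this]; exact A.domain.smul_mem c hf' }
  toFun :=
    { toFun := fun f => A ⟨B ⟨f.1, f.2.1⟩, f.2.2⟩
      map_add' := by
        rintro ⟨f, hf, hf'⟩ ⟨g, hg, hg'⟩
        rw [← A.map_add]
        congr 1
        exact Subtype.ext (B.map_add ⟨f, hf⟩ ⟨g, hg⟩)
      map_smul' := by
        rintro c ⟨f, hf, hf'⟩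
        rw [RingHom.id_apply, ← A.map_smul]
        congr 1
        exact Subtype.ext (B.map_smul c ⟨f, hf⟩) }

/-- `T⁻¹ ∈ B(H)`: the operator `T` is injective and its inverse (defined on the range of `T`)
is an everywhere defined bounded operator. -/
def HasBoundedInverse (T : H →ₗ.[ℂ] H) : Prop :=
  LinearMap.ker T.toFun = ⊥ ∧ ∃ R : H →L[ℂ] H, T.inverse = ofCLM R

/-- `T ≥ 0` in the sense of quadratic forms. -/
def IsNonneg (T : H →ₗ.[ℂ] H) : Prop :=
  ∀ f : T.domain, 0 ≤ (inner ℂ (f : H) (T f)).re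

/-! ### Projection-valued measures and spectral integrals -/

/-- A projection-valued measure (resolution of the identity) on the Borel sets of `ℝ`. The values
on sets that are not Borel play no role. -/
structure ProjMeasure (H : Type*) [NormedAddCommGroup H] [InnerProductSpace ℂ H]
    [CompleteSpace H] where
  proj : Set ℝ → H →L[ℂ] H
  isStarProjection : ∀ s, MeasurableSet s → IsStarProjection (proj s)
  proj_univ : proj Set.univ = 1
  hasSum_iUnion : ∀ s : ℕ → Set ℝ, (∀ n, MeasurableSet (s n)) →
    Pairwise (Function.onFun Disjoint s) →
    ∀ f : H, HasSum (fun n => proj (s n) f) (proj (⋃ n, s n) f)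

namespace ProjMeasure

variable (E : ProjMeasure H)

theorem proj_empty (f : H) : E.proj ∅ f = 0 := by
  have h := E.hasSum_iUnion (fun _ => ∅) (fun _ => MeasurableSet.empty)
    (fun _ _ _ => by simp [Function.onFun]) f
  have h' := h.summable.tendsto_atTop_zero
  exact tendsto_nhds_unique tendsto_const_nhds h'

open scoped Classical in
/-- The vector measure `s ↦ E(s) f`. -/
def vec (f : H) : VectorMeasure ℝ H where
  measureOf' s := if MeasurableSet s then E.proj s f else 0
  empty' := by simp [E.proj_empty]
  not_measurable' s hs := by simp [hs]
  m_iUnion' s hs hd := by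
    simpa [hs, MeasurableSet.iUnion hs] using E.hasSum_iUnion s hs hd f

theorem vec_apply (f : H) {s : Set ℝ} (hs : MeasurableSet s) : E.vec f s = E.proj s f :=
  if_pos hs

theorem inner_proj (f : H) {s : Set ℝ} (hs : MeasurableSet s) :
    inner ℂ f (E.proj s f) = ((‖E.proj s f‖ ^ 2 : ℝ) : ℂ) := by
  have h := E.isStarProjection s hs
  have h1 : E.proj s (E.proj s f) = E.proj s f := congrArg (fun A => A f) h.isIdempotentElem
  have h2 : ContinuousLinearMap.adjoint (E.proj s) = E.proj s := h.isSelfAdjoint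
  calc inner ℂ f (E.proj s f) = inner ℂ f (E.proj s (E.proj s f)) := by rw [h1]
    _ = inner ℂ (ContinuousLinearMap.adjoint (E.proj s) f) (E.proj s f) := by
        rw [ContinuousLinearMap.adjoint_inner_left]
    _ = _ := by rw [h2, inner_self_eq_norm_sq_to_K]; norm_cast

/-- The finite Borel measure `s ↦ ‖E(s) f‖²` on `ℝ`. -/
def scalar (f : H) : Measure ℝ :=
  Measure.ofMeasurable (fun s _ => ENNReal.ofReal (‖E.proj s f‖ ^ 2))
    (by simp [E.proj_empty])
    (by
      intro s hs hd
      have h := (E.hasSum_iUnion s hs hd f).mapL (innerSL ℂ f)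
      simp only [innerSL_apply_apply] at h
      rw [E.inner_proj f (MeasurableSet.iUnion hs)] at h
      simp only [E.inner_proj f (hs _)] at h
      have h' := Complex.hasSum_ofReal.mp h
      rw [← h'.tsum_eq, ENNReal.ofReal_tsum_of_nonneg (fun _ => by positivity) h'.summable])

theorem scalar_apply (f : H) {s : Set ℝ} (hs : MeasurableSet s) :
    E.scalar f s = ENNReal.ofReal (‖E.proj s f‖ ^ 2) :=
  Measure.ofMeasurable_apply s hs

instance (f : H) : IsFiniteMeasure (E.scalar f) :=
  ⟨by rw [E.scalar_apply f MeasurableSet.univ]; exact ENNReal.ofReal_lt_top⟩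

theorem scalar_add_le (f g : H) :
    E.scalar (f + g) ≤ (2 : ℝ≥0∞) • (E.scalar f + E.scalar g) := by
  refine Measure.le_iff.mpr fun s hs => ?_
  simp only [Measure.smul_apply, Measure.add_apply, E.scalar_apply _ hs, smul_eq_mul]
  rw [← ENNReal.ofReal_add (by positivity) (by positivity),
    show (2 : ℝ≥0∞) = ENNReal.ofReal 2 by simp, ← ENNReal.ofReal_mul (by norm_num)]
  refine ENNReal.ofReal_le_ofReal ?_
  rw [map_add]
  have := norm_add_le (E.proj s f) (E.proj s g)
  nlinarith [norm_nonneg (E.proj s f + E.proj s g), sq_nonneg (‖E.proj s f‖ - ‖E.proj s g‖)]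

theorem scalar_smul (c : ℂ) (f : H) :
    E.scalar (c • f) = ENNReal.ofReal (‖c‖ ^ 2) • E.scalar f := by
  refine Measure.ext fun s hs => ?_
  rw [Measure.smul_apply, E.scalar_apply _ hs, E.scalar_apply _ hs, map_smul, norm_smul, mul_pow,
    ENNReal.ofReal_mul (by positivity), smul_eq_mul]

/-- The spectral integral `∫ φ dE = ∑_c c E(φ⁻¹{c})` of a simple function `φ`. -/
def simple (φ : SimpleFunc ℝ ℂ) : H →L[ℂ] H :=
  ∑ c ∈ φ.range, c • E.proj (φ ⁻¹' {c})

/-- The set function `s ↦ (c ↦ c • E(s) f)`, used for the additivity of `simple`. -/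
def setFun (f : H) (s : Set ℝ) : ℂ →L[ℝ] H :=
  ((ContinuousLinearMap.id ℂ ℂ).smulRight (E.vec f s)).restrictScalars ℝ

theorem setFun_additive (f : H) : FinMeasAdditive (E.scalar f) (E.setFun f) := by
  intro s t hs ht _ _ hd
  ext
  simp [setFun, VectorMeasure.of_union hd hs ht]

theorem simple_apply (φ : SimpleFunc ℝ ℂ) (f : H) :
    E.simple φ f = φ.setToSimpleFunc (E.setFun f) := by
  simp [simple, SimpleFunc.setToSimpleFunc, setFun,
    E.vec_apply f (φ.measurableSet_fiber _)]

theorem simple_sub (φ ψ : SimpleFunc ℝ ℂ) (f : H) :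
    E.simple (φ - ψ) f = E.simple φ f - E.simple ψ f := by
  simp only [simple_apply]
  exact SimpleFunc.setToSimpleFunc_sub _ (E.setFun_additive f)
    (SimpleFunc.integrable_of_isFiniteMeasure _) (SimpleFunc.integrable_of_isFiniteMeasure _)

theorem inner_proj_of_disjoint (f : H) {s t : Set ℝ} (hs : MeasurableSet s) (ht : MeasurableSet t)
    (hd : Disjoint s t) : inner ℂ (E.proj s f) (E.proj t f) = 0 := by
  have hadd : E.proj (s ∪ t) = E.proj s + E.proj t := by
    ext g
    have := VectorMeasure.of_union (v := E.vec g) hd hs ht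
    simpa [E.vec_apply g hs, E.vec_apply g ht, E.vec_apply g (hs.union ht)] using this
  have h0 := E.isStarProjection _ (hs.union ht)
  have h1 := E.isStarProjection s hs
  have h2 := E.isStarProjection t ht
  have hmul : E.proj s * E.proj t = 0 := by
    rw [hadd] at h0
    have hi := h0.isIdempotentElem
    have := (IsIdempotentElem.add_iff h1.isIdempotentElem h2.isIdempotentElem).mp hi
    have is := h1.isIdempotentElem.eq
    have hanti := eq_neg_of_add_eq_zero_left this
    have e2 : E.proj s * E.proj t = E.proj s * E.proj t * (-1 : H →L[ℂ] H) * E.proj s := by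
      calc E.proj s * E.proj t = E.proj s * (E.proj s * E.proj t) := by
            rw [← mul_assoc, is]
        _ = E.proj s * (-(E.proj t * E.proj s)) := by rw [hanti]
        _ = _ := by noncomm_ring
    have e3 : E.proj s * E.proj t * E.proj s = -(E.proj s * E.proj t * E.proj s) := by
      conv_lhs => rw [e2]
      simp [mul_assoc, is]
    have e4 : E.proj s * E.proj t * E.proj s = 0 := by
      have := add_eq_zero_iff_eq_neg.mpr e3
      rw [← two_smul ℂ] at this
      exact (smul_eq_zero.mp this).resolve_left two_ne_zero
    rw [e2]
    simpa using e4
  rw [← ContinuousLinearMap.adjoint_inner_right]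
  have h1' : ContinuousLinearMap.adjoint (E.proj s) = E.proj s := h1.isSelfAdjoint
  rw [h1']
  have : E.proj s (E.proj t f) = 0 := congrArg (fun A : H →L[ℂ] H => A f) hmul
  rw [this, inner_zero_right]

/-- The isometry property `‖(∫ φ dE) f‖ = ‖φ‖_{L²(‖E f‖²)}` for simple functions. -/
theorem norm_simple (φ : SimpleFunc ℝ ℂ) (f : H) :
    ENNReal.ofReal ‖E.simple φ f‖ = eLpNorm φ 2 (E.scalar f) := by
  have h1 : ‖E.simple φ f‖ ^ 2 = ∑ c ∈ φ.range, ‖c‖ ^ 2 * ‖E.proj (φ ⁻¹' {c}) f‖ ^ 2 := by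
    have : inner ℂ (E.simple φ f) (E.simple φ f)
        = ((∑ c ∈ φ.range, ‖c‖ ^ 2 * ‖E.proj (φ ⁻¹' {c}) f‖ ^ 2 : ℝ) : ℂ) := by
      simp only [simple, sum_apply, smul_apply,
        sum_inner, inner_sum, inner_smul_left, inner_smul_right]
      push_cast
      refine Finset.sum_congr rfl fun c hc => ?_
      rw [Finset.sum_eq_single c]
      · rw [inner_self_eq_norm_sq_to_K, ← mul_assoc, Complex.mul_conj']
        rfl
      · intro d _ hd
        rw [E.inner_proj_of_disjoint f (φ.measurableSet_fiber _) (φ.measurableSet_fiber _)]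
        · simp
        · exact (Set.disjoint_singleton.mpr hd).preimage φ
      · exact fun h => absurd hc h
    rw [inner_self_eq_norm_sq_to_K] at this
    exact Complex.ofReal_injective (by rw [← this]; norm_cast)
  have h2 : eLpNorm φ 2 (E.scalar f) ^ 2 = ENNReal.ofReal (‖E.simple φ f‖ ^ 2) := by
    have : eLpNorm φ 2 (E.scalar f) ^ 2 = ∫⁻ t, ‖φ t‖ₑ ^ 2 ∂(E.scalar f) := by
      have := eLpNorm_nnreal_pow_eq_lintegral (f := φ) (μ := E.scalar f) (p := 2) (by norm_num)
      simpa using this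
    rw [this]
    have hm : ∀ t, ‖φ t‖ₑ ^ 2 = (φ.map (fun c => ‖c‖ₑ ^ 2)) t := fun t => rfl
    simp_rw [hm]
    rw [SimpleFunc.lintegral_eq_lintegral, SimpleFunc.map_lintegral, h1,
      ENNReal.ofReal_sum_of_nonneg (fun _ _ => by positivity)]
    refine Finset.sum_congr rfl fun c _ => ?_
    rw [E.scalar_apply f (φ.measurableSet_fiber _), ENNReal.ofReal_mul (by positivity),
      ENNReal.ofReal_pow (norm_nonneg c), ofReal_norm]
  rw [ENNReal.ofReal_pow (norm_nonneg _)] at h2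
  exact ((ENNReal.pow_right_strictMono two_ne_zero).injective h2).symm

/-- A sequence of simple functions that converges pointwise to the Borel function `g`, and also
in `L²(μ)` for every finite measure `μ` with `g ∈ L²(μ)`. -/
def approx (g : ℝ → ℂ) (hg : Measurable g) (n : ℕ) : SimpleFunc ℝ ℂ :=
  SimpleFunc.approxOn g hg Set.univ 0 (Set.mem_univ _) n

theorem tendsto_approx {g : ℝ → ℂ} (hg : Measurable g) {f : H} (hf : MemLp g 2 (E.scalar f)) :
    Tendsto (fun n => E.simple (approx g hg n) f) atTop
      (𝓝 (limUnder atTop fun n => E.simple (approx g hg n) f)) := by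
  have hlim : Tendsto (fun n => eLpNorm (⇑(approx g hg n) - g) 2 (E.scalar f)) atTop (𝓝 0) := by
    refine SimpleFunc.tendsto_approxOn_Lp_eLpNorm hg (Set.mem_univ _) (by norm_num) (by simp) ?_
    simpa using hf.2
  refine CauchySeq.tendsto_limUnder ?_
  rw [EMetric.cauchySeq_iff]
  intro ε hε
  have hε2 : 0 < ε / 2 := ENNReal.half_pos hε.ne'
  obtain ⟨N, hN⟩ := eventually_atTop.mp (hlim.eventually (gt_mem_nhds hε2))
  refine ⟨N, fun m hm n hn => ?_⟩
  have e : edist (E.simple (approx g hg m) f) (E.simple (approx g hg n) f)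
      = eLpNorm ((⇑(approx g hg m) - g) - (⇑(approx g hg n) - g)) 2 (E.scalar f) := by
    rw [edist_dist, dist_eq_norm, ← E.simple_sub, E.norm_simple]
    congr 1
    ext t
    simp
  rw [e]
  calc _ ≤ eLpNorm (⇑(approx g hg m) - g) 2 (E.scalar f)
        + eLpNorm (⇑(approx g hg n) - g) 2 (E.scalar f) :=
        eLpNorm_sub_le ((SimpleFunc.aestronglyMeasurable _).sub hg.aestronglyMeasurable)
          ((SimpleFunc.aestronglyMeasurable _).sub hg.aestronglyMeasurable) (by norm_num)
    _ < ε / 2 + ε / 2 := ENNReal.add_lt_add (hN m hm) (hN n hn)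
    _ = ε := ENNReal.add_halves ε

theorem memLp_add_measure {g : ℝ → ℂ} (hg : Measurable g) {μ ν : Measure ℝ}
    (hμ : MemLp g 2 μ) (hν : MemLp g 2 ν) : MemLp g 2 (μ + ν) := by
  refine ⟨hg.aestronglyMeasurable, ?_⟩
  have h1 := hμ.2
  have h2 := hν.2
  rw [eLpNorm_lt_top_iff_lintegral_rpow_enorm_lt_top two_ne_zero ENNReal.ofNat_ne_top] at *
  rw [lintegral_add_measure]
  exact ENNReal.add_lt_top.mpr ⟨h1, h2⟩

/-- The spectral integral `∫ g(λ) dE(λ)` of a Borel function `g`: its domain consists of the `f`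
with `∫ |g(λ)|² d‖E(λ) f‖² < ∞`, and its value at `f` is the limit of the integrals of simple
functions converging to `g` in `L²(d‖E(λ) f‖²)`. -/
def integral (g : ℝ → ℂ) (hg : Measurable g) : H →ₗ.[ℂ] H where
  domain :=
    { carrier := {f | MemLp g 2 (E.scalar f)}
      zero_mem' := by
        have : E.scalar 0 = 0 := by simpa using E.scalar_smul 0 0
        simp [this]
      add_mem' := fun {f f'} hf hf' =>
        ((memLp_add_measure hg hf hf').smul_measure (by norm_num)).mono_measure
          (E.scalar_add_le f f')
      smul_mem' := fun c f hf => by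
        change MemLp g 2 (E.scalar (c • f))
        rw [E.scalar_smul]
        exact hf.smul_measure ENNReal.ofReal_ne_top }
  toFun :=
    { toFun := fun f => limUnder atTop fun n => E.simple (approx g hg n) f
      map_add' := fun f f' => by
        have h := (E.tendsto_approx hg f.2).add (E.tendsto_approx hg f'.2)
        refine tendsto_nhds_unique (E.tendsto_approx hg (f + f').2) (h.congr fun n => ?_)
        simp
      map_smul' := fun c f => by
        have h := (E.tendsto_approx hg f.2).const_smul c
        refine tendsto_nhds_unique (E.tendsto_approx hg (c • f).2) (h.congr fun n => ?_)
        simp }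

open scoped Classical in
/-- The projection-valued measure concentrated at the point `0`. -/
def diracZero : ProjMeasure H where
  proj s := if (0 : ℝ) ∈ s then 1 else 0
  isStarProjection s _ := by
    split_ifs
    · exact IsStarProjection.one _
    · exact IsStarProjection.zero _
  proj_univ := by simp
  hasSum_iUnion s _ hd f := by
    by_cases h : ∃ n, (0 : ℝ) ∈ s n
    · obtain ⟨n, hn⟩ := h
      have hU : (0 : ℝ) ∈ ⋃ n, s n := Set.mem_iUnion.mpr ⟨n, hn⟩
      have hne : ∀ m, m ≠ n → (0 : ℝ) ∉ s m := fun m hm h0 =>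
        Set.disjoint_left.mp (hd hm) h0 hn
      have := hasSum_single (f := fun m => (if (0 : ℝ) ∈ s m then (1 : H →L[ℂ] H) else 0) f) n
        (fun m hm => by simp [hne m hm])
      simpa [hU, hn] using this
    · have hU : (0 : ℝ) ∉ ⋃ n, s n := by simpa using h
      push Not at h
      simp [h]

end ProjMeasure

/-! ### Powers of self-adjoint operators -/

open scoped Classical in
/-- The spectral measure `E_A` of a self-adjoint operator `A`, i.e. the projection-valued measure
with `A = ∫ λ dE_A(λ)`, including equality of domains. (If there is none, which does not occur
for self-adjoint `A`, an arbitrary value is taken.) -/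
def spectralMeasure (A : H →ₗ.[ℂ] H) : ProjMeasure H :=
  if h : ∃ E : ProjMeasure H, E.integral (fun t => (t : ℂ)) Complex.measurable_ofReal = A
  then h.choose else ProjMeasure.diracZero

theorem measurable_cpow_ofReal (z : ℂ) : Measurable fun t : ℝ => (t : ℂ) ^ z :=
  Complex.measurable_ofReal.pow_const z

/-- The power `A^z = ∫ λ^z dE_A(λ)` of a self-adjoint operator `A`. Here `λ^z` is the principal
value: `λ^z = e^{z ln λ}` for `λ > 0` and `λ^z = e^{z (ln |λ| + iπ)}` for `λ < 0`,
moreover `0^0 = 1`. -/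
def opPow (A : H →ₗ.[ℂ] H) (z : ℂ) : H →ₗ.[ℂ] H :=
  (spectralMeasure A).integral (fun t => (t : ℂ) ^ z) (measurable_cpow_ofReal z)

/-- `|S| = (S^* S)^{1/2}`. -/
def absOp (S : H →ₗ.[ℂ] H) : H →ₗ.[ℂ] H := opPow (opMul S† S) (1 / 2)

/-- `U` is the partial isometry of the polar decomposition of `S`: `S = U |S|`,
`U` is isometric on `(ker U)ᗮ`, and `ker U = ker S`. -/
structure IsPolarFactor (S : H →ₗ.[ℂ] H) (U : H →L[ℂ] H) : Prop where
  mul_abs : opMul (ofCLM U) (absOp S) = S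
  isometric : ∀ f ∈ (LinearMap.ker (U : H →ₗ[ℂ] H))ᗮ, ‖U f‖ = ‖f‖
  ker_eq : ∀ f : H, U f = 0 ↔ ∃ h : f ∈ S.domain, S ⟨f, h⟩ = 0

open scoped Classical in
/-- The partial isometry `U_S` of the polar decomposition `S = U_S |S|` of a closed, densely
defined operator `S` (an arbitrary value is taken if there is no polar decomposition). -/
def polarFactor (S : H →ₗ.[ℂ] H) : H →L[ℂ] H :=
  if h : ∃ U : H →L[ℂ] H, IsPolarFactor S U then h.choose else 0

/-! ### The interpolated operators -/

/-- The product `T^{-z} S T^{-1+z}` on its maximal domain. -/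
def sandwichMax (S T : H →ₗ.[ℂ] H) (z : ℂ) : H →ₗ.[ℂ] H :=
  opMul (opPow T (-z)) (opMul S (opPow T (-1 + z)))

/-- The product `T^{-z} S T^{-1+z}` defined on `dom T`. -/
def sandwich (S T : H →ₗ.[ℂ] H) (z : ℂ) : H →ₗ.[ℂ] H :=
  (sandwichMax S T z).domRestrict T.domain

/-- The product `T^{-i Im z} [|S^*|^{Re z} P]^* U_S |S|^{1 - Re z} T^{-1 + Re z} T^{i Im z}`. -/
def factorized (S T P : H →ₗ.[ℂ] H) (z : ℂ) : H →ₗ.[ℂ] H :=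
  opMul (opPow T (-(Complex.I * z.im))) <|
  opMul (opMul (opPow (absOp S†) z.re) P)† <|
  opMul (ofCLM (polarFactor S)) <|
  opMul (opPow (absOp S) (1 - z.re)) <|
  opMul (opPow T (-1 + z.re)) (opPow T (Complex.I * z.im))

end

/-! Write `R` for the inverse of `T`, `A` for `S R` and `B` for `S† R`; the closed graph theorem
makes `A` and `B` bounded. Moving `S` across the inner product gives the one algebraic identity that
drives the estimate, `R A = B* R`. Formally the operator in question is `T^{-z} A T^z`. On `Re z =
0` it is `A` between imaginary powers of `T`. On `Re z = 1` the identity turns it into `T^{-(z-1)}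
B* T^{z-1}`, which is `B*` between imaginary powers. For negative spectrum the imaginary powers have
norm up to `e^{π|Im z|}`, so the three lines theorem is applied after multiplication by the Gaussian
`e^{k(z²-z)}`; this is the source of the exponential factor. To have an entire function, the powers
are first cut off to spectral bands `1/(n+1) ≤ |λ| ≤ n+1`; the resulting bound does not depend on
`n` and survives the limit. This is `norm_le_of_interpolation`. For `T ≥ 0` the imaginary powers are
contractive and `k` can tend to `0`; for real exponents one optimises over `k`.

The factorization and the boundedness of the closure come from a different argument, with `x = Re
z`. A Heinz inequality (`memLp_cpow_of_memLp`), again by three lines on bands, shows that `|S|^{1-x}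
T^{-1+x}` and `|S†|^x (T^{-x})*` are everywhere defined, hence bounded. The polar factor `U`
intertwines the powers, `U |S|^x ⊆ |S†|^x U` (`intertwines_opPow_absOp`), so `S = U |S|^x |S|^{1-x}`
splits between the two bounded factors. The product `K` satisfies `K R = T^{-z} A T^{-1+z}`
(`exists_factorization`), so `K` agrees with the interpolated operator on `dom T`, which is dense.

All of this rests on a spectral calculus for projection-valued measures: products, adjoints and
domains of spectral integrals, existence of spectral measures for bounded self-adjoint operators
(continuous functional calculus and Riesz representation), for operators with a self-adjoint
resolvent and for `S† S`, and the fact that an intertwining relation between two operators passes to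
their spectral projections (`mul_proj_of_intertwines`). -/

noncomputable section

variable {H : Type*} [NormedAddCommGroup H] [InnerProductSpace ℂ H] [CompleteSpace H]

/-! ### Spectral integrals of unbounded functions as L² limits -/

namespace ProjMeasure

variable (E : ProjMeasure H)

/-- The value of the spectral integral `∫ g dE` at `f` (meaningful if `g ∈ L²(‖E f‖²)`). -/
def app (g : ℝ → ℂ) (hg : Measurable g) (f : H) : H :=
  limUnder atTop fun n => E.simple (approx g hg n) f

theorem tendsto_eLpNorm_approx {g : ℝ → ℂ} (hg : Measurable g) {μ : Measure ℝ}
    (hf : MemLp g 2 μ) :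
    Tendsto (fun n => eLpNorm (⇑(approx g hg n) - g) 2 μ) atTop (𝓝 0) := by
  refine SimpleFunc.tendsto_approxOn_Lp_eLpNorm hg (Set.mem_univ _) (by norm_num) (by simp) ?_
  simpa using hf.2

theorem enorm_simple (φ : SimpleFunc ℝ ℂ) (f : H) :
    ‖E.simple φ f‖ₑ = eLpNorm φ 2 (E.scalar f) := by
  rw [← E.norm_simple, ofReal_norm]

theorem simple_add (φ ψ : SimpleFunc ℝ ℂ) : E.simple (φ + ψ) = E.simple φ + E.simple ψ := by
  ext f
  rw [add_apply]
  simp only [simple_apply]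
  exact SimpleFunc.setToSimpleFunc_add _ (E.setFun_additive f)
    (SimpleFunc.integrable_of_isFiniteMeasure _) (SimpleFunc.integrable_of_isFiniteMeasure _)

theorem simple_indicator {s : Set ℝ} (hs : MeasurableSet s) (c : ℂ) :
    E.simple (SimpleFunc.piecewise s hs (SimpleFunc.const ℝ c) (SimpleFunc.const ℝ 0))
      = c • E.proj s := by
  ext f
  rw [simple_apply, SimpleFunc.setToSimpleFunc_indicator]
  · simp [setFun, E.vec_apply f hs]
  · ext; simp [setFun]

/-- By the isometry for simple functions, two sequences with the same L² limit have spectral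
integrals with the same limit. This frees the calculus from the particular sequence `approx`: sums,
products and conjugates of approximants may be used instead. -/
theorem tendsto_simple_app {g : ℝ → ℂ} (hg : Measurable g) {f : H} (hf : MemLp g 2 (E.scalar f))
    {φ : ℕ → SimpleFunc ℝ ℂ}
    (hφ : Tendsto (fun n => eLpNorm (⇑(φ n) - g) 2 (E.scalar f)) atTop (𝓝 0)) :
    Tendsto (fun n => E.simple (φ n) f) atTop (𝓝 (E.app g hg f)) := by
  have h1 : Tendsto (fun n => E.simple (approx g hg n) f) atTop (𝓝 (E.app g hg f)) :=
    E.tendsto_approx hg hf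
  have h2 := tendsto_eLpNorm_approx hg hf
  have h3 : Tendsto (fun n => E.simple (φ n) f - E.simple (approx g hg n) f) atTop (𝓝 0) := by
    rw [tendsto_zero_iff_enorm_tendsto_zero]
    refine tendsto_of_tendsto_of_tendsto_of_le_of_le tendsto_const_nhds
      (by simpa using hφ.add h2) (fun _ => zero_le) fun n => ?_
    rw [← E.simple_sub, E.enorm_simple]
    have : (⇑(φ n - approx g hg n) : ℝ → ℂ) = (⇑(φ n) - g) - (⇑(approx g hg n) - g) := by
      ext t; simp
    rw [this]
    exact eLpNorm_sub_le ((SimpleFunc.aestronglyMeasurable _).sub hg.aestronglyMeasurable)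
      ((SimpleFunc.aestronglyMeasurable _).sub hg.aestronglyMeasurable) (by norm_num)
  simpa using h3.add h1

theorem enorm_app {g : ℝ → ℂ} (hg : Measurable g) {f : H} (hf : MemLp g 2 (E.scalar f)) :
    ‖E.app g hg f‖ₑ = eLpNorm g 2 (E.scalar f) := by
  have h1 : Tendsto (fun n => ‖E.simple (approx g hg n) f‖ₑ) atTop (𝓝 ‖E.app g hg f‖ₑ) :=
    (continuous_enorm.tendsto _).comp (E.tendsto_approx hg hf)
  simp only [E.enorm_simple] at h1
  have h2 := tendsto_eLpNorm_approx hg hf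
  have hm : ∀ n, AEStronglyMeasurable (⇑(approx g hg n) - g) (E.scalar f) := fun n =>
    (SimpleFunc.aestronglyMeasurable _).sub hg.aestronglyMeasurable
  apply le_antisymm
  · refine le_of_tendsto_of_tendsto' h1 (by simpa using h2.add_const (eLpNorm g 2 (E.scalar f)))
      fun n => ?_
    calc eLpNorm (approx g hg n) 2 (E.scalar f)
        = eLpNorm ((⇑(approx g hg n) - g) + g) 2 (E.scalar f) := by simp
      _ ≤ _ := eLpNorm_add_le (hm n) hg.aestronglyMeasurable (by norm_num)
  · refine le_of_tendsto_of_tendsto' tendsto_const_nhds (by simpa using h1.add h2) fun n => ?_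
    calc eLpNorm g 2 (E.scalar f)
        = eLpNorm (⇑(approx g hg n) - (⇑(approx g hg n) - g)) 2 (E.scalar f) := by simp
      _ ≤ _ := eLpNorm_sub_le (SimpleFunc.aestronglyMeasurable _) (hm n) (by norm_num)

theorem app_congr {g h : ℝ → ℂ} (hg : Measurable g) (hh : Measurable h) {f : H}
    (hgh : g =ᵐ[E.scalar f] h) (hf : MemLp g 2 (E.scalar f)) :
    E.app g hg f = E.app h hh f := by
  have hf' : MemLp h 2 (E.scalar f) := hf.ae_eq hgh
  refine tendsto_nhds_unique (E.tendsto_approx hg hf) (E.tendsto_simple_app hh hf' ?_)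
  refine (tendsto_eLpNorm_approx hg hf).congr fun n => ?_
  exact eLpNorm_congr_ae ((EventuallyEq.refl _ _).sub hgh)

theorem app_add {g h : ℝ → ℂ} (hg : Measurable g) (hh : Measurable h) {f : H}
    (hf : MemLp g 2 (E.scalar f)) (hf' : MemLp h 2 (E.scalar f)) :
    E.app (g + h) (hg.add hh) f = E.app g hg f + E.app h hh f := by
  have h1 : Tendsto (fun n => E.simple (approx g hg n + approx h hh n) f) atTop
      (𝓝 (E.app (g + h) (hg.add hh) f)) := by
    refine E.tendsto_simple_app _ (hf.add hf') ?_
    refine tendsto_of_tendsto_of_tendsto_of_le_of_le tendsto_const_nhds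
      (by simpa using (tendsto_eLpNorm_approx hg hf).add (tendsto_eLpNorm_approx hh hf'))
      (fun _ => zero_le) fun n => ?_
    have : (⇑(approx g hg n + approx h hh n) - (g + h) : ℝ → ℂ)
        = (⇑(approx g hg n) - g) + (⇑(approx h hh n) - h) := by
      ext t; simp; ring
    simp only [this]
    exact eLpNorm_add_le ((SimpleFunc.aestronglyMeasurable _).sub hg.aestronglyMeasurable)
      ((SimpleFunc.aestronglyMeasurable _).sub hh.aestronglyMeasurable) (by norm_num)
  refine tendsto_nhds_unique h1 ?_
  simp only [E.simple_add, add_apply]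
  exact (E.tendsto_approx hg hf).add (E.tendsto_approx hh hf')

/-! ### Multiplicativity -/

theorem proj_union {s t : Set ℝ} (hs : MeasurableSet s) (ht : MeasurableSet t)
    (hd : Disjoint s t) : E.proj (s ∪ t) = E.proj s + E.proj t := by
  ext g
  have := VectorMeasure.of_union (v := E.vec g) hd hs ht
  simpa [E.vec_apply g hs, E.vec_apply g ht, E.vec_apply g (hs.union ht)] using this

theorem adjoint_proj {s : Set ℝ} (hs : MeasurableSet s) :
    ContinuousLinearMap.adjoint (E.proj s) = E.proj s :=
  (E.isStarProjection s hs).isSelfAdjoint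

theorem proj_mul_self {s : Set ℝ} (hs : MeasurableSet s) : E.proj s * E.proj s = E.proj s :=
  (E.isStarProjection s hs).isIdempotentElem

/-- On a complex space an operator with vanishing quadratic form is zero, and here the quadratic
form is an inner product of orthogonal vectors. -/
theorem proj_mul_of_disjoint {s t : Set ℝ} (hs : MeasurableSet s) (ht : MeasurableSet t)
    (hd : Disjoint s t) : E.proj s * E.proj t = 0 := by
  have : ((E.proj s * E.proj t : H →L[ℂ] H) : H →ₗ[ℂ] H) = 0 := by
    rw [← inner_map_self_eq_zero]
    intro f
    rw [← E.inner_proj_of_disjoint f ht hs hd.symm]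
    change inner ℂ (E.proj s (E.proj t f)) f = _
    rw [← ContinuousLinearMap.adjoint_inner_right, E.adjoint_proj hs]
  ext f
  exact congrArg (fun A : H →ₗ[ℂ] H => A f) this

theorem proj_mul {s t : Set ℝ} (hs : MeasurableSet s) (ht : MeasurableSet t) :
    E.proj s * E.proj t = E.proj (s ∩ t) := by
  have h1 : E.proj s = E.proj (s ∩ t) + E.proj (s \ t) := by
    rw [← E.proj_union (hs.inter ht) (hs.diff ht) Set.disjoint_sdiff_inter.symm,
      Set.inter_union_sdiff]
  have h2 : E.proj t = E.proj (s ∩ t) + E.proj (t \ s) := by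
    rw [Set.inter_comm, ← E.proj_union (ht.inter hs) (ht.diff hs) Set.disjoint_sdiff_inter.symm,
      Set.inter_union_sdiff]
  have d1 : Disjoint (s ∩ t) (t \ s) :=
    Set.disjoint_left.mpr fun x hx hx' => hx'.2 hx.1
  have d2 : Disjoint (s \ t) (s ∩ t) :=
    Set.disjoint_left.mpr fun x hx hx' => hx.2 hx'.2
  have d3 : Disjoint (s \ t) (t \ s) :=
    Set.disjoint_left.mpr fun x hx hx' => hx.2 hx'.1
  rw [h1, h2, add_mul, mul_add, mul_add, E.proj_mul_self (hs.inter ht),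
    E.proj_mul_of_disjoint (hs.inter ht) (ht.diff hs) d1,
    E.proj_mul_of_disjoint (hs.diff ht) (hs.inter ht) d2,
    E.proj_mul_of_disjoint (hs.diff ht) (ht.diff hs) d3]
  simp

theorem simple_mul (φ ψ : SimpleFunc ℝ ℂ) : E.simple (φ * ψ) = E.simple φ * E.simple ψ := by
  induction φ using SimpleFunc.induction with
  | const c hs =>
    induction ψ using SimpleFunc.induction with
    | const d ht =>
      rename_i s t
      have : (SimpleFunc.piecewise s hs (SimpleFunc.const ℝ c) (SimpleFunc.const ℝ 0)
          * SimpleFunc.piecewise t ht (SimpleFunc.const ℝ d) (SimpleFunc.const ℝ 0))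
          = SimpleFunc.piecewise (s ∩ t) (hs.inter ht) (SimpleFunc.const ℝ (c * d))
            (SimpleFunc.const ℝ 0) := by
        ext x
        by_cases h1 : x ∈ s <;> by_cases h2 : x ∈ t <;> simp [h1, h2]
      rw [this, simple_indicator, simple_indicator, simple_indicator, smul_mul_smul_comm,
        E.proj_mul hs ht]
    | add _ h1 h2 => rw [mul_add, simple_add, h1, h2, simple_add, mul_add]
  | add _ h1 h2 => rw [add_mul, simple_add, h1, h2, simple_add, add_mul]

theorem inner_simple_left (φ : SimpleFunc ℝ ℂ) (f u : H) :
    inner ℂ (E.simple φ f) u = inner ℂ f (E.simple (φ.map (starRingEnd ℂ)) u) := by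
  induction φ using SimpleFunc.induction with
  | const c hs =>
    rename_i s
    have : (SimpleFunc.piecewise s hs (SimpleFunc.const ℝ c) (SimpleFunc.const ℝ 0)).map
        (starRingEnd ℂ) = SimpleFunc.piecewise s hs (SimpleFunc.const ℝ (starRingEnd ℂ c))
          (SimpleFunc.const ℝ 0) := by
      ext x
      by_cases h1 : x ∈ s <;> simp [h1]
    rw [this, simple_indicator, simple_indicator]
    simp only [smul_apply, inner_smul_left, inner_smul_right]
    congr 1
    rw [← ContinuousLinearMap.adjoint_inner_right, E.adjoint_proj hs]
  | add _ h1 h2 =>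
    rename_i φ ψ _
    have : (φ + ψ).map (starRingEnd ℂ) = φ.map (starRingEnd ℂ) + ψ.map (starRingEnd ℂ) := by
      ext x; simp
    rw [this, simple_add, simple_add, add_apply, add_apply, inner_add_left, inner_add_right, h1, h2]

theorem inner_simple (φ : SimpleFunc ℝ ℂ) (f : H) :
    inner ℂ f (E.simple φ f) = ∫ t, φ t ∂(E.scalar f) := by
  induction φ using SimpleFunc.induction with
  | const c hs =>
    rename_i s
    rw [simple_indicator, smul_apply, inner_smul_right, E.inner_proj f hs]
    have : (⇑(SimpleFunc.piecewise s hs (SimpleFunc.const ℝ c) (SimpleFunc.const ℝ 0)) : ℝ → ℂ)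
        = s.indicator (fun _ => c) := by
      ext x
      by_cases h1 : x ∈ s <;> simp [h1]
    rw [this, integral_indicator_const _ hs, measureReal_def, E.scalar_apply f hs,
      ENNReal.toReal_ofReal (by positivity), mul_comm]
    simp
  | add _ h1 h2 =>
    rw [simple_add, add_apply, inner_add_right, h1, h2]
    simp only [SimpleFunc.coe_add, Pi.add_apply]
    rw [integral_add (SimpleFunc.integrable_of_isFiniteMeasure _)
      (SimpleFunc.integrable_of_isFiniteMeasure _)]

/-- The measure is finite, so the L² convergence of the approximants is also L¹ convergence and the
scalar integrals converge. -/
theorem inner_app {g : ℝ → ℂ} (hg : Measurable g) {f : H} (hf : MemLp g 2 (E.scalar f)) :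
    inner ℂ f (E.app g hg f) = ∫ t, g t ∂(E.scalar f) := by
  have h1 : Tendsto (fun n => inner ℂ f (E.simple (approx g hg n) f)) atTop
      (𝓝 (inner ℂ f (E.app g hg f))) := tendsto_const_nhds.inner (E.tendsto_approx hg hf)
  refine tendsto_nhds_unique h1 ?_
  simp only [inner_simple]
  refine tendsto_integral_of_L1' _ hg.aestronglyMeasurable
    (.of_forall fun n => SimpleFunc.integrable_of_isFiniteMeasure _) ?_
  have h2 := tendsto_eLpNorm_approx hg hf
  have h3 : Tendsto (fun n => eLpNorm (⇑(approx g hg n) - g) 2 (E.scalar f)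
      * E.scalar f Set.univ ^ (1 / (1 : ℝ≥0∞).toReal - 1 / (2 : ℝ≥0∞).toReal)) atTop (𝓝 0) := by
    have := ENNReal.Tendsto.mul_const (b := E.scalar f Set.univ ^
      (1 / (1 : ℝ≥0∞).toReal - 1 / (2 : ℝ≥0∞).toReal)) h2 (Or.inr ?_)
    · simpa using this
    · refine ENNReal.rpow_ne_top_of_nonneg (by norm_num) (measure_ne_top _ _)
  refine tendsto_of_tendsto_of_tendsto_of_le_of_le tendsto_const_nhds h3 (fun _ => zero_le)
    fun n => ?_
  exact eLpNorm_le_eLpNorm_mul_rpow_measure_univ (by norm_num)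
    ((SimpleFunc.aestronglyMeasurable _).sub hg.aestronglyMeasurable)

theorem measurable_conj {g : ℝ → ℂ} (hg : Measurable g) :
    Measurable fun t => starRingEnd ℂ (g t) :=
  Complex.continuous_conj.measurable.comp hg

theorem memLp_conj {g : ℝ → ℂ} {μ : Measure ℝ} (hf : MemLp g 2 μ) :
    MemLp (fun t => starRingEnd ℂ (g t)) 2 μ :=
  hf.star

theorem inner_app_left {g : ℝ → ℂ} (hg : Measurable g) {f u : H} (hf : MemLp g 2 (E.scalar f))
    (hu : MemLp g 2 (E.scalar u)) :
    inner ℂ (E.app g hg f) u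
      = inner ℂ f (E.app (fun t => starRingEnd ℂ (g t)) (measurable_conj hg) u) := by
  have h1 : Tendsto (fun n => inner ℂ (E.simple (approx g hg n) f) u) atTop
      (𝓝 (inner ℂ (E.app g hg f) u)) := (E.tendsto_approx hg hf).inner tendsto_const_nhds
  refine tendsto_nhds_unique h1 ?_
  simp only [inner_simple_left]
  refine tendsto_const_nhds.inner (E.tendsto_simple_app _ (memLp_conj hu) ?_)
  refine (tendsto_eLpNorm_approx hg hu).congr fun n => ?_
  refine eLpNorm_congr_norm_ae (.of_forall fun t => ?_)
  simp [← map_sub]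

/-- A simple function is bounded, so multiplication by it is continuous on L² and the product rule
for simple functions passes to the limit in the second factor. -/
theorem simple_app (φ : SimpleFunc ℝ ℂ) {g : ℝ → ℂ} (hg : Measurable g) {f : H}
    (hf : MemLp g 2 (E.scalar f)) :
    MemLp (⇑φ * g) 2 (E.scalar f) ∧
    E.simple φ (E.app g hg f) = E.app (⇑φ * g) (φ.measurable.mul hg) f := by
  obtain ⟨C, hC⟩ := φ.exists_forall_norm_le
  have hb : ∀ h : ℝ → ℂ, eLpNorm (⇑φ * h) 2 (E.scalar f)
      ≤ ENNReal.ofReal C * eLpNorm h 2 (E.scalar f) := fun h =>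
    eLpNorm_le_mul_eLpNorm_of_ae_le_mul (.of_forall fun t => by
      simp only [Pi.mul_apply, norm_mul]
      exact mul_le_mul_of_nonneg_right (hC t) (norm_nonneg _)) 2
  have hm : MemLp (⇑φ * g) 2 (E.scalar f) :=
    ⟨(φ.measurable.mul hg).aestronglyMeasurable,
      (hb g).trans_lt (ENNReal.mul_lt_top ENNReal.ofReal_lt_top hf.2)⟩
  refine ⟨hm, ?_⟩
  have h1 : Tendsto (fun n => E.simple φ (E.simple (approx g hg n) f)) atTop
      (𝓝 (E.simple φ (E.app g hg f))) :=
    ((E.simple φ).continuous.tendsto _).comp (E.tendsto_approx hg hf)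
  refine tendsto_nhds_unique h1 ?_
  have h2 : ∀ n, E.simple φ (E.simple (approx g hg n) f) = E.simple (φ * approx g hg n) f :=
    fun n => by rw [simple_mul]; rfl
  simp only [h2]
  refine E.tendsto_simple_app _ hm ?_
  have h3 : Tendsto (fun n => ENNReal.ofReal C * eLpNorm (⇑(approx g hg n) - g) 2 (E.scalar f))
      atTop (𝓝 0) := by
    simpa using ENNReal.Tendsto.const_mul (tendsto_eLpNorm_approx hg hf)
      (Or.inr ENNReal.ofReal_ne_top)
  refine tendsto_of_tendsto_of_tendsto_of_le_of_le tendsto_const_nhds h3 (fun _ => zero_le)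
    fun n => ?_
  have : (⇑(φ * approx g hg n) - ⇑φ * g : ℝ → ℂ) = ⇑φ * (⇑(approx g hg n) - g) := by
    ext t; simp; ring
  simp only [this]
  exact hb _

/-- Apply the product rule to the indicator of each Borel set. The resulting density reduces every
domain question about a product of spectral integrals to square integrability of the product
function. -/
theorem scalar_app {g : ℝ → ℂ} (hg : Measurable g) {f : H} (hf : MemLp g 2 (E.scalar f)) :
    E.scalar (E.app g hg f) = (E.scalar f).withDensity fun t => ‖g t‖ₑ ^ 2 := by
  refine Measure.ext fun s hs => ?_
  have h1 := E.simple_app (SimpleFunc.piecewise s hs (SimpleFunc.const ℝ 1) (SimpleFunc.const ℝ 0))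
    hg hf
  rw [simple_indicator, one_smul] at h1
  rw [E.scalar_apply _ hs, ENNReal.ofReal_pow (norm_nonneg _), ofReal_norm, h1.2,
    E.enorm_app _ h1.1, withDensity_apply _ hs]
  have := eLpNorm_nnreal_pow_eq_lintegral (f := ⇑(SimpleFunc.piecewise s hs (SimpleFunc.const ℝ 1)
    (SimpleFunc.const ℝ 0)) * g) (μ := E.scalar f) (p := 2) (by norm_num)
  simp only [ENNReal.coe_ofNat, NNReal.coe_ofNat, ENNReal.rpow_ofNat] at this
  rw [this, ← lintegral_indicator hs]
  refine lintegral_congr fun t => ?_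
  by_cases ht : t ∈ s <;> simp [ht]

theorem eLpNorm_scalar_app {g h : ℝ → ℂ} (hg : Measurable g) (hh : Measurable h) {f : H}
    (hf : MemLp g 2 (E.scalar f)) :
    eLpNorm h 2 (E.scalar (E.app g hg f)) = eLpNorm (h * g) 2 (E.scalar f) := by
  rw [E.scalar_app hg hf]
  refine (ENNReal.pow_right_strictMono two_ne_zero).injective ?_
  have h1 := eLpNorm_nnreal_pow_eq_lintegral (f := h)
    (μ := (E.scalar f).withDensity fun t => ‖g t‖ₑ ^ 2) (p := 2) (by norm_num)
  have h2 := eLpNorm_nnreal_pow_eq_lintegral (f := h * g) (μ := E.scalar f) (p := 2) (by norm_num)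
  simp only [ENNReal.coe_ofNat, NNReal.coe_ofNat, ENNReal.rpow_ofNat] at h1 h2
  simp only [h1, h2]
  rw [lintegral_withDensity_eq_lintegral_mul _ (hg.enorm.pow_const 2) (hh.enorm.pow_const 2)]
  refine lintegral_congr fun t => ?_
  simp [enorm_mul, mul_pow, mul_comm]

theorem memLp_scalar_app {g h : ℝ → ℂ} (hg : Measurable g) (hh : Measurable h) {f : H}
    (hf : MemLp g 2 (E.scalar f)) :
    MemLp h 2 (E.scalar (E.app g hg f)) ↔ MemLp (h * g) 2 (E.scalar f) := by
  simp only [MemLp, E.eLpNorm_scalar_app hg hh hf, hh.aestronglyMeasurable, (hh.mul hg).aestronglyMeasurable]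

theorem enorm_app_sub {g h : ℝ → ℂ} (hg : Measurable g) (hh : Measurable h) {f : H}
    (hf : MemLp g 2 (E.scalar f)) (hf' : MemLp h 2 (E.scalar f)) :
    ‖E.app g hg f - E.app h hh f‖ₑ = eLpNorm (g - h) 2 (E.scalar f) := by
  have h1 := E.app_add (hg.sub hh) hh (hf.sub hf') hf'
  have h2 : E.app (g - h + h) ((hg.sub hh).add hh) f = E.app g hg f := by
    congr 1; simp
  rw [← h2, h1, add_sub_cancel_right, E.enorm_app _ (hf.sub hf')]

/-- The first factor is handled by `simple_app`; for the second, the density in `scalar_app`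
identifies L² convergence for the image vector with L² convergence of the products. -/
theorem app_app {g h : ℝ → ℂ} (hg : Measurable g) (hh : Measurable h) {f : H}
    (hf : MemLp g 2 (E.scalar f)) (hf' : MemLp (h * g) 2 (E.scalar f)) :
    E.app h hh (E.app g hg f) = E.app (h * g) (hh.mul hg) f := by
  have hm := (E.memLp_scalar_app hg hh hf).mpr hf'
  refine tendsto_nhds_unique (E.tendsto_approx hh hm) ?_
  simp only [(E.simple_app _ hg hf).2]
  rw [tendsto_iff_edist_tendsto_0]
  refine (tendsto_eLpNorm_approx hh hm).congr fun n => ?_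
  rw [edist_eq_enorm_sub, E.enorm_app_sub _ _ (E.simple_app _ hg hf).1 hf',
    E.eLpNorm_scalar_app hg (h := ⇑(approx h hh n) - h) ((SimpleFunc.measurable _).sub hh) hf,
    sub_mul]

end ProjMeasure

/-! ### Graphs of adjoints and products; intertwining relations -/

theorem mem_graph_adjoint_iff {A : H →ₗ.[ℂ] H} (hA : Dense (A.domain : Set H)) {u w : H} :
    (u, w) ∈ A†.graph ↔ ∀ x : A.domain, inner ℂ w (x : H) = inner ℂ u (A x) := by
  constructor
  · intro h x
    obtain ⟨y, hy1, hy2⟩ := (LinearPMap.mem_graph_iff _).mp h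
    have := LinearPMap.adjoint_isFormalAdjoint hA y x
    simp only at hy1 hy2
    rw [← hy1, ← hy2]
    exact this
  · intro h
    have hu : u ∈ A†.domain := LinearPMap.mem_adjoint_domain_of_exists _ ⟨w, h⟩
    exact (LinearPMap.mem_graph_iff _).mpr
      ⟨⟨u, hu⟩, rfl, LinearPMap.adjoint_apply_eq hA ⟨u, hu⟩ h⟩

theorem mem_graph_ofCLM {B : H →L[ℂ] H} {f h : H} : (f, h) ∈ (ofCLM B).graph ↔ B f = h := by
  rw [LinearPMap.mem_graph_iff]
  constructor
  · rintro ⟨y, hy, rfl⟩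
    simp only at hy
    subst hy
    rfl
  · rintro rfl
    exact ⟨⟨f, trivial⟩, rfl, rfl⟩

/-- In graph form the maximal domain of a product becomes an existential quantifier, so no
membership proofs have to be carried inside terms. -/
theorem mem_graph_opMul {A B : H →ₗ.[ℂ] H} {f h : H} :
    (f, h) ∈ (opMul A B).graph ↔ ∃ k, (f, k) ∈ B.graph ∧ (k, h) ∈ A.graph := by
  constructor
  · intro hf
    obtain ⟨⟨y, hy, hy'⟩, h1, h2⟩ := (LinearPMap.mem_graph_iff _).mp hf
    simp only at h1 h2
    subst h1
    refine ⟨B ⟨y, hy⟩, LinearPMap.mem_graph B ⟨y, hy⟩, ?_⟩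
    rw [← h2]
    exact LinearPMap.mem_graph A ⟨B ⟨y, hy⟩, hy'⟩
  · rintro ⟨k, h1, h2⟩
    obtain ⟨y, hy, hyk⟩ := (LinearPMap.mem_graph_iff _).mp h1
    obtain ⟨y', hy', hyk'⟩ := (LinearPMap.mem_graph_iff _).mp h2
    simp only at hy hyk hy' hyk'
    subst hy hyk' hyk
    have hm : B y ∈ A.domain := hy' ▸ y'.2
    refine (LinearPMap.mem_graph_iff _).mpr ⟨⟨y, y.2, hm⟩, rfl, ?_⟩
    change A ⟨B y, hm⟩ = A y'
    congr 1
    exact Subtype.ext hy'.symm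

/-- `B A ⊆ A' B`, for a bounded operator `B`. -/
def Intertwines (B : H →L[ℂ] H) (A A' : H →ₗ.[ℂ] H) : Prop :=
  ∀ f h, (f, h) ∈ A.graph → (B f, B h) ∈ A'.graph

theorem Intertwines.adjoint {B : H →L[ℂ] H} {A A' : H →ₗ.[ℂ] H} (h : Intertwines B A A')
    (hA : Dense (A.domain : Set H)) (hA' : Dense (A'.domain : Set H)) :
    Intertwines (ContinuousLinearMap.adjoint B) A'† A† := by
  intro u w huw
  rw [mem_graph_adjoint_iff hA] at *
  rw [mem_graph_adjoint_iff hA'] at huw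
  intro x
  rw [ContinuousLinearMap.adjoint_inner_left, ContinuousLinearMap.adjoint_inner_left]
  obtain ⟨y, hy1, hy2⟩ := (LinearPMap.mem_graph_iff _).mp (h _ _ (LinearPMap.mem_graph A x))
  simp only at hy1 hy2
  rw [← hy2, ← huw y, hy1]

/-! ### Bounded Borel functions -/

/-- A bounded Borel function. -/
structure BddMeas (g : ℝ → ℂ) : Prop where
  meas : Measurable g
  bdd : ∃ C, ∀ t, ‖g t‖ ≤ C

namespace BddMeas

theorem const (c : ℂ) : BddMeas fun _ => c := ⟨measurable_const, ‖c‖, fun _ => le_rfl⟩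

theorem mul {g h : ℝ → ℂ} (hg : BddMeas g) (hh : BddMeas h) : BddMeas (g * h) := by
  obtain ⟨hg, C, hC⟩ := hg
  obtain ⟨hh, D, hD⟩ := hh
  refine ⟨hg.mul hh, C * D, fun t => ?_⟩
  rw [Pi.mul_apply, norm_mul]
  exact mul_le_mul (hC t) (hD t) (norm_nonneg _) ((norm_nonneg _).trans (hC t))

theorem add {g h : ℝ → ℂ} (hg : BddMeas g) (hh : BddMeas h) : BddMeas (g + h) := by
  obtain ⟨hg, C, hC⟩ := hg
  obtain ⟨hh, D, hD⟩ := hh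
  exact ⟨hg.add hh, C + D, fun t => (norm_add_le _ _).trans (add_le_add (hC t) (hD t))⟩

theorem conj {g : ℝ → ℂ} (hg : BddMeas g) : BddMeas fun t => starRingEnd ℂ (g t) := by
  obtain ⟨hg, C, hC⟩ := hg
  exact ⟨ProjMeasure.measurable_conj hg, C, fun t => by simpa using hC t⟩

theorem indicator_of_le {g : ℝ → ℂ} (hg : Measurable g) {s : Set ℝ} (hs : MeasurableSet s) (C : ℝ)
    (hC : ∀ t ∈ s, ‖g t‖ ≤ C) : BddMeas (s.indicator g) := by
  refine ⟨hg.indicator hs, |C|, fun t => ?_⟩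
  by_cases ht : t ∈ s
  · simpa [ht] using (hC t ht).trans (le_abs_self C)
  · simp [ht]

theorem indicator_one {s : Set ℝ} (hs : MeasurableSet s) : BddMeas (s.indicator 1) :=
  indicator_of_le measurable_one hs 1 fun t _ => by simp

theorem memLp {g : ℝ → ℂ} (hg : BddMeas g) (μ : Measure ℝ) [IsFiniteMeasure μ] : MemLp g 2 μ := by
  obtain ⟨hg, C, hC⟩ := hg
  exact MemLp.of_bound hg.aestronglyMeasurable C (.of_forall hC)

theorem memLp_mul {g h : ℝ → ℂ} (hg : BddMeas g) {μ : Measure ℝ} (hh : MemLp h 2 μ) :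
    MemLp (g * h) 2 μ := by
  obtain ⟨hg, C, hC⟩ := hg
  refine hh.of_le_mul (c := C) (hg.aestronglyMeasurable.mul hh.1) (.of_forall fun t => ?_)
  rw [Pi.mul_apply, norm_mul]
  exact mul_le_mul_of_nonneg_right (hC t) (norm_nonneg _)

end BddMeas

/-! ### The bounded functional calculus and limit theorems -/

namespace ProjMeasure

variable (E : ProjMeasure H)

theorem mem_graph_integral {g : ℝ → ℂ} {hg : Measurable g} {f h : H} :
    (f, h) ∈ (E.integral g hg).graph ↔ MemLp g 2 (E.scalar f) ∧ E.app g hg f = h := by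
  rw [LinearPMap.mem_graph_iff]
  constructor
  · rintro ⟨y, hy, rfl⟩
    simp only at hy
    subst hy
    exact ⟨y.2, rfl⟩
  · rintro ⟨h1, rfl⟩
    exact ⟨⟨f, h1⟩, rfl, rfl⟩

theorem integral_congr {g h : ℝ → ℂ} (hg : Measurable g) (hh : Measurable h)
    (hgh : ∀ f, g =ᵐ[E.scalar f] h) : E.integral g hg = E.integral h hh := by
  refine LinearPMap.eq_of_eq_graph (Submodule.ext fun ⟨f, k⟩ => ?_)
  rw [mem_graph_integral, mem_graph_integral, memLp_congr_ae (hgh f)]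
  refine and_congr_right fun hf => ?_
  rw [E.app_congr hh hg (hgh f).symm hf]

theorem scalar_eq_zero_iff {f : H} {s : Set ℝ} (hs : MeasurableSet s) :
    E.scalar f s = 0 ↔ E.proj s f = 0 := by
  rw [E.scalar_apply f hs, ENNReal.ofReal_eq_zero]
  constructor
  · intro h
    have : ‖E.proj s f‖ ^ 2 = 0 := le_antisymm h (by positivity)
    simpa using this
  · intro h; simp [h]

theorem scalar_univ (f : H) : E.scalar f Set.univ = ENNReal.ofReal (‖f‖ ^ 2) := by
  rw [E.scalar_apply f MeasurableSet.univ, E.proj_univ]; rfl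

/-- The bounded operator `∫ g dE`, for a bounded Borel function `g`. -/
def op (g : ℝ → ℂ) : H →L[ℂ] H :=
  open scoped Classical in
  if h : BddMeas g then
    LinearMap.mkContinuousOfExistsBound
      { toFun := E.app g h.meas
        map_add' := fun f f' => (E.integral g h.meas).map_add
          ⟨f, h.memLp _⟩ ⟨f', h.memLp _⟩
        map_smul' := fun c f => (E.integral g h.meas).map_smul c ⟨f, h.memLp _⟩ }
      (by
        obtain ⟨C, hC⟩ := h.bdd
        have hC0 : 0 ≤ C := (norm_nonneg _).trans (hC 0)
        refine ⟨C, fun f => ?_⟩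
        change ‖E.app g h.meas f‖ ≤ _
        rw [← ENNReal.ofReal_le_ofReal_iff (by positivity), ofReal_norm, E.enorm_app _ (h.memLp _),
          mul_comm]
        refine (eLpNorm_le_of_ae_bound (.of_forall hC)).trans ?_
        rw [E.scalar_univ, ENNReal.ofReal_mul (norm_nonneg _),
          ENNReal.ofReal_rpow_of_nonneg (by positivity) (by norm_num), ← Real.rpow_natCast,
          ← Real.rpow_mul (norm_nonneg _)]
        simp)
  else 0

variable {E}

theorem op_apply {g : ℝ → ℂ} (hg : BddMeas g) (f : H) : E.op g f = E.app g hg.meas f := by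
  rw [op, dif_pos hg]; rfl

theorem enorm_op {g : ℝ → ℂ} (hg : BddMeas g) (f : H) : ‖E.op g f‖ₑ = eLpNorm g 2 (E.scalar f) := by
  rw [op_apply hg, E.enorm_app _ (hg.memLp _)]

theorem norm_op_apply_le {g : ℝ → ℂ} (hg : BddMeas g) {C : ℝ} (f : H)
    (hC : ∀ᵐ t ∂(E.scalar f), ‖g t‖ ≤ C) (hC0 : 0 ≤ C) : ‖E.op g f‖ ≤ C * ‖f‖ := by
  rw [← ENNReal.ofReal_le_ofReal_iff (by positivity), ofReal_norm, enorm_op hg, mul_comm]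
  refine (eLpNorm_le_of_ae_bound hC).trans ?_
  rw [E.scalar_univ, ENNReal.ofReal_mul (norm_nonneg _),
    ENNReal.ofReal_rpow_of_nonneg (by positivity) (by norm_num), ← Real.rpow_natCast,
    ← Real.rpow_mul (norm_nonneg _)]
  simp

theorem norm_op_le {g : ℝ → ℂ} (hg : BddMeas g) {C : ℝ}
    (hC : ∀ f, ∀ᵐ t ∂(E.scalar f), ‖g t‖ ≤ C) (hC0 : 0 ≤ C) : ‖E.op g‖ ≤ C :=
  ContinuousLinearMap.opNorm_le_bound _ hC0 fun f => norm_op_apply_le hg f (hC f) hC0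

theorem integral_eq_ofCLM {g : ℝ → ℂ} (hg : BddMeas g) :
    E.integral g hg.meas = ofCLM (E.op g) := by
  refine LinearPMap.eq_of_eq_graph (Submodule.ext fun ⟨f, k⟩ => ?_)
  rw [mem_graph_integral, mem_graph_ofCLM, op_apply hg]
  exact and_iff_right (hg.memLp _)

theorem op_congr {g h : ℝ → ℂ} (hg : BddMeas g) (hh : BddMeas h)
    (hgh : ∀ f, g =ᵐ[E.scalar f] h) : E.op g = E.op h := by
  ext f
  rw [op_apply hg, op_apply hh, E.app_congr hg.meas hh.meas (hgh f) (hg.memLp _)]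

theorem op_app {g h : ℝ → ℂ} (hg : BddMeas g) (hh : Measurable h) {f : H}
    (hf : MemLp h 2 (E.scalar f)) : E.op g (E.app h hh f) = E.app (g * h) (hg.meas.mul hh) f := by
  rw [op_apply hg, E.app_app hh hg.meas hf (hg.memLp_mul hf)]

theorem memLp_scalar_op {g h : ℝ → ℂ} (hg : BddMeas g) (hh : Measurable h) {f : H} :
    MemLp h 2 (E.scalar (E.op g f)) ↔ MemLp (h * g) 2 (E.scalar f) := by
  rw [op_apply hg, E.memLp_scalar_app hg.meas hh (hg.memLp _)]

theorem app_op {g h : ℝ → ℂ} (hg : BddMeas g) (hh : Measurable h) {f : H}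
    (hf : MemLp (h * g) 2 (E.scalar f)) :
    E.app h hh (E.op g f) = E.app (h * g) (hh.mul hg.meas) f := by
  rw [op_apply hg, E.app_app hg.meas hh (hg.memLp _) hf]

theorem op_mul {g h : ℝ → ℂ} (hg : BddMeas g) (hh : BddMeas h) :
    E.op (g * h) = E.op g * E.op h := by
  ext f
  change _ = E.op g (E.op h f)
  rw [op_apply hh, op_app hg hh.meas (hh.memLp _), op_apply (hg.mul hh)]

theorem op_mul_comm {g h : ℝ → ℂ} (hg : BddMeas g) (hh : BddMeas h) :
    E.op g * E.op h = E.op h * E.op g := by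
  rw [← op_mul hg hh, ← op_mul hh hg, mul_comm]

theorem op_add {g h : ℝ → ℂ} (hg : BddMeas g) (hh : BddMeas h) :
    E.op (g + h) = E.op g + E.op h := by
  ext f
  rw [add_apply, op_apply hg, op_apply hh, op_apply (hg.add hh),
    E.app_add hg.meas hh.meas (hg.memLp _) (hh.memLp _)]

theorem op_conj {g : ℝ → ℂ} (hg : BddMeas g) :
    ContinuousLinearMap.adjoint (E.op g) = E.op fun t => starRingEnd ℂ (g t) := by
  symm
  rw [ContinuousLinearMap.eq_adjoint_iff]
  intro f u
  have h := E.inner_app_left hg.meas (hg.memLp (E.scalar u)) (hg.memLp (E.scalar f))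
  rw [op_apply hg, op_apply hg.conj, ← inner_conj_symm, ← h, inner_conj_symm]

theorem op_indicator_const {s : Set ℝ} (hs : MeasurableSet s) (c : ℂ) :
    E.op (s.indicator fun _ => c) = c • E.proj s := by
  have hb : BddMeas (s.indicator fun _ => c) :=
    BddMeas.indicator_of_le measurable_const hs ‖c‖ fun _ _ => le_rfl
  rw [← E.simple_indicator hs]
  ext f
  rw [op_apply hb]
  refine tendsto_nhds_unique (E.tendsto_simple_app hb.meas (hb.memLp _)
    (φ := fun _ => SimpleFunc.piecewise s hs (SimpleFunc.const ℝ c) (SimpleFunc.const ℝ 0)) ?_)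
    tendsto_const_nhds
  have : (⇑(SimpleFunc.piecewise s hs (SimpleFunc.const ℝ c) (SimpleFunc.const ℝ 0)) : ℝ → ℂ)
      = s.indicator fun _ => c := by
    ext x
    by_cases h1 : x ∈ s <;> simp [h1]
  simp only [this, sub_self, eLpNorm_zero]
  exact tendsto_const_nhds

theorem op_indicator_one {s : Set ℝ} (hs : MeasurableSet s) : E.op (s.indicator 1) = E.proj s := by
  have := E.op_indicator_const hs 1
  rwa [one_smul] at this

theorem op_const (c : ℂ) : E.op (fun _ => c) = c • 1 := by
  have := E.op_indicator_const MeasurableSet.univ c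
  rwa [Set.indicator_univ, E.proj_univ] at this

theorem op_indicator {s : Set ℝ} (hs : MeasurableSet s) {g : ℝ → ℂ} (hg : BddMeas g) :
    E.op (s.indicator g) = E.proj s * E.op g := by
  rw [← op_indicator_one hs, ← op_mul (BddMeas.indicator_one hs) hg]
  congr 1
  ext t
  by_cases ht : t ∈ s <;> simp [ht]

theorem eLpNorm_two_sq (g : ℝ → ℂ) (μ : Measure ℝ) :
    eLpNorm g 2 μ ^ 2 = ∫⁻ t, ‖g t‖ₑ ^ 2 ∂μ := by
  have h1 := eLpNorm_nnreal_pow_eq_lintegral (f := g) (μ := μ) (p := 2) (by norm_num)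
  simpa using h1

theorem tendsto_app_of_dominated {g : ℕ → ℝ → ℂ} {h G : ℝ → ℂ} (hg : ∀ n, Measurable (g n))
    (hh : Measurable h) {f : H} (hG : MemLp G 2 (E.scalar f))
    (hle : ∀ n t, ‖g n t‖ ≤ ‖G t‖)
    (hlim : ∀ᵐ t ∂(E.scalar f), Tendsto (fun n => g n t) atTop (𝓝 (h t))) :
    MemLp h 2 (E.scalar f) ∧
    Tendsto (fun n => E.app (g n) (hg n) f) atTop (𝓝 (E.app h hh f)) := by
  have hgm : ∀ n, MemLp (g n) 2 (E.scalar f) := fun n =>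
    hG.of_le (hg n).aestronglyMeasurable (.of_forall (hle n))
  have hle' : ∀ᵐ t ∂(E.scalar f), ‖h t‖ ≤ ‖G t‖ := hlim.mono fun t ht =>
    le_of_tendsto ht.norm (.of_forall fun n => hle n t)
  have hhm : MemLp h 2 (E.scalar f) := hG.of_le hh.aestronglyMeasurable hle'
  refine ⟨hhm, ?_⟩
  rw [tendsto_iff_edist_tendsto_0]
  simp only [edist_eq_enorm_sub, E.enorm_app_sub (hg _) hh (hgm _) hhm]
  -- Dominated convergence is applied to the squared norm, with majorant `|2G|²`; the square root is
  -- taken at the end.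
  have key : Tendsto (fun n => eLpNorm (g n - h) 2 (E.scalar f) ^ 2) atTop (𝓝 0) := by
    simp only [eLpNorm_two_sq]
    rw [show (0 : ℝ≥0∞) = ∫⁻ t, 0 ∂(E.scalar f) by simp]
    refine tendsto_lintegral_of_dominated_convergence (fun t => ‖(2 : ℂ) * G t‖ₑ ^ 2)
      (fun n => ((hg n).sub hh).enorm.pow_const 2) (fun n => ?_) ?_ ?_
    · filter_upwards [hle'] with t ht
      have : ‖(g n - h) t‖ ≤ ‖2 * G t‖ := by
        rw [norm_mul, Complex.norm_ofNat, two_mul]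
        exact (norm_sub_le _ _).trans (add_le_add (hle n t) ht)
      exact pow_le_pow_left' (enorm_le_iff_norm_le.mpr this) 2
    · have := (hG.const_mul 2).2
      have h2 := eLpNorm_two_sq (fun t => 2 * G t) (E.scalar f)
      rw [← h2]
      exact (ENNReal.pow_lt_top this).ne
    · filter_upwards [hlim] with t ht
      have h1 : Tendsto (fun n => (g n - h) t) atTop (𝓝 0) := by
        simpa using ht.sub_const (h t)
      have h2 := (continuous_enorm.tendsto _).comp h1
      simpa [Function.comp_def] using ((ENNReal.continuous_pow 2).tendsto _).comp h2
  have h3 := ((ENNReal.continuous_rpow_const (y := (2 : ℝ)⁻¹)).tendsto 0).comp key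
  have h4 : ∀ x : ℝ≥0∞, (x ^ 2) ^ (2 : ℝ)⁻¹ = x := fun x => by
    rw [← ENNReal.rpow_natCast, ← ENNReal.rpow_mul]; simp
  simpa [Function.comp_def, h4] using h3

theorem tendsto_proj {s : ℕ → Set ℝ} (hs : ∀ n, MeasurableSet (s n)) {f : H}
    (h : ∀ᵐ t ∂(E.scalar f), ∀ᶠ n in atTop, t ∈ s n) :
    Tendsto (fun n => E.proj (s n) f) atTop (𝓝 f) := by
  have h1 := (tendsto_app_of_dominated (E := E) (f := f) (g := fun n => (s n).indicator 1) (h := 1)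
    (G := 1) (fun n => (BddMeas.indicator_one (hs n)).meas) measurable_const
    ((BddMeas.const 1).memLp _) (fun n t => ?_) ?_).2
  · simp only [← op_apply (BddMeas.indicator_one (hs _)), op_indicator_one (hs _)] at h1
    have h2 : E.app 1 measurable_const f = f := by
      have := (op_apply (E := E) (BddMeas.const 1) f).symm
      rw [op_const, one_smul] at this
      exact this
    rwa [h2] at h1
  · by_cases ht : t ∈ s n <;> simp [ht]
  · filter_upwards [h] with t ht
    refine tendsto_const_nhds.congr' ?_
    filter_upwards [ht] with n hn
    simp [hn]

/-- Fatou's lemma in L². It is the tool for proving that a vector lies in the domain of a spectral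
integral: it is enough to bound the integrals of truncations uniformly. -/
theorem memLp_of_tendsto {g : ℕ → ℝ → ℂ} {h : ℝ → ℂ} (hg : ∀ n, BddMeas (g n))
    (hh : Measurable h) {f : H} {C : ℝ} (hC : ∀ n, ‖E.op (g n) f‖ ≤ C)
    (hlim : ∀ᵐ t ∂(E.scalar f), Tendsto (fun n => g n t) atTop (𝓝 (h t))) :
    MemLp h 2 (E.scalar f) := by
  refine ⟨hh.aestronglyMeasurable, ?_⟩
  have h1 := Lp.eLpNorm_lim_le_liminf_eLpNorm (p := 2)
    (fun n => (hg n).meas.aestronglyMeasurable (μ := E.scalar f)) h hlim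
  refine h1.trans_lt ?_
  have : liminf (fun n => eLpNorm (g n) 2 (E.scalar f)) atTop
      ≤ liminf (fun _ : ℕ => ENNReal.ofReal C) atTop := by
    refine liminf_le_liminf (.of_forall fun n => ?_)
    rw [← enorm_op (hg n), ← ofReal_norm]
    exact ENNReal.ofReal_le_ofReal (hC n)
  exact this.trans_lt (by simp)

/-! ### Adjoints -/

theorem measurableSet_norm_le {g : ℝ → ℂ} (hg : Measurable g) (C : ℝ) :
    MeasurableSet {t | ‖g t‖ ≤ C} :=
  measurableSet_le hg.norm measurable_const

theorem tendsto_proj_norm_le {g : ℝ → ℂ} (hg : Measurable g) (f : H) :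
    Tendsto (fun n : ℕ => E.proj {t | ‖g t‖ ≤ n} f) atTop (𝓝 f) := by
  refine tendsto_proj (fun n => measurableSet_norm_le hg n) (.of_forall fun t => ?_)
  obtain ⟨N, hN⟩ := exists_nat_ge ‖g t‖
  filter_upwards [eventually_ge_atTop N] with n hn
  exact hN.trans (Nat.cast_le.mpr hn)

theorem indicator_mul_indicator_one (s : Set ℝ) (g : ℝ → ℂ) :
    g * s.indicator 1 = s.indicator g := by
  ext t
  by_cases ht : t ∈ s <;> simp [ht]

theorem proj_mem_domain {g : ℝ → ℂ} (hg : Measurable g) {s : Set ℝ} (hs : MeasurableSet s)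
    (hb : BddMeas (s.indicator g)) (f : H) :
    MemLp g 2 (E.scalar (E.proj s f)) ∧ E.app g hg (E.proj s f) = E.op (s.indicator g) f := by
  have h1 : MemLp (g * s.indicator 1) 2 (E.scalar f) := by
    rw [indicator_mul_indicator_one]; exact hb.memLp _
  rw [← op_indicator_one hs, memLp_scalar_op (BddMeas.indicator_one hs) hg,
    app_op (BddMeas.indicator_one hs) hg h1, op_apply hb]
  refine ⟨h1, ?_⟩
  simp only [indicator_mul_indicator_one]

theorem dense_domain_integral {g : ℝ → ℂ} (hg : Measurable g) :
    Dense ((E.integral g hg).domain : Set H) := by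
  intro f
  refine mem_closure_of_tendsto (tendsto_proj_norm_le (E := E) hg f) (.of_forall fun n => ?_)
  exact (proj_mem_domain hg (measurableSet_norm_le hg n)
    (BddMeas.indicator_of_le hg (measurableSet_norm_le hg n) n fun t ht => ht) f).1

/-- If `(u, w)` is in the graph of the adjoint, testing with the vectors `E(|g| ≤ n) v` shows that
the truncated integral of the conjugate of `g` sends `u` to `E(|g| ≤ n) w`. These vectors have norm
at most `‖w‖`, so Fatou puts `u` in the domain, and `n → ∞` gives the value. -/
theorem adjoint_integral {g : ℝ → ℂ} (hg : Measurable g) :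
    (E.integral g hg)† = E.integral (fun t => starRingEnd ℂ (g t)) (measurable_conj hg) := by
  refine LinearPMap.eq_of_eq_graph (Submodule.ext fun ⟨u, w⟩ => ?_)
  rw [mem_graph_adjoint_iff (dense_domain_integral hg), mem_graph_integral]
  constructor
  · intro h
    have hs := fun n : ℕ => measurableSet_norm_le hg (n : ℝ)
    have hb := fun n : ℕ => BddMeas.indicator_of_le hg (hs n) n fun t ht => ht
    have hcc : ∀ n : ℕ, (fun t => starRingEnd ℂ ({t | ‖g t‖ ≤ n}.indicator g t))
        = {t | ‖g t‖ ≤ n}.indicator (fun t => starRingEnd ℂ (g t)) := fun n => by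
      ext t
      by_cases ht : t ∈ {t | ‖g t‖ ≤ (n : ℝ)}
      · simp only [Set.indicator_of_mem ht]
      · simp only [Set.indicator_of_notMem ht, map_zero]
    have key : ∀ n : ℕ, E.op ({t | ‖g t‖ ≤ n}.indicator fun t => starRingEnd ℂ (g t)) u
        = E.proj {t | ‖g t‖ ≤ n} w := fun n => by
      refine ext_inner_right ℂ fun v => ?_
      obtain ⟨h1, h2⟩ := proj_mem_domain (E := E) hg (hs n) (hb n) v
      have h3 := h ⟨_, h1⟩
      have h4 : E.integral g hg ⟨_, h1⟩ = _ := h2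
      rw [h4] at h3
      rw [← hcc, ← op_conj (hb n), ContinuousLinearMap.adjoint_inner_left, ← h3,
        ← ContinuousLinearMap.adjoint_inner_left, E.adjoint_proj (hs n)]
    have hm : MemLp (fun t => starRingEnd ℂ (g t)) 2 (E.scalar u) := by
      refine memLp_of_tendsto (g := fun n : ℕ => {t | ‖g t‖ ≤ n}.indicator
        fun t => starRingEnd ℂ (g t)) (fun n => hcc n ▸ (hb n).conj) (measurable_conj hg)
        (C := ‖w‖) (fun n => ?_) (.of_forall fun t => ?_)
      · rw [key]
        have := (E.isStarProjection _ (hs n)).norm_le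
        exact ((E.proj _).le_opNorm w).trans (mul_le_of_le_one_left (norm_nonneg _) this)
      · refine tendsto_const_nhds.congr' ?_
        obtain ⟨N, hN⟩ := exists_nat_ge ‖g t‖
        filter_upwards [eventually_ge_atTop N] with n hn
        rw [Set.indicator_of_mem]
        exact hN.trans (Nat.cast_le.mpr hn)
    refine ⟨hm, ?_⟩
    refine tendsto_nhds_unique (tendsto_proj_norm_le (E := E) hg _)
      ((tendsto_proj_norm_le (E := E) hg w).congr fun n => ?_)
    rw [← key, ← op_indicator_one (hs n), op_app (BddMeas.indicator_one (hs n)) _ hm,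
      op_apply (hcc n ▸ (hb n).conj)]
    congr 1
    rw [mul_comm, indicator_mul_indicator_one]
  · rintro ⟨h1, rfl⟩ x
    have h2 : MemLp g 2 (E.scalar u) := by simpa using memLp_conj h1
    rw [← inner_conj_symm, ← E.inner_app_left hg x.2 h2, inner_conj_symm]
    rfl

/-- The operator is itself an adjoint, namely that of the integral of the conjugate function. -/
theorem isClosed_integral {g : ℝ → ℂ} (hg : Measurable g) : (E.integral g hg).IsClosed := by
  have h := adjoint_integral (E := E) (measurable_conj hg)
  simp only [Complex.conj_conj] at h
  rw [← h]
  exact LinearPMap.adjoint_isClosed (dense_domain_integral _)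

/-- `∫ λ dE` is self-adjoint. -/
theorem isSelfAdjoint_integral_ofReal :
    (E.integral (fun t => (t : ℂ)) Complex.measurable_ofReal)†
      = E.integral (fun t => (t : ℂ)) Complex.measurable_ofReal := by
  rw [adjoint_integral]
  simp only [Complex.conj_ofReal]

end ProjMeasure

/-! ### Image measures, and passage of intertwining relations to spectral projections -/

namespace ProjMeasure

/-- The image of a projection-valued measure under a Borel map. -/
def map (E : ProjMeasure H) (φ : ℝ → ℝ) (hφ : Measurable φ) : ProjMeasure H where
  proj s := E.proj (φ ⁻¹' s)
  isStarProjection s hs := E.isStarProjection _ (hφ hs)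
  proj_univ := by simp [E.proj_univ]
  hasSum_iUnion s hs hd f := by
    rw [Set.preimage_iUnion]
    exact E.hasSum_iUnion _ (fun n => hφ (hs n)) (fun i j hij => (hd hij).preimage φ) f

variable {E E' : ProjMeasure H}

theorem scalar_map {φ : ℝ → ℝ} (hφ : Measurable φ) (f : H) :
    (E.map φ hφ).scalar f = (E.scalar f).map φ := by
  refine Measure.ext fun s hs => ?_
  rw [Measure.map_apply hφ hs, scalar_apply _ _ hs, scalar_apply _ _ (hφ hs)]
  rfl

theorem simple_map {φ : ℝ → ℝ} (hφ : Measurable φ) (ψ : SimpleFunc ℝ ℂ) :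
    (E.map φ hφ).simple ψ = E.simple (ψ.comp φ hφ) := by
  induction ψ using SimpleFunc.induction with
  | const c hs =>
    rename_i s
    have : (SimpleFunc.piecewise s hs (SimpleFunc.const ℝ c) (SimpleFunc.const ℝ 0)).comp φ hφ
        = SimpleFunc.piecewise (φ ⁻¹' s) (hφ hs) (SimpleFunc.const ℝ c) (SimpleFunc.const ℝ 0) := by
      ext x
      by_cases h1 : φ x ∈ s <;> simp [h1]
    rw [this, simple_indicator, simple_indicator]
    rfl
  | add _ h1 h2 =>
    rename_i ψ₁ ψ₂ _
    have : (ψ₁ + ψ₂).comp φ hφ = ψ₁.comp φ hφ + ψ₂.comp φ hφ := rfl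
    rw [this, simple_add, simple_add, h1, h2]

theorem memLp_scalar_map {φ : ℝ → ℝ} (hφ : Measurable φ) {g : ℝ → ℂ} (hg : Measurable g) {f : H} :
    MemLp g 2 ((E.map φ hφ).scalar f) ↔ MemLp (g ∘ φ) 2 (E.scalar f) := by
  rw [scalar_map]
  exact memLp_map_measure_iff hg.aestronglyMeasurable hφ.aemeasurable

theorem app_map {φ : ℝ → ℝ} (hφ : Measurable φ) {g : ℝ → ℂ} (hg : Measurable g) {f : H}
    (hf : MemLp (g ∘ φ) 2 (E.scalar f)) :
    (E.map φ hφ).app g hg f = E.app (g ∘ φ) (hg.comp hφ) f := by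
  have hf' := (memLp_scalar_map hφ hg).mpr hf
  refine tendsto_nhds_unique (tendsto_approx _ hg hf') ?_
  simp only [simple_map]
  refine E.tendsto_simple_app _ hf ?_
  refine (tendsto_eLpNorm_approx hg hf').congr fun n => ?_
  rw [scalar_map, eLpNorm_map_measure
    ((SimpleFunc.measurable _).sub hg).aestronglyMeasurable hφ.aemeasurable]
  rfl

theorem integral_map {φ : ℝ → ℝ} (hφ : Measurable φ) {g : ℝ → ℂ} (hg : Measurable g) :
    (E.map φ hφ).integral g hg = E.integral (g ∘ φ) (hg.comp hφ) := by
  refine LinearPMap.eq_of_eq_graph (Submodule.ext fun ⟨f, k⟩ => ?_)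
  rw [mem_graph_integral, mem_graph_integral, memLp_scalar_map hφ hg]
  refine and_congr_right fun hf => ?_
  rw [app_map hφ hg hf]

/-! ### Intertwining -/

/-- Intertwining the projections makes the scalar measure of `B f` at most `‖B‖²` times that of `f`;
hence `B` respects the domains, and the equation holds already for simple functions. -/
theorem intertwines_integral {B : H →L[ℂ] H}
    (hB : ∀ s, MeasurableSet s → B * E.proj s = E'.proj s * B) {g : ℝ → ℂ} (hg : Measurable g) :
    Intertwines B (E.integral g hg) (E'.integral g hg) := by
  intro f h hf
  rw [mem_graph_integral] at *
  obtain ⟨hf, rfl⟩ := hf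
  have hB' : ∀ s, MeasurableSet s → ∀ f, E'.proj s (B f) = B (E.proj s f) := fun s hs f =>
    (congrArg (fun A : H →L[ℂ] H => A f) (hB s hs)).symm
  have hle : E'.scalar (B f) ≤ ENNReal.ofReal (‖B‖ ^ 2) • E.scalar f := by
    refine Measure.le_iff.mpr fun s hs => ?_
    rw [Measure.smul_apply, scalar_apply _ _ hs, scalar_apply _ _ hs, smul_eq_mul,
      ← ENNReal.ofReal_mul (by positivity), hB' s hs, ← mul_pow]
    exact ENNReal.ofReal_le_ofReal
      (pow_le_pow_left₀ (norm_nonneg _) (B.le_opNorm _) 2)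
  have hm : MemLp g 2 (E'.scalar (B f)) :=
    (hf.smul_measure ENNReal.ofReal_ne_top).mono_measure hle
  refine ⟨hm, tendsto_nhds_unique (E'.tendsto_approx hg hm) ?_⟩
  refine ((B.continuous.tendsto _).comp (E.tendsto_approx hg hf)).congr fun n => ?_
  simp [simple, sum_apply, hB' _ (SimpleFunc.measurableSet_fiber _ _)]

/-- On the spectral subspace of `|λ - c| ≥ ρ` the operator minus `c` is bounded below by `ρ`. The
counterpart for a ball, where it is bounded above by `r` and leaves the subspace invariant, is
`exists_mem_graph_of_proj_closedBall`. -/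
theorem mul_norm_proj_le {c ρ : ℝ} (hρ : 0 ≤ ρ) {u w : H}
    (h : (u, w) ∈ (E.integral (fun t => (t : ℂ)) Complex.measurable_ofReal).graph) :
    ρ * ‖E.proj {t | ρ ≤ |t - c|} u‖ ≤ ‖E.proj {t | ρ ≤ |t - c|} (w - (c : ℂ) • u)‖ := by
  obtain ⟨h1, rfl⟩ := (mem_graph_integral _).mp h
  have hs : MeasurableSet {t : ℝ | ρ ≤ |t - c|} :=
    measurableSet_le measurable_const (by fun_prop)
  have hc : E.app (fun _ => -(c : ℂ)) measurable_const u = -(c : ℂ) • u := by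
    have := op_apply (E := E) (BddMeas.const (-(c : ℂ))) u
    rw [op_const] at this
    exact this.symm
  have h2 := E.app_add Complex.measurable_ofReal measurable_const h1
    ((BddMeas.const (-(c : ℂ))).memLp _)
  rw [hc, neg_smul, ← sub_eq_add_neg] at h2
  rw [← h2]
  have hm := h1.add ((BddMeas.const (-(c : ℂ))).memLp (E.scalar u))
  have h3 := E.scalar_app (Complex.measurable_ofReal.add measurable_const) hm
  have h4 := congrArg (fun μ : Measure ℝ => μ {t : ℝ | ρ ≤ |t - c|}) h3
  simp only [scalar_apply _ _ hs, withDensity_apply _ hs] at h4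
  have h5 : ENNReal.ofReal (ρ ^ 2) * E.scalar u {t : ℝ | ρ ≤ |t - c|}
      ≤ ∫⁻ t in {t : ℝ | ρ ≤ |t - c|}, ‖(Complex.ofReal + fun _ : ℝ => -(c : ℂ)) t‖ₑ ^ 2
        ∂(E.scalar u) := by
    rw [← setLIntegral_const]
    refine setLIntegral_mono' hs fun t ht => ?_
    rw [ENNReal.ofReal_pow hρ]
    refine pow_le_pow_left' ?_ 2
    rw [← ofReal_norm]
    refine ENNReal.ofReal_le_ofReal ?_
    have : (Complex.ofReal + fun _ : ℝ => -(c : ℂ)) t = ((t - c : ℝ) : ℂ) := by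
      simp [sub_eq_add_neg]
    rw [this, Complex.norm_real]
    exact ht
  rw [← h4, scalar_apply _ _ hs, ← ENNReal.ofReal_mul (by positivity),
    ENNReal.ofReal_le_ofReal_iff (by positivity), ← mul_pow] at h5
  exact (pow_le_pow_iff_left₀ (by positivity) (by positivity) two_ne_zero).mp h5

theorem exists_mem_graph_of_proj_closedBall {c r : ℝ} (hr : 0 ≤ r) {f : H}
    (hf : E.proj {t | |t - c| ≤ r} f = f) :
    ∃ k, (f, k + (c : ℂ) • f) ∈ (E.integral (fun t => (t : ℂ)) Complex.measurable_ofReal).graph ∧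
      E.proj {t | |t - c| ≤ r} k = k ∧ ‖k‖ ≤ r * ‖f‖ := by
  set I := {t : ℝ | |t - c| ≤ r} with hI
  have hs : MeasurableSet I := measurableSet_le (by fun_prop) measurable_const
  set m : ℝ → ℂ := I.indicator fun t => ((t - c : ℝ) : ℂ) with hm
  have hmb : ∀ t, ‖m t‖ ≤ r := fun t => by
    by_cases ht : t ∈ I
    · rw [hm, Set.indicator_of_mem ht, Complex.norm_real]; exact ht
    · rw [hm, Set.indicator_of_notMem ht, norm_zero]; exact hr
  have hmB : BddMeas m :=
    ⟨(Complex.measurable_ofReal.comp (by fun_prop)).indicator hs, r, hmb⟩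
  have hcB : BddMeas (I.indicator fun _ => (c : ℂ)) :=
    BddMeas.indicator_of_le measurable_const hs |c| fun t _ => by simp
  have hadd : I.indicator (fun t : ℝ => (t : ℂ)) = m + I.indicator fun _ => (c : ℂ) := by
    ext t
    by_cases ht : t ∈ I <;> simp [hm, ht]
  have hb : BddMeas (I.indicator fun t : ℝ => (t : ℂ)) := hadd ▸ hmB.add hcB
  refine ⟨E.op m f, ?_, ?_, ?_⟩
  · rw [mem_graph_integral]
    have h := proj_mem_domain (E := E) Complex.measurable_ofReal hs hb f
    rw [hf, hadd, op_add hmB hcB, op_indicator_const hs, add_apply, smul_apply, hf] at h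
    exact h
  · change (E.proj I * E.op m) f = _
    rw [← op_indicator hs hmB]
    congr 2
    rw [hm, Set.indicator_indicator, Set.inter_self]
  · exact norm_op_apply_le hmB f (.of_forall hmb) hr

/-- Apply the `n`-th power of the operator minus `c`: it grows at most like `r^n` on `f` but at
least like `ρ^n` on the projected part of `B f`. As `r < ρ`, that part must vanish. -/
theorem proj_eq_zero_of_intertwines {B : H →L[ℂ] H}
    (hB : Intertwines B (E.integral (fun t => (t : ℂ)) Complex.measurable_ofReal)
      (E'.integral (fun t => (t : ℂ)) Complex.measurable_ofReal)) {c r ρ : ℝ} (hr : 0 ≤ r)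
    (hρ : r < ρ) (f : H) (hf : E.proj {t | |t - c| ≤ r} f = f) :
    E'.proj {t | ρ ≤ |t - c|} (B f) = 0 := by
  have hρ0 : 0 < ρ := hr.trans_lt hρ
  have hs : MeasurableSet {t : ℝ | ρ ≤ |t - c|} :=
    measurableSet_le measurable_const (by fun_prop)
  -- Quantified over all vectors of the spectral subspace, so that the induction can replace `f` by
  -- its image under the operator minus `c`.
  have key : ∀ n : ℕ, ∀ f : H, E.proj {t | |t - c| ≤ r} f = f →
      ρ ^ n * ‖E'.proj {t | ρ ≤ |t - c|} (B f)‖ ≤ ‖B‖ * (r ^ n * ‖f‖) := by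
    intro n
    induction n with
    | zero =>
      intro f hf
      have := (E'.isStarProjection _ hs).norm_le
      have h1 := ((E'.proj {t | ρ ≤ |t - c|}).le_opNorm (B f)).trans
        (mul_le_of_le_one_left (norm_nonneg _) this)
      simpa using h1.trans (B.le_opNorm f)
    | succ n ih =>
      intro f hf
      obtain ⟨k, h1, h2, h3⟩ := exists_mem_graph_of_proj_closedBall hr hf
      have h4 := mul_norm_proj_le (c := c) hρ0.le (hB _ _ h1)
      rw [map_add, map_smul, add_sub_cancel_right] at h4
      calc ρ ^ (n + 1) * ‖E'.proj {t | ρ ≤ |t - c|} (B f)‖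
          = ρ ^ n * (ρ * ‖E'.proj {t | ρ ≤ |t - c|} (B f)‖) := by ring
        _ ≤ ρ ^ n * ‖E'.proj {t | ρ ≤ |t - c|} (B k)‖ := by gcongr
        _ ≤ ‖B‖ * (r ^ n * ‖k‖) := ih k h2
        _ ≤ ‖B‖ * (r ^ n * (r * ‖f‖)) := by gcongr
        _ = _ := by ring
  have h0 : ‖E'.proj {t | ρ ≤ |t - c|} (B f)‖ ≤ 0 := by
    have hlim : Tendsto (fun n : ℕ => (r / ρ) ^ n * (‖B‖ * ‖f‖)) atTop (𝓝 0) := by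
      simpa using (tendsto_pow_atTop_nhds_zero_of_lt_one (by positivity)
        ((div_lt_one hρ0).mpr hρ)).mul_const (‖B‖ * ‖f‖)
    refine ge_of_tendsto' hlim fun n => ?_
    have := key n f hf
    rw [div_pow, div_mul_eq_mul_div, le_div_iff₀ (by positivity)]
    linarith
  simpa using h0

theorem proj_compl {s : Set ℝ} (hs : MeasurableSet s) : E.proj sᶜ = 1 - E.proj s := by
  have := E.proj_union hs hs.compl disjoint_compl_right
  rw [Set.union_compl_self, E.proj_univ] at this
  rw [this]; abel

theorem proj_compl_mul_of_intertwines {B : H →L[ℂ] H}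
    (hB : Intertwines B (E.integral (fun t => (t : ℂ)) Complex.measurable_ofReal)
      (E'.integral (fun t => (t : ℂ)) Complex.measurable_ofReal)) {c r : ℝ} (hr : 0 ≤ r) :
    E'.proj {t | |t - c| ≤ r}ᶜ * B * E.proj {t | |t - c| ≤ r} = 0 := by
  have hI : MeasurableSet {t : ℝ | |t - c| ≤ r} := measurableSet_le (by fun_prop) measurable_const
  ext f
  have hf : E.proj {t | |t - c| ≤ r} (E.proj {t | |t - c| ≤ r} f) = E.proj {t | |t - c| ≤ r} f :=
    congrArg (fun A : H →L[ℂ] H => A f) (E.proj_mul_self hI)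
  change E'.proj {t | |t - c| ≤ r}ᶜ (B (E.proj {t | |t - c| ≤ r} f)) = 0
  have hU : {t : ℝ | |t - c| ≤ r}ᶜ = ⋃ n : ℕ, {t : ℝ | r + 1 / ((n : ℝ) + 1) ≤ |t - c|} := by
    ext t
    simp only [Set.mem_compl_iff, Set.mem_ofPred_eq, not_le, Set.mem_iUnion]
    constructor
    · intro h
      obtain ⟨n, hn⟩ := exists_nat_one_div_lt (sub_pos.mpr h)
      exact ⟨n, by linarith⟩
    · rintro ⟨n, hn⟩
      have : (0 : ℝ) < 1 / ((n : ℝ) + 1) := by positivity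
      linarith
  rw [← scalar_eq_zero_iff _ hI.compl, hU, measure_iUnion_null_iff]
  intro n
  rw [scalar_eq_zero_iff _ (measurableSet_le measurable_const (by fun_prop))]
  have : (0 : ℝ) < 1 / ((n : ℝ) + 1) := by positivity
  exact proj_eq_zero_of_intertwines hB hr (by linarith) _ hf

/-- The growth argument gives one off-diagonal block of `B` with respect to a closed ball; applied
to the adjoint of `B`, which intertwines in the other direction, it gives the other block. So `B`
intertwines the projections of closed intervals, and these generate the Borel sets. No uniqueness of
spectral measures has to be known beforehand. -/
theorem mul_proj_of_intertwines {B : H →L[ℂ] H}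
    (hB : Intertwines B (E.integral (fun t => (t : ℂ)) Complex.measurable_ofReal)
      (E'.integral (fun t => (t : ℂ)) Complex.measurable_ofReal)) {s : Set ℝ}
    (hs : MeasurableSet s) : B * E.proj s = E'.proj s * B := by
  have hB' := hB.adjoint (dense_domain_integral _) (dense_domain_integral _)
  rw [isSelfAdjoint_integral_ofReal, isSelfAdjoint_integral_ofReal] at hB'
  have hball : ∀ c r : ℝ, 0 ≤ r →
      B * E.proj {t | |t - c| ≤ r} = E'.proj {t | |t - c| ≤ r} * B := by
    intro c r hr
    have hI : MeasurableSet {t : ℝ | |t - c| ≤ r} :=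
      measurableSet_le (by fun_prop) measurable_const
    have h1 := proj_compl_mul_of_intertwines (c := c) hB hr
    have h2 := congrArg star (proj_compl_mul_of_intertwines (c := c) hB' hr)
    simp only [star_mul, (isStarProjection _ _ hI).isSelfAdjoint.star_eq,
      (isStarProjection _ _ hI.compl).isSelfAdjoint.star_eq, ContinuousLinearMap.star_eq_adjoint,
      ContinuousLinearMap.adjoint_adjoint, star_zero] at h2
    rw [proj_compl hI, sub_mul, sub_mul, one_mul, sub_eq_zero] at h1
    rw [proj_compl hI, mul_sub, mul_sub, mul_one, sub_eq_zero] at h2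
    rw [h1, mul_assoc, h2]
  have hgen := Dense.borel_eq_generateFrom_Icc_mem (α := ℝ) dense_univ
  refine MeasurableSpace.induction_on_inter (C := fun s _ => B * E.proj s = E'.proj s * B)
    ((BorelSpace.measurable_eq).trans hgen) (isPiSystem_Icc_mem _ _) ?_ ?_ ?_ ?_ s hs
  · ext f; simp [proj_empty]
  · rintro _ ⟨a, -, b, -, hab, rfl⟩
    have : Set.Icc a b = {t : ℝ | |t - (a + b) / 2| ≤ (b - a) / 2} := by
      ext t
      simp only [Set.mem_Icc, Set.mem_ofPred_eq, abs_le]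
      constructor <;> rintro ⟨h1, h2⟩ <;> constructor <;> linarith
    rw [this]
    exact hball _ _ (by linarith)
  · intro t ht h
    rw [proj_compl ht, proj_compl ht, mul_sub, sub_mul, h, mul_one, one_mul]
  · intro t hd ht h
    ext f
    have h1 := (E.hasSum_iUnion t ht hd f).mapL B
    have h2 := E'.hasSum_iUnion t ht hd (B f)
    have h3 : ∀ n, E'.proj (t n) (B f) = B (E.proj (t n) f) := fun n =>
      (congrArg (fun A : H →L[ℂ] H => A f) (h n)).symm
    simp only [h3] at h2
    exact h1.unique h2

end ProjMeasure

/-! ### Projections determined by quadratic forms -/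

theorem clm_ext_inner_self {A B : H →L[ℂ] H} (h : ∀ f, inner ℂ f (A f) = inner ℂ f (B f)) :
    A = B := by
  have : (A : H →ₗ[ℂ] H) = B := by
    rw [← ext_inner_map]
    intro f
    have := congrArg (starRingEnd ℂ) (h f)
    rwa [inner_conj_symm, inner_conj_symm] at this
  ext f
  exact congrArg (fun C : H →ₗ[ℂ] H => C f) this

/-- The quadratic form is real, so `P` is self-adjoint; and it equals that of `P* P = P²`, so `P` is
idempotent by polarization. -/
theorem isStarProjection_of_inner_eq {P : H →L[ℂ] H}
    (h : ∀ f, inner ℂ f (P f) = ((‖P f‖ ^ 2 : ℝ) : ℂ)) : IsStarProjection P := by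
  have hsa : IsSelfAdjoint P := by
    rw [ContinuousLinearMap.isSelfAdjoint_iff_isSymmetric,
      LinearMap.isSymmetric_iff_inner_map_self_real]
    intro f
    change starRingEnd ℂ (inner ℂ (P f) f) = inner ℂ (P f) f
    rw [inner_conj_symm, ← inner_conj_symm (P f) f, h f, Complex.conj_ofReal]
  refine ⟨?_, hsa⟩
  refine clm_ext_inner_self fun f => ?_
  change inner ℂ f (P (P f)) = _
  have hP : ContinuousLinearMap.adjoint P = P := hsa
  conv_lhs => rw [← hP, ContinuousLinearMap.adjoint_inner_right, hP]
  rw [h f, inner_self_eq_norm_sq_to_K]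
  norm_cast

theorem IsStarProjection.inner_eq {P : H →L[ℂ] H} (hP : IsStarProjection P) (f : H) :
    inner ℂ f (P f) = ((‖P f‖ ^ 2 : ℝ) : ℂ) := by
  have h1 : P (P f) = P f := congrArg (fun A : H →L[ℂ] H => A f) hP.isIdempotentElem
  have h2 : ContinuousLinearMap.adjoint P = P := hP.isSelfAdjoint
  rw [← h1, ← ContinuousLinearMap.adjoint_inner_left, h2, h1, inner_self_eq_norm_sq_to_K]
  norm_cast

/-- A countable orthogonal family of projections is strongly summable. -/
theorem exists_hasSum_of_orthogonal_projections {P : ℕ → H →L[ℂ] H} {a : H → ℝ}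
    (hP : ∀ n, IsStarProjection (P n)) (horth : ∀ i j, i ≠ j → P i * P j = 0)
    (ha : ∀ f, HasSum (fun n => ‖P n f‖ ^ 2) (a f)) :
    ∃ R : H →L[ℂ] H, IsStarProjection R ∧ (∀ f, HasSum (fun n => P n f) (R f)) ∧
      ∀ f, ‖R f‖ ^ 2 = a f := by
  have hin : ∀ i j f, i ≠ j → inner ℂ (P i f) (P j f) = 0 := fun i j f hij => by
    have h2 : ContinuousLinearMap.adjoint (P i) = P i := (hP i).isSelfAdjoint
    rw [← ContinuousLinearMap.adjoint_inner_right, h2]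
    have : P i (P j f) = 0 := congrArg (fun A : H →L[ℂ] H => A f) (horth i j hij)
    rw [this, inner_zero_right]
  have hnorm : ∀ (t : Finset ℕ) f, ‖∑ n ∈ t, P n f‖ ^ 2 = ∑ n ∈ t, ‖P n f‖ ^ 2 := fun t f => by
    have : inner ℂ (∑ n ∈ t, P n f) (∑ n ∈ t, P n f)
        = ((∑ n ∈ t, ‖P n f‖ ^ 2 : ℝ) : ℂ) := by
      simp only [sum_inner, inner_sum]
      push_cast
      refine Finset.sum_congr rfl fun i hi => ?_
      rw [Finset.sum_eq_single i (fun j _ hj => hin j i f hj) (fun h => absurd hi h),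
        inner_self_eq_norm_sq_to_K]
      rfl
    rw [inner_self_eq_norm_sq_to_K] at this
    exact Complex.ofReal_injective (by rw [← this]; norm_cast)
  have hsum : ∀ f, Summable fun n => P n f := fun f => by
    rw [summable_iff_vanishing_norm]
    intro ε hε
    obtain ⟨s, hs⟩ := summable_iff_vanishing_norm.mp (ha f).summable (ε ^ 2) (by positivity)
    refine ⟨s, fun t ht => ?_⟩
    have := (le_abs_self _).trans_lt (hs t ht)
    rw [← hnorm] at this
    exact lt_of_pow_lt_pow_left₀ 2 hε.le this
  let R : H →L[ℂ] H := continuousLinearMapOfTendsto (l := atTop)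
    (fun N : ℕ => ∑ n ∈ Finset.range N, P n) (f := fun f => ∑' n, P n f) (by
      rw [tendsto_pi_nhds]
      intro f
      simpa [sum_apply] using (hsum f).hasSum.tendsto_sum_nat)
  have hR : ∀ f, HasSum (fun n => P n f) (R f) := fun f => (hsum f).hasSum
  have hRin : ∀ f, inner ℂ f (R f) = (a f : ℂ) := fun f => by
    have h1 := (hR f).mapL (innerSL ℂ f)
    simp only [innerSL_apply_apply, (hP _).inner_eq] at h1
    exact h1.unique (Complex.hasSum_ofReal.mpr (ha f))
  have hPR : ∀ m f, P m (R f) = P m f := fun m f => by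
    have h1 := (hR f).mapL (P m)
    refine h1.unique ?_
    have h2 := hasSum_single (f := fun n => P m (P n f)) m fun n hn =>
      congrArg (fun A : H →L[ℂ] H => A f) (horth m n hn.symm)
    have h3 : P m (P m f) = P m f := congrArg (fun A : H →L[ℂ] H => A f) (hP m).isIdempotentElem
    rwa [h3] at h2
  have hRa : ∀ f, ‖R f‖ ^ 2 = a f := fun f => by
    have h1 := (hR f).mapL (innerSL ℂ (R f))
    simp only [innerSL_apply_apply] at h1
    have h2 : ∀ n, inner ℂ (R f) (P n f) = ((‖P n f‖ ^ 2 : ℝ) : ℂ) := fun n => by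
      rw [← hPR n f, (hP n).inner_eq]
    simp only [h2] at h1
    have h3 := h1.unique (Complex.hasSum_ofReal.mpr (ha f))
    rw [inner_self_eq_norm_sq_to_K] at h3
    exact Complex.ofReal_injective (by rw [← h3]; norm_cast)
  exact ⟨R, isStarProjection_of_inner_eq fun f => by rw [hRin, hRa], hR, hRa⟩

theorem hasSum_measureReal_iUnion {X : Type*} [MeasurableSpace X] {μ : Measure X}
    [IsFiniteMeasure μ] {t : ℕ → Set X} (hd : Pairwise (Function.onFun Disjoint t))
    (ht : ∀ n, MeasurableSet (t n)) :
    HasSum (fun n => μ.real (t n)) (μ.real (⋃ n, t n)) := by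
  have h := measure_iUnion hd ht (μ := μ)
  have h1 : ∑' n, μ (t n) ≠ ∞ := h ▸ measure_ne_top _ _
  rw [measureReal_def, h, ENNReal.tsum_toReal_eq (fun n => measure_ne_top _ _)]
  exact ENNReal.hasSum_toReal h1

/-! ### Spectral projections from a representation of continuous functions -/

section Representation

open scoped CompactlySupported

variable {X : Type*} [TopologicalSpace X] [CompactSpace X] [T2Space X] [MeasurableSpace X]
  [BorelSpace X] (Φ : C(X, ℝ) →⋆ₐ[ℝ] (H →L[ℂ] H))

theorem adjoint_rep (φ : C(X, ℝ)) : ContinuousLinearMap.adjoint (Φ φ) = Φ φ := by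
  have h := map_star Φ φ
  rw [star_trivial] at h
  exact h.symm

theorem inner_rep_mul_self (φ : C(X, ℝ)) (f : H) :
    inner ℂ f (Φ (φ * φ) f) = ((‖Φ φ f‖ ^ 2 : ℝ) : ℂ) := by
  rw [map_mul]
  change inner ℂ f (Φ φ (Φ φ f)) = _
  rw [← ContinuousLinearMap.adjoint_inner_left, adjoint_rep, inner_self_eq_norm_sq_to_K]
  norm_cast

theorem re_inner_rep (φ : C(X, ℝ)) (f : H) :
    (((inner ℂ f (Φ φ f)).re : ℝ) : ℂ) = inner ℂ f (Φ φ f) := by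
  refine Complex.conj_eq_iff_re.mp ?_
  rw [inner_conj_symm, ← ContinuousLinearMap.adjoint_inner_right, adjoint_rep]

/-- The positive functional `φ ↦ ⟨f, Φ(φ) f⟩`. -/
def repFunctional (f : H) : C_c(X, ℝ) →ₚ[ℝ] ℝ :=
  PositiveLinearMap.mk₀
    { toFun := fun φ => (inner ℂ f (Φ φ.toContinuousMap f)).re
      map_add' := fun φ ψ => by
        have : (φ + ψ).toContinuousMap = φ.toContinuousMap + ψ.toContinuousMap := rfl
        rw [this, map_add, add_apply, inner_add_right, Complex.add_re]
      map_smul' := fun c φ => by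
        have : (c • φ).toContinuousMap = c • φ.toContinuousMap := rfl
        rw [this, map_smul, smul_apply, ← Complex.coe_smul, inner_smul_right,
          Complex.re_ofReal_mul]
        rfl }
    (fun φ hφ => by
      let ψ : C(X, ℝ) := ⟨fun x => √(φ x), φ.continuous.sqrt⟩
      have : φ.toContinuousMap = ψ * ψ := by
        ext x
        exact (Real.mul_self_sqrt (hφ x)).symm
      change 0 ≤ (inner ℂ f (Φ φ.toContinuousMap f)).re
      rw [this, inner_rep_mul_self, Complex.ofReal_re]
      positivity)

/-- The measure representing `φ ↦ ⟨f, Φ(φ) f⟩`. -/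
def repMeasure (f : H) : Measure X := RealRMK.rieszMeasure (repFunctional Φ f)

instance (f : H) : IsFiniteMeasure (repMeasure Φ f) := by
  unfold repMeasure
  infer_instance

theorem integral_repMeasure (φ : C(X, ℝ)) (f : H) :
    ((∫ x, φ x ∂(repMeasure Φ f) : ℝ) : ℂ) = inner ℂ f (Φ φ f) := by
  have := RealRMK.integral_rieszMeasure (repFunctional Φ f)
    (CompactlySupportedContinuousMap.continuousMapEquiv φ)
  rw [← re_inner_rep]
  congr 1

theorem integral_sq_repMeasure (φ : C(X, ℝ)) (f : H) :
    ∫ x, φ x ^ 2 ∂(repMeasure Φ f) = ‖Φ φ f‖ ^ 2 := by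
  have := integral_repMeasure Φ (φ * φ) f
  rw [inner_rep_mul_self] at this
  rw [← Complex.ofReal_injective this]
  simp [sq]

theorem repMeasure_univ (f : H) : (repMeasure Φ f).real Set.univ = ‖f‖ ^ 2 := by
  have := integral_sq_repMeasure Φ 1 f
  simpa using this

variable {Φ} in
/-- Two projections that represent disjoint sets are orthogonal. -/
theorem mul_eq_zero_of_repMeasure {P R : H →L[ℂ] H} {s t : Set X} (ht : MeasurableSet t)
    (hd : Disjoint s t) (hR : IsStarProjection R)
    (hPs : ∀ f, ‖P f‖ ^ 2 = (repMeasure Φ f).real s)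
    (hRt : ∀ f, ‖R f‖ ^ 2 = (repMeasure Φ f).real t) : P * R = 0 := by
  ext f
  change P (R f) = 0
  have h1 : R (R f) = R f := congrArg (fun A : H →L[ℂ] H => A f) hR.isIdempotentElem
  -- The measure of the vector `R f` has total mass `‖R f‖²`, and `t` already carries all of it, so
  -- nothing is left for the disjoint set `s`.
  have h2 : ‖P (R f)‖ ^ 2 + ‖R (R f)‖ ^ 2 ≤ ‖R f‖ ^ 2 := by
    rw [hPs, hRt, ← measureReal_union hd ht, ← repMeasure_univ Φ]
    exact measureReal_mono (Set.subset_univ _)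
  rw [h1] at h2
  have h3 : ‖P (R f)‖ ^ 2 = 0 := le_antisymm (by linarith) (by positivity)
  simpa using h3

/-- Approximate the indicator of `F` by continuous functions `φ n` with values in `[0,1]`. The
vectors `Φ (φ n) f` are Cauchy because norms of `Φ` are L² norms for the representing measure. Both
`∫ φ n` and `∫ (φ n)²` tend to the mass of `F`, so the limit satisfies `⟨f, P f⟩ = ‖P f‖²` and is a
projection. -/
theorem exists_projection_of_isClosed [HasOuterApproxClosed X] {F : Set X} (hF : IsClosed F) :
    ∃ P : H →L[ℂ] H, IsStarProjection P ∧ ∀ f, ‖P f‖ ^ 2 = (repMeasure Φ f).real F := by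
  let φ : ℕ → C(X, ℝ) := fun n => ⟨fun x => hF.apprSeq n x, by fun_prop⟩
  have hφ1 : ∀ n x, ‖φ n x‖ ≤ 1 := fun n x => by
    change ‖((hF.apprSeq n x : NNReal) : ℝ)‖ ≤ 1
    rw [Real.norm_of_nonneg NNReal.zero_le_coe]
    exact_mod_cast HasOuterApproxClosed.apprSeq_apply_le_one hF n x
  have hφlim : ∀ x, Tendsto (fun n => φ n x) atTop (𝓝 (F.indicator (fun _ => (1 : ℝ)) x)) := by
    intro x
    have h1 := tendsto_pi_nhds.mp (HasOuterApproxClosed.tendsto_apprSeq hF) x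
    have h2 := (NNReal.continuous_coe.tendsto _).comp h1
    refine h2.congr' (.of_forall fun n => rfl) |>.trans_eq ?_
    congr 1
    by_cases hx : x ∈ F <;> simp [hx]
  have hFm := hF.measurableSet
  have hint : ∀ f n, Integrable (fun x => (φ n x - F.indicator (fun _ => (1 : ℝ)) x) ^ 2)
      (repMeasure Φ f) := fun f n => by
    refine Integrable.of_bound (C := 4) ?_ (.of_forall fun x => ?_)
    · exact ((((φ n).continuous.measurable).sub
        (measurable_const.indicator hFm)).pow_const 2).aestronglyMeasurable
    · rw [norm_pow]
      have : ‖φ n x - F.indicator (fun _ => (1 : ℝ)) x‖ ≤ 2 := by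
        refine (norm_sub_le _ _).trans ?_
        have : ‖F.indicator (fun _ => (1 : ℝ)) x‖ ≤ 1 := by
          by_cases hx : x ∈ F <;> simp [hx]
        linarith [hφ1 n x]
      nlinarith [norm_nonneg (φ n x - F.indicator (fun _ => (1 : ℝ)) x)]
  have hlim2 : ∀ f, Tendsto (fun n => ∫ x, (φ n x - F.indicator (fun _ => (1 : ℝ)) x) ^ 2
      ∂(repMeasure Φ f)) atTop (𝓝 0) := fun f => by
    have := tendsto_integral_of_dominated_convergence (μ := repMeasure Φ f)
      (F := fun n x => (φ n x - F.indicator (fun _ => (1 : ℝ)) x) ^ 2) (f := fun _ => 0)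
      (fun _ => 4) (fun n => (hint f n).1) (integrable_const _) (fun n => .of_forall fun x => ?_)
      (.of_forall fun x => ?_)
    · simpa using this
    · rw [norm_pow]
      have : ‖φ n x - F.indicator (fun _ => (1 : ℝ)) x‖ ≤ 2 := by
        refine (norm_sub_le _ _).trans ?_
        have : ‖F.indicator (fun _ => (1 : ℝ)) x‖ ≤ 1 := by
          by_cases hx : x ∈ F <;> simp [hx]
        linarith [hφ1 n x]
      nlinarith [norm_nonneg (φ n x - F.indicator (fun _ => (1 : ℝ)) x)]
    · simpa using ((hφlim x).sub_const (F.indicator (fun _ => (1 : ℝ)) x)).pow 2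
  have hcau : ∀ f, CauchySeq fun n => Φ (φ n) f := fun f => by
    rw [Metric.cauchySeq_iff]
    intro ε hε
    obtain ⟨N, hN⟩ := eventually_atTop.mp
      ((hlim2 f).eventually (gt_mem_nhds (show (0 : ℝ) < ε ^ 2 / 4 by positivity)))
    refine ⟨N, fun m hm n hn => ?_⟩
    have h1 : Φ (φ m) f - Φ (φ n) f = Φ (φ m - φ n) f := by rw [map_sub]; rfl
    have h2 : ‖Φ (φ m) f - Φ (φ n) f‖ ^ 2
        ≤ 2 * (∫ x, (φ m x - F.indicator (fun _ => (1 : ℝ)) x) ^ 2 ∂(repMeasure Φ f))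
          + 2 * (∫ x, (φ n x - F.indicator (fun _ => (1 : ℝ)) x) ^ 2 ∂(repMeasure Φ f)) := by
      rw [h1, ← integral_sq_repMeasure, ← integral_const_mul, ← integral_const_mul,
        ← integral_add ((hint f m).const_mul 2) ((hint f n).const_mul 2)]
      refine integral_mono_of_nonneg (.of_forall fun x => by positivity)
        (((hint f m).const_mul 2).add ((hint f n).const_mul 2)) (.of_forall fun x => ?_)
      simp only [ContinuousMap.sub_apply]
      nlinarith [sq_nonneg (φ m x - F.indicator (fun _ => (1 : ℝ)) x
        + (φ n x - F.indicator (fun _ => (1 : ℝ)) x))]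
    rw [dist_eq_norm]
    refine lt_of_pow_lt_pow_left₀ 2 hε.le ?_
    linarith [hN m hm, hN n hn]
  choose p hp using fun f => cauchySeq_tendsto_of_complete (hcau f)
  let P : H →L[ℂ] H := continuousLinearMapOfTendsto (l := atTop) (fun n => Φ (φ n)) (f := p)
    (tendsto_pi_nhds.mpr hp)
  have hP : ∀ f, Tendsto (fun n => Φ (φ n) f) atTop (𝓝 (P f)) := hp
  have hdom : ∀ k : ℕ, k ≠ 0 → ∀ f, Tendsto (fun n => ∫ x, φ n x ^ k ∂(repMeasure Φ f)) atTop
      (𝓝 ((repMeasure Φ f).real F)) := fun k hk f => by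
    have h1 : ∫ x, F.indicator (fun _ => (1 : ℝ)) x ∂(repMeasure Φ f)
        = (repMeasure Φ f).real F := by
      rw [integral_indicator_const _ hFm]; simp
    rw [← h1]
    refine tendsto_integral_of_dominated_convergence (fun _ => 1)
      (fun n => ((φ n).continuous.measurable.pow_const k).aestronglyMeasurable)
      (integrable_const _) (fun n => .of_forall fun x => ?_) (.of_forall fun x => ?_)
    · rw [norm_pow]
      exact pow_le_one₀ (norm_nonneg _) (hφ1 n x)
    · have := (hφlim x).pow k
      refine this.trans_eq ?_
      congr 1
      by_cases hx : x ∈ F <;> simp [hx, hk]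
  have hnorm : ∀ f, ‖P f‖ ^ 2 = (repMeasure Φ f).real F := fun f => by
    refine tendsto_nhds_unique ((hP f).norm.pow 2) ?_
    simp only [← integral_sq_repMeasure]
    exact hdom 2 two_ne_zero f
  refine ⟨P, isStarProjection_of_inner_eq fun f => ?_, hnorm⟩
  rw [hnorm]
  refine tendsto_nhds_unique (tendsto_const_nhds.inner (hP f)) ?_
  simp only [← integral_repMeasure]
  have := hdom 1 one_ne_zero f
  simp only [pow_one] at this
  exact (Complex.continuous_ofReal.tendsto _).comp this

/-- The sets represented by a projection contain the closed sets and are stable under complements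
and disjoint countable unions, so the π-λ theorem applies. -/
theorem exists_projection_of_measurableSet [HasOuterApproxClosed X] {s : Set X}
    (hs : MeasurableSet s) :
    ∃ P : H →L[ℂ] H, IsStarProjection P ∧ ∀ f, ‖P f‖ ^ 2 = (repMeasure Φ f).real s := by
  refine MeasurableSpace.induction_on_inter (C := fun s _ => ∃ P : H →L[ℂ] H,
    IsStarProjection P ∧ ∀ f, ‖P f‖ ^ 2 = (repMeasure Φ f).real s)
    ((BorelSpace.measurable_eq).trans borel_eq_generateFrom_isClosed) isPiSystem_isClosed
    ?_ ?_ ?_ ?_ s hs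
  · exact ⟨0, IsStarProjection.zero _, fun f => by simp⟩
  · exact fun F hF => exists_projection_of_isClosed Φ hF
  · rintro t ht ⟨P, hP, hPt⟩
    refine ⟨1 - P, hP.one_sub, fun f => ?_⟩
    rw [measureReal_compl ht, ← hPt, repMeasure_univ]
    have h1 := hP.one_sub.inner_eq f
    have h2 : inner ℂ f ((1 - P) f) = ((‖f‖ ^ 2 - ‖P f‖ ^ 2 : ℝ) : ℂ) := by
      rw [sub_apply, inner_sub_right, hP.inner_eq]
      push_cast
      rw [id_eq, inner_self_eq_norm_sq_to_K]
      rfl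
    exact Complex.ofReal_injective (h1.symm.trans h2)
  · intro t hd ht h
    choose P hP hPt using h
    obtain ⟨R, hR, -, hRa⟩ := exists_hasSum_of_orthogonal_projections
      (a := fun f => (repMeasure Φ f).real (⋃ n, t n)) hP
      (fun i j hij => mul_eq_zero_of_repMeasure (ht j) (hd hij) (hP j) (hPt i) (hPt j))
      (fun f => by
        simp only [hPt]
        exact hasSum_measureReal_iUnion hd ht)
    exact ⟨R, hR, hRa⟩

end Representation

/-! ### Existence of spectral measures -/

open scoped Classical in
/-- The projection-valued measure on `ℝ` of a representation of `C(K, ℝ)`, `K ⊆ ℝ` compact. -/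
theorem exists_projMeasure_of_rep {K : Set ℝ} [CompactSpace K] (Φ : C(K, ℝ) →⋆ₐ[ℝ] (H →L[ℂ] H)) :
    ∃ E : ProjMeasure H, ∀ f, E.scalar f = (repMeasure Φ f).map Subtype.val := by
  have hm : ∀ s : Set ℝ, MeasurableSet s → MeasurableSet (Subtype.val ⁻¹' s : Set K) :=
    fun s hs => measurable_subtype_coe hs
  choose P hP hPs using fun s : {s : Set ℝ // MeasurableSet s} =>
    exists_projection_of_measurableSet Φ (hm s.1 s.2)
  let E : ProjMeasure H :=
    { proj := fun s => if hs : MeasurableSet s then P ⟨s, hs⟩ else 0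
      isStarProjection := fun s hs => by rw [dif_pos hs]; exact hP _
      proj_univ := by
        rw [dif_pos MeasurableSet.univ]
        refine clm_ext_inner_self fun f => ?_
        rw [(hP _).inner_eq, hPs]
        simp only [Set.preimage_univ, repMeasure_univ]
        rw [one_apply_eq_self, inner_self_eq_norm_sq_to_K]
        norm_cast
      hasSum_iUnion := fun s hs hd f => by
        simp only [dif_pos (hs _), dif_pos (MeasurableSet.iUnion hs)]
        obtain ⟨R, hR, hsum, hRa⟩ := exists_hasSum_of_orthogonal_projections
          (P := fun n => P ⟨s n, hs n⟩)
          (a := fun f => (repMeasure Φ f).real (Subtype.val ⁻¹' ⋃ n, s n)) (fun n => hP _)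
          (fun i j hij => mul_eq_zero_of_repMeasure (hm _ (hs j)) ((hd hij).preimage _) (hP _)
            (hPs _) (hPs _))
          (fun f => by
            simp only [hPs, Set.preimage_iUnion]
            exact hasSum_measureReal_iUnion (fun i j hij => (hd hij).preimage _)
              (fun n => hm _ (hs n)))
        have : P ⟨⋃ n, s n, MeasurableSet.iUnion hs⟩ = R := clm_ext_inner_self fun f => by
          rw [(hP _).inner_eq, hR.inner_eq, hPs, hRa]
        rw [this]
        exact hsum f }
  refine ⟨E, fun f => Measure.ext fun s hs => ?_⟩
  have : E.proj s = P ⟨s, hs⟩ := dif_pos hs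
  rw [E.scalar_apply f hs, this, hPs, Measure.map_apply measurable_subtype_coe hs,
    ofReal_measureReal]

/-- The spectral theorem for bounded self-adjoint operators. -/
theorem exists_projMeasure_of_isSelfAdjoint {Q : H →L[ℂ] H} (hQ : IsSelfAdjoint Q) :
    ∃ E : ProjMeasure H, E.integral (fun t => (t : ℂ)) Complex.measurable_ofReal = ofCLM Q := by
  obtain ⟨E, hE⟩ := exists_projMeasure_of_rep (cfcHom hQ)
  obtain ⟨C, hC⟩ := (isCompact_iff_compactSpace.mpr
    (inferInstance : CompactSpace (spectrum ℝ Q))).isBounded.exists_norm_le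
  have hs : MeasurableSet {t : ℝ | |t| ≤ C} := measurableSet_le (by fun_prop) measurable_const
  have hb : BddMeas ({t : ℝ | |t| ≤ C}.indicator fun t => (t : ℂ)) :=
    BddMeas.indicator_of_le Complex.measurable_ofReal hs C fun t ht => by
      rw [Complex.norm_real]; exact ht
  -- The measures live on the compact spectrum, so the unbounded function `λ` may be replaced by a
  -- bounded cut-off; two bounded operators are then compared by their quadratic forms.
  have hae : ∀ f, (fun t : ℝ => (t : ℂ)) =ᵐ[E.scalar f]
      {t : ℝ | |t| ≤ C}.indicator fun t => (t : ℂ) := fun f => by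
    have h1 : ∀ᵐ t ∂(E.scalar f), t ∈ {t : ℝ | |t| ≤ C} := by
      rw [hE]
      exact (ae_map_iff measurable_subtype_coe.aemeasurable hs).mpr
        (.of_forall fun x => hC x.1 x.2)
    filter_upwards [h1] with t ht
    exact (Set.indicator_of_mem (s := {t : ℝ | |t| ≤ C}) ht _).symm
  refine ⟨E, ?_⟩
  rw [E.integral_congr _ hb.meas hae, ProjMeasure.integral_eq_ofCLM hb]
  congr 1
  refine clm_ext_inner_self fun f => ?_
  rw [ProjMeasure.op_apply hb, E.inner_app hb.meas (hb.memLp _), ← integral_congr_ae (hae f), hE,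
    integral_map measurable_subtype_coe.aemeasurable
      Complex.measurable_ofReal.aestronglyMeasurable]
  have := integral_repMeasure (cfcHom hQ)
    (ContinuousMap.restrict (spectrum ℝ Q) (ContinuousMap.id ℝ)) f
  rw [cfcHom_id hQ] at this
  rw [← this]
  exact integral_ofReal

theorem zero_mem_graph_snd {A : H →ₗ.[ℂ] H} {u : H} (h : ((0 : H), u) ∈ A.graph) : u = 0 :=
  A.graph_fst_eq_zero_snd h rfl

/-- If `A = Q⁻¹ - c` for a bounded self-adjoint `Q`, then `A` has a spectral measure. -/
theorem exists_projMeasure_of_resolvent {A : H →ₗ.[ℂ] H} {Q : H →L[ℂ] H} (hQ : IsSelfAdjoint Q)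
    (c : ℝ) (hA : ∀ f h, (f, h) ∈ A.graph ↔ Q (h + (c : ℂ) • f) = f) :
    ∃ E : ProjMeasure H, E.integral (fun t => (t : ℂ)) Complex.measurable_ofReal = A := by
  obtain ⟨E, hE⟩ := exists_projMeasure_of_isSelfAdjoint hQ
  have hEQ : ∀ u, MemLp (fun t : ℝ => (t : ℂ)) 2 (E.scalar u) ∧
      E.app (fun t : ℝ => (t : ℂ)) Complex.measurable_ofReal u = Q u := fun u => by
    rw [← E.mem_graph_integral, hE, mem_graph_ofCLM]
  have hinj : ∀ u, Q u = 0 → u = 0 := fun u hu =>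
    zero_mem_graph_snd ((hA 0 u).mpr (by simpa using hu))
  -- `Q` vanishes on the range of `E({0})` and is injective, so `λ⁻¹` is defined almost everywhere.
  have h0 : ∀ f, ∀ᵐ t ∂(E.scalar f), t ≠ 0 := fun f => by
    have h1 : E.scalar f {0} = 0 := by
      rw [E.scalar_eq_zero_iff (measurableSet_singleton 0)]
      refine hinj _ ?_
      have hz : ({0} : Set ℝ).indicator (fun t => (t : ℂ)) = fun _ => 0 := by
        ext t
        by_cases ht : t = 0 <;> simp [ht]
      have := (ProjMeasure.proj_mem_domain (E := E) Complex.measurable_ofReal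
        (measurableSet_singleton 0) (hz ▸ BddMeas.const 0) f).2
      rw [hz, ProjMeasure.op_const] at this
      rw [← (hEQ _).2, this]
      simp
    exact compl_mem_ae_iff.mpr h1
  have hinv : Measurable fun t : ℝ => ((t⁻¹ : ℝ) : ℂ) :=
    Complex.measurable_ofReal.comp measurable_inv
  -- As `A = Q⁻¹ - c`, its spectral measure is the image of that of `Q` under `λ ↦ λ⁻¹ - c`.
  have hφ : Measurable fun t : ℝ => t⁻¹ - c := measurable_inv.sub_const c
  refine ⟨E.map _ hφ, ?_⟩
  rw [ProjMeasure.integral_map hφ]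
  have hsplit : (fun t : ℝ => (t : ℂ)) ∘ (fun t : ℝ => t⁻¹ - c)
      = (fun t : ℝ => ((t⁻¹ : ℝ) : ℂ)) + fun _ => -(c : ℂ) := by
    ext t; simp [sub_eq_add_neg]
  have happc : ∀ f, E.app (fun _ => -(c : ℂ)) measurable_const f = -(c : ℂ) • f := fun f => by
    have := ProjMeasure.op_apply (E := E) (BddMeas.const (-(c : ℂ))) f
    rw [ProjMeasure.op_const] at this
    exact this.symm
  have hone : ∀ f, E.app 1 measurable_one f = f := fun f => by
    have := (ProjMeasure.op_apply (E := E) (BddMeas.const 1) f).symm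
    rw [ProjMeasure.op_const, one_smul] at this
    exact this
  have hcM : ∀ f, MemLp (fun _ : ℝ => -(c : ℂ)) 2 (E.scalar f) := fun f =>
    (BddMeas.const _).memLp _
  have h1M : ∀ f, MemLp (1 : ℝ → ℂ) 2 (E.scalar f) := fun f => (BddMeas.const 1).memLp _
  refine LinearPMap.eq_of_eq_graph (Submodule.ext fun ⟨f, h⟩ => ?_)
  rw [E.mem_graph_integral, hA]
  have hval : MemLp (fun t : ℝ => ((t⁻¹ : ℝ) : ℂ)) 2 (E.scalar f) →
      E.app ((fun t : ℝ => (t : ℂ)) ∘ fun t : ℝ => t⁻¹ - c)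
        (Complex.measurable_ofReal.comp hφ) f
      = E.app _ hinv f - (c : ℂ) • f := fun hf => by
    have := E.app_add hinv measurable_const hf (hcM f)
    rw [happc, neg_smul, ← sub_eq_add_neg] at this
    rw [← this]
    simp only [hsplit]
  constructor
  · rintro ⟨h1, rfl⟩
    rw [hsplit] at h1
    have h2 : MemLp (fun t : ℝ => ((t⁻¹ : ℝ) : ℂ)) 2 (E.scalar f) := by
      simpa using h1.sub (hcM f)
    rw [hval h2, sub_add_cancel, ← (hEQ _).2]
    have hae : (fun t : ℝ => (t : ℂ)) * (fun t : ℝ => ((t⁻¹ : ℝ) : ℂ)) =ᵐ[E.scalar f] 1 := by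
      filter_upwards [h0 f] with t ht
      have : (t : ℂ) ≠ 0 := Complex.ofReal_ne_zero.mpr ht
      simp [this]
    rw [E.app_app hinv _ h2 ((h1M f).ae_eq hae.symm),
      E.app_congr _ measurable_one hae ((h1M f).ae_eq hae.symm), hone]
  · intro hf
    set v := h + (c : ℂ) • f with hv
    have hae : (fun t : ℝ => ((t⁻¹ : ℝ) : ℂ)) * (fun t : ℝ => (t : ℂ)) =ᵐ[E.scalar v] 1 := by
      filter_upwards [h0 v] with t ht
      have : (t : ℂ) ≠ 0 := Complex.ofReal_ne_zero.mpr ht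
      simp [this]
    have hm : MemLp (fun t : ℝ => ((t⁻¹ : ℝ) : ℂ)) 2 (E.scalar f) := by
      rw [← hf, ← (hEQ v).2, E.memLp_scalar_app _ hinv (hEQ v).1]
      exact (h1M v).ae_eq hae.symm
    have hav : E.app _ hinv f = v := by
      conv_lhs => rw [← hf, ← (hEQ v).2]
      rw [E.app_app _ hinv (hEQ v).1 ((h1M v).ae_eq hae.symm),
        E.app_congr _ measurable_one hae ((h1M v).ae_eq hae.symm), hone]
    refine ⟨?_, ?_⟩
    · rw [hsplit]; exact hm.add (hcM f)
    · rw [hval hm, hav, hv, add_sub_cancel_right]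

theorem spectralMeasure_integral {A : H →ₗ.[ℂ] H}
    (h : ∃ E : ProjMeasure H, E.integral (fun t => (t : ℂ)) Complex.measurable_ofReal = A) :
    (spectralMeasure A).integral (fun t => (t : ℂ)) Complex.measurable_ofReal = A := by
  rw [spectralMeasure, dif_pos h]
  exact h.choose_spec

/-- The spectral measure of a nonnegative operator is concentrated on `[0, ∞)`. -/
theorem ProjMeasure.ae_nonneg {E : ProjMeasure H}
    (hE : ∀ f, MemLp (fun t : ℝ => (t : ℂ)) 2 (E.scalar f) →
      0 ≤ (inner ℂ f (E.app (fun t : ℝ => (t : ℂ)) Complex.measurable_ofReal f)).re) (f : H) :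
    ∀ᵐ t ∂(E.scalar f), 0 ≤ t := by
  have hU : {t : ℝ | ¬ 0 ≤ t} = ⋃ n : ℕ, Set.Ico (-(n : ℝ)) 0 := by
    ext t
    simp only [Set.mem_ofPred_eq, not_le, Set.mem_iUnion, Set.mem_Ico]
    constructor
    · intro h
      obtain ⟨n, hn⟩ := exists_nat_ge (-t)
      exact ⟨n, by linarith, h⟩
    · rintro ⟨n, _, h⟩; exact h
  rw [ae_iff, hU, measure_iUnion_null_iff]
  intro n
  -- For a vector in the range of `E([-n, 0))` the quadratic form is an integral of a negative
  -- function, yet it is nonnegative by hypothesis; so the measure of this set is zero.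
  set s := Set.Ico (-(n : ℝ)) 0
  have hs : MeasurableSet s := measurableSet_Ico
  have hb : BddMeas (s.indicator fun t : ℝ => (t : ℂ)) :=
    BddMeas.indicator_of_le Complex.measurable_ofReal hs n fun t ht => by
      rw [Complex.norm_real, Real.norm_eq_abs, abs_of_nonpos ht.2.le]
      linarith [ht.1]
  obtain ⟨h1, h2⟩ := proj_mem_domain (E := E) Complex.measurable_ofReal hs hb f
  have h3 := hE _ h1
  have h4 : inner ℂ (E.proj s f) (E.op (s.indicator fun t : ℝ => (t : ℂ)) f)
      = ((∫ t, s.indicator (fun t : ℝ => t) t ∂(E.scalar f) : ℝ) : ℂ) := by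
    rw [← ContinuousLinearMap.adjoint_inner_right, E.adjoint_proj hs]
    change inner ℂ f ((E.proj s * E.op (s.indicator fun t : ℝ => (t : ℂ))) f) = _
    rw [← op_indicator hs hb, Set.indicator_indicator, Set.inter_self, op_apply hb,
      E.inner_app hb.meas (hb.memLp _), ← integral_complex_ofReal]
    refine integral_congr_ae (.of_forall fun t => ?_)
    by_cases ht : t ∈ s <;> simp [ht]
  rw [h2, h4, Complex.ofReal_re] at h3
  have hint : Integrable (s.indicator fun t : ℝ => t) (E.scalar f) := by
    refine Integrable.of_bound (C := n) (measurable_id.indicator hs).aestronglyMeasurable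
      (.of_forall fun t => ?_)
    by_cases ht : t ∈ s
    · rw [Set.indicator_of_mem ht, Real.norm_eq_abs, abs_of_nonpos ht.2.le]
      linarith [ht.1]
    · simp [ht]
  have hneg : ∀ t, 0 ≤ -s.indicator (fun t : ℝ => t) t := fun t => by
    by_cases ht : t ∈ s
    · rw [Set.indicator_of_mem ht]; linarith [ht.2]
    · simp [ht]
  have h5 : ∫ t, -s.indicator (fun t : ℝ => t) t ∂(E.scalar f) = 0 := by
    refine le_antisymm ?_ (integral_nonneg hneg)
    rw [integral_neg]; linarith
  rw [integral_eq_zero_iff_of_nonneg hneg hint.neg] at h5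
  refine measure_mono_null (t := {t | ¬ -s.indicator (fun t : ℝ => t) t = 0}) (fun t ht => ?_)
    (ae_iff.mp h5)
  simp only [Set.mem_ofPred_eq, Set.indicator_of_mem ht]
  have := ht.2
  linarith

/-! ### Closed operators: graph decomposition, `S† S` -/

/-- The graph of `S` as a subspace of the Hilbert space `H ⊕ H`. -/
def l2graph (S : H →ₗ.[ℂ] H) : Submodule ℂ (WithLp 2 (H × H)) :=
  S.graph.comap (WithLp.linearEquiv 2 ℂ (H × H)).toLinearMap

theorem mem_l2graph {S : H →ₗ.[ℂ] H} {x : WithLp 2 (H × H)} :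
    x ∈ l2graph S ↔ (x.fst, x.snd) ∈ S.graph := Iff.rfl

theorem isClosed_l2graph {S : H →ₗ.[ℂ] H} (hS : S.IsClosed) :
    IsClosed (l2graph S : Set (WithLp 2 (H × H))) :=
  IsClosed.preimage (WithLp.prodContinuousLinearEquiv 2 ℂ H H).continuous hS

theorem mem_orthogonal_l2graph {S : H →ₗ.[ℂ] H} (hd : Dense (S.domain : Set H))
    {x : WithLp 2 (H × H)} : x ∈ (l2graph S)ᗮ ↔ (x.snd, -x.fst) ∈ S†.graph := by
  rw [mem_graph_adjoint_iff hd, Submodule.mem_orthogonal']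
  constructor
  · intro h v
    have := h (WithLp.toLp 2 ((v : H), S v)) (S.mem_graph v)
    rw [WithLp.prod_inner_apply] at this
    rw [inner_neg_left]
    exact (eq_neg_of_add_eq_zero_right this).symm
  · intro h y hy
    obtain ⟨v, hv1, hv2⟩ := (LinearPMap.mem_graph_iff _).mp (mem_l2graph.mp hy)
    have h1 := h v
    rw [inner_neg_left] at h1
    rw [WithLp.prod_inner_apply]
    simp only at hv1 hv2
    change inner ℂ x.fst y.fst + inner ℂ x.snd y.snd = 0
    rw [← hv1, ← hv2, ← h1, add_neg_cancel]

/-- Subtract from a point of the graph of `S††` its projection onto the graph of `S`. The difference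
lies in the graph of `S††` and, after a rotation, in that of `S†`; pairing the two gives `‖w - y₂‖²
= -‖u - y₁‖²`, so both vanish. -/
theorem adjoint_adjoint_of_isClosed {S : H →ₗ.[ℂ] H} (hS : S.IsClosed)
    (hd : Dense (S.domain : Set H)) (hd' : Dense (S†.domain : Set H)) : S†† = S := by
  have : CompleteSpace (l2graph S) := (isClosed_l2graph hS).completeSpace_coe
  have hle : ∀ p, p ∈ S.graph → p ∈ S††.graph := by
    rintro ⟨f, h⟩ hf
    rw [mem_graph_adjoint_iff hd']
    intro y
    have h1 := (mem_graph_adjoint_iff hd).mp (S†.mem_graph y)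
    obtain ⟨v, hv1, hv2⟩ := (LinearPMap.mem_graph_iff _).mp hf
    simp only at hv1 hv2
    have := congrArg (starRingEnd ℂ) (h1 v)
    rw [inner_conj_symm, inner_conj_symm] at this
    rw [← hv1, ← hv2, this]
  refine LinearPMap.eq_of_eq_graph (le_antisymm (fun p hp => ?_) hle)
  obtain ⟨u, w⟩ := p
  have hx := (l2graph S).sub_starProjection_mem_orthogonal (WithLp.toLp 2 (u, w))
  have hy := (l2graph S).starProjection_apply_mem (WithLp.toLp 2 (u, w))
  set y := (l2graph S).starProjection (WithLp.toLp 2 (u, w)) with hydef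
  rw [mem_orthogonal_l2graph hd] at hx
  have h1 := S††.graph.sub_mem hp (hle _ (mem_l2graph.mp hy))
  obtain ⟨q, hq1, hq2⟩ := (LinearPMap.mem_graph_iff _).mp hx
  have h2 := (mem_graph_adjoint_iff hd').mp h1 q
  simp only at hq1 hq2
  rw [hq1, hq2, inner_neg_right] at h2
  change inner ℂ (w - y.snd) (w - y.snd) = -inner ℂ (u - y.fst) (u - y.fst) at h2
  rw [inner_self_eq_norm_sq_to_K, inner_self_eq_norm_sq_to_K] at h2
  have h3 : ‖w - y.snd‖ ^ 2 = -‖u - y.fst‖ ^ 2 := by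
    refine Complex.ofReal_injective ?_
    push_cast
    exact h2
  have h4 : ‖w - y.snd‖ ^ 2 = 0 := by nlinarith [sq_nonneg ‖w - y.snd‖, sq_nonneg ‖u - y.fst‖]
  have h5 : ‖u - y.fst‖ ^ 2 = 0 := by nlinarith [sq_nonneg ‖w - y.snd‖, sq_nonneg ‖u - y.fst‖]
  have h6 : w = y.snd := by simpa [sub_eq_zero] using h4
  have h7 : u = y.fst := by simpa [sub_eq_zero] using h5
  rw [h6, h7]
  exact mem_l2graph.mp hy

/-- `S† S` has a spectral measure (von Neumann). -/
theorem exists_projMeasure_adjoint_mul_self {S : H →ₗ.[ℂ] H} (hS : S.IsClosed)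
    (hd : Dense (S.domain : Set H)) :
    ∃ E : ProjMeasure H, E.integral (fun t => (t : ℂ)) Complex.measurable_ofReal
      = opMul S† S := by
  have : CompleteSpace (l2graph S) := (isClosed_l2graph hS).completeSpace_coe
  let J : H →L[ℂ] WithLp 2 (H × H) :=
    ((WithLp.prodContinuousLinearEquiv 2 ℂ H H).symm : (H × H) →L[ℂ] WithLp 2 (H × H)) ∘L
      ContinuousLinearMap.inl ℂ H H
  -- `Q` is `(1 + S† S)⁻¹`: the projection of `(h + f, 0)` onto the graph is `(f, S f)` exactly when
  -- the residual `(h, -S f)` is orthogonal to the graph, which means `S† S f = h`. Hence the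
  -- resolvent criterion applies with `c = 1`.
  let Q : H →L[ℂ] H := (ContinuousLinearMap.adjoint J) ∘L (l2graph S).starProjection ∘L J
  have hJ : ∀ x, ContinuousLinearMap.adjoint J x = x.fst := fun x => by
    refine ext_inner_right ℂ fun v => ?_
    rw [ContinuousLinearMap.adjoint_inner_left]
    change inner ℂ x (WithLp.toLp 2 (v, (0 : H))) = _
    rw [WithLp.prod_inner_apply]
    simp
  have hQ : IsSelfAdjoint Q := by
    rw [ContinuousLinearMap.isSelfAdjoint_iff_isSymmetric]
    intro f g
    change inner ℂ (ContinuousLinearMap.adjoint J ((l2graph S).starProjection (J f))) g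
      = inner ℂ f (ContinuousLinearMap.adjoint J ((l2graph S).starProjection (J g)))
    rw [ContinuousLinearMap.adjoint_inner_left, ContinuousLinearMap.adjoint_inner_right,
      Submodule.inner_starProjection_left_eq_right]
  refine exists_projMeasure_of_resolvent hQ 1 fun f h => ?_
  rw [Complex.ofReal_one, one_smul, mem_graph_opMul]
  change _ ↔ ContinuousLinearMap.adjoint J ((l2graph S).starProjection (J (h + f))) = f
  rw [hJ]
  constructor
  · rintro ⟨k, h1, h2⟩
    have : WithLp.toLp 2 (f, k) = (l2graph S).starProjection (J (h + f)) := by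
      refine (Submodule.eq_starProjection_of_mem_orthogonal (mem_l2graph.mpr h1) ?_).symm
      rw [mem_orthogonal_l2graph hd]
      have h3 := S†.graph.neg_mem h2
      change ((0 : H) - k, -(h + f - f)) ∈ _
      simpa using h3
    rw [← this]
    rfl
  · intro hf
    have hx := (l2graph S).sub_starProjection_mem_orthogonal (J (h + f))
    have hy := (l2graph S).starProjection_apply_mem (J (h + f))
    set y := (l2graph S).starProjection (J (h + f)) with hydef
    rw [mem_orthogonal_l2graph hd] at hx
    change ((0 : H) - y.snd, -(h + f - y.fst)) ∈ _ at hx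
    refine ⟨y.snd, hf ▸ mem_l2graph.mp hy, ?_⟩
    have h3 := S†.graph.neg_mem hx
    rw [hf] at h3
    simpa using h3

/-! ### The square root and the operator `|S|` -/

/-- The principal square root, as a function on `ℝ`. -/
abbrev csqrt (t : ℝ) : ℂ := (t : ℂ) ^ (1 / 2 : ℂ)

theorem csqrt_mul_self (t : ℝ) : csqrt t * csqrt t = t := by
  have h := Complex.cpow_nat_inv_pow (t : ℂ) two_ne_zero
  rw [sq] at h
  simpa [csqrt] using h

theorem csqrt_of_nonneg {t : ℝ} (ht : 0 ≤ t) : csqrt t = ((√t : ℝ) : ℂ) := by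
  rw [csqrt, Real.sqrt_eq_rpow, Complex.ofReal_cpow ht]
  norm_num

theorem norm_csqrt_le (t : ℝ) : ‖csqrt t‖ ≤ 1 + ‖(t : ℂ)‖ := by
  rw [← csqrt_mul_self t, norm_mul]
  nlinarith [norm_nonneg (csqrt t), sq_nonneg (‖csqrt t‖ - 1)]

theorem measurable_csqrt : Measurable csqrt := measurable_cpow_ofReal _

theorem memLp_csqrt {μ : Measure ℝ} [IsFiniteMeasure μ] (h : MemLp (fun t : ℝ => (t : ℂ)) 2 μ) :
    MemLp csqrt 2 μ := by
  have h1 : MemLp (fun t : ℝ => (1 : ℝ) + ‖(t : ℂ)‖) 2 μ := by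
    have h2 : MemLp (fun _ : ℝ => (1 : ℝ)) 2 μ := memLp_const 1
    exact h2.add h.norm
  refine h1.of_le measurable_csqrt.aestronglyMeasurable (.of_forall fun t => ?_)
  rw [Real.norm_of_nonneg (by positivity)]
  exact norm_csqrt_le t

section AbsoluteValue

variable {S : H →ₗ.[ℂ] H} (hS : S.IsClosed) (hd : Dense (S.domain : Set H))
include hS hd

theorem integral_spectralMeasure_adjoint_mul_self :
    (spectralMeasure (opMul S† S)).integral (fun t => (t : ℂ)) Complex.measurable_ofReal
      = opMul S† S :=
  spectralMeasure_integral (exists_projMeasure_adjoint_mul_self hS hd)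

theorem mem_graph_adjoint_mul_self {f h : H} :
    (f, h) ∈ (opMul S† S).graph ↔ MemLp (fun t : ℝ => (t : ℂ)) 2
      ((spectralMeasure (opMul S† S)).scalar f) ∧ (spectralMeasure (opMul S† S)).app
        (fun t : ℝ => (t : ℂ)) Complex.measurable_ofReal f = h := by
  rw [← ProjMeasure.mem_graph_integral, integral_spectralMeasure_adjoint_mul_self hS hd]

omit hS in
theorem inner_of_mem_graph {f k u v : H} (h1 : (f, k) ∈ S.graph) (h2 : (u, v) ∈ S†.graph) :
    inner ℂ v f = inner ℂ u k := by
  obtain ⟨x, hx1, hx2⟩ := (LinearPMap.mem_graph_iff _).mp h1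
  have := (mem_graph_adjoint_iff hd).mp h2 x
  simp only at hx1 hx2
  rwa [hx1, hx2] at this

theorem ae_nonneg_adjoint_mul_self (f : H) :
    ∀ᵐ t ∂((spectralMeasure (opMul S† S)).scalar f), 0 ≤ t := by
  refine ProjMeasure.ae_nonneg (fun f hf => ?_) f
  obtain ⟨k, h1, h2⟩ := mem_graph_opMul.mp ((mem_graph_adjoint_mul_self hS hd).mpr ⟨hf, rfl⟩)
  rw [← inner_conj_symm, inner_of_mem_graph hd h1 h2, Complex.conj_re]
  exact inner_self_nonneg (𝕜 := ℂ)

omit hS hd in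
theorem mem_graph_absOp {f h : H} :
    (f, h) ∈ (absOp S).graph ↔ MemLp csqrt 2 ((spectralMeasure (opMul S† S)).scalar f) ∧
      (spectralMeasure (opMul S† S)).app csqrt measurable_csqrt f = h :=
  ProjMeasure.mem_graph_integral _

theorem conj_csqrt_ae (f : H) : (fun t => starRingEnd ℂ (csqrt t))
    =ᵐ[(spectralMeasure (opMul S† S)).scalar f] csqrt := by
  filter_upwards [ae_nonneg_adjoint_mul_self hS hd f] with t ht
  rw [csqrt_of_nonneg ht, Complex.conj_ofReal]

theorem adjoint_absOp : (absOp S)† = absOp S := by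
  change ((spectralMeasure (opMul S† S)).integral csqrt measurable_csqrt)† = _
  rw [ProjMeasure.adjoint_integral]
  exact ProjMeasure.integral_congr _ _ _ (conj_csqrt_ae hS hd)

omit hS hd in
theorem dense_domain_absOp : Dense ((absOp S).domain : Set H) :=
  ProjMeasure.dense_domain_integral _

theorem inner_absOp {f k u v : H} (h1 : (f, k) ∈ (absOp S).graph) (h2 : (u, v) ∈ (absOp S).graph) :
    inner ℂ v f = inner ℂ u k :=
  inner_of_mem_graph dense_domain_absOp h1 ((adjoint_absOp hS hd).symm ▸ h2)

/-- `|S|² = S† S`. -/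
theorem mem_graph_absOp_sq {f h : H} (hf : (f, h) ∈ (opMul S† S).graph) :
    ∃ m, (f, m) ∈ (absOp S).graph ∧ (m, h) ∈ (absOp S).graph := by
  obtain ⟨h1, rfl⟩ := (mem_graph_adjoint_mul_self hS hd).mp hf
  have h2 := memLp_csqrt h1
  have h3 : csqrt * csqrt = fun t : ℝ => (t : ℂ) := funext csqrt_mul_self
  refine ⟨_, mem_graph_absOp.mpr ⟨h2, rfl⟩, mem_graph_absOp.mpr ⟨?_, ?_⟩⟩
  · rw [ProjMeasure.memLp_scalar_app _ _ measurable_csqrt h2, h3]; exact h1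
  · rw [ProjMeasure.app_app _ _ measurable_csqrt h2 (h3 ▸ h1)]
    simp only [h3]

/-- Both squared norms equal `⟨S† S u, u⟩`. The restriction to `dom (S† S)` is removed later, by
spectral truncation. -/
theorem norm_absOp_of_mem_adjoint_mul_self {u k m : H} (hu : u ∈ (opMul S† S).domain)
    (h1 : (u, k) ∈ S.graph) (h2 : (u, m) ∈ (absOp S).graph) : ‖m‖ = ‖k‖ := by
  obtain ⟨v, hv⟩ := LinearPMap.mem_domain_iff.mp hu
  obtain ⟨m', h3, h4⟩ := mem_graph_absOp_sq hS hd hv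
  obtain rfl := LinearPMap.mem_graph_snd_inj _ h2 h3 rfl
  obtain ⟨k', h5, h6⟩ := mem_graph_opMul.mp hv
  obtain rfl := LinearPMap.mem_graph_snd_inj _ h1 h5 rfl
  have h7 := inner_absOp hS hd h2 h4
  have h8 := inner_of_mem_graph hd h1 h6
  rw [h8, inner_self_eq_norm_sq_to_K, inner_self_eq_norm_sq_to_K] at h7
  have h9 : ‖k‖ ^ 2 = ‖m‖ ^ 2 := by
    refine Complex.ofReal_injective ?_
    push_cast
    exact h7
  exact ((sq_eq_sq₀ (norm_nonneg _) (norm_nonneg _)).mp h9).symm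

/-- Spectral truncations of a vector with respect to `S† S`. -/
theorem exists_truncation (f : H) : ∃ u k m : ℕ → H, (∀ n, (u n, k n) ∈ S.graph) ∧
    (∀ n, (u n, m n) ∈ (absOp S).graph) ∧ (∀ n, u n ∈ (opMul S† S).domain) ∧
    Tendsto u atTop (𝓝 f) ∧
    (∀ h, (f, h) ∈ (absOp S).graph → Tendsto m atTop (𝓝 h)) ∧
    ((∃ C, ∀ n, ‖m n‖ ≤ C) → f ∈ (absOp S).domain) ∧
    ∀ h, (f, h) ∈ S.graph → ∀ n, ‖k n‖ ≤ ‖h‖ := by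
  set E := spectralMeasure (opMul S† S) with hE
  have hs := fun n : ℕ => ProjMeasure.measurableSet_norm_le Complex.measurable_ofReal (n : ℝ)
  set s : ℕ → Set ℝ := fun n => {t : ℝ | ‖(t : ℂ)‖ ≤ n} with hsdef
  have hb : ∀ n, BddMeas ((s n).indicator fun t : ℝ => (t : ℂ)) := fun n =>
    BddMeas.indicator_of_le Complex.measurable_ofReal (hs n) n fun t ht => ht
  have hbw : ∀ n, BddMeas ((s n).indicator csqrt) := fun n =>
    BddMeas.indicator_of_le measurable_csqrt (hs n) (1 + n) fun t ht =>
      (norm_csqrt_le t).trans (by gcongr; exact ht)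
  have h1 := fun n => ProjMeasure.proj_mem_domain (E := E) Complex.measurable_ofReal (hs n) (hb n) f
  have h2 := fun n => ProjMeasure.proj_mem_domain (E := E) measurable_csqrt (hs n) (hbw n) f
  have h3 : ∀ n, (E.proj (s n) f, E.op ((s n).indicator fun t : ℝ => (t : ℂ)) f)
      ∈ (opMul S† S).graph := fun n => (mem_graph_adjoint_mul_self hS hd).mpr (h1 n)
  choose k hk1 hk2 using fun n => mem_graph_opMul.mp (h3 n)
  refine ⟨fun n => E.proj (s n) f, k, fun n => E.op ((s n).indicator csqrt) f, hk1,
    fun n => mem_graph_absOp.mpr (h2 n),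
    fun n => LinearPMap.mem_domain_of_mem_graph (h3 n),
    ProjMeasure.tendsto_proj_norm_le Complex.measurable_ofReal f, ?_, ?_, ?_⟩
  · intro h hh
    obtain ⟨h4, rfl⟩ := mem_graph_absOp.mp hh
    refine (ProjMeasure.tendsto_proj_norm_le (E := E) Complex.measurable_ofReal _).congr fun n => ?_
    rw [← ProjMeasure.op_indicator_one (hs n),
      ProjMeasure.op_app (BddMeas.indicator_one (hs n)) measurable_csqrt h4,
      ProjMeasure.op_apply (hbw n)]
    congr 1
    rw [mul_comm, ProjMeasure.indicator_mul_indicator_one]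
  · rintro ⟨C, hC⟩
    refine ProjMeasure.memLp_of_tendsto hbw measurable_csqrt hC (.of_forall fun t => ?_)
    refine tendsto_const_nhds.congr' ?_
    obtain ⟨N, hN⟩ := exists_nat_ge ‖(t : ℂ)‖
    filter_upwards [eventually_ge_atTop N] with n hn
    rw [Set.indicator_of_mem]
    exact hN.trans (Nat.cast_le.mpr hn)
  · intro h hh n
    -- With `E_n` the truncating projection, `‖S E_n f‖² = ⟨S† S E_n f, f⟩ = ⟨S E_n f, S f⟩`, and
    -- Cauchy-Schwarz gives `‖S E_n f‖ ≤ ‖S f‖`.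
    have h5 := inner_of_mem_graph hd (hk1 n) (hk2 n)
    have h6 := inner_of_mem_graph hd hh (hk2 n)
    have h7 : inner ℂ (E.op ((s n).indicator fun t : ℝ => (t : ℂ)) f) (E.proj (s n) f)
        = inner ℂ (E.op ((s n).indicator fun t : ℝ => (t : ℂ)) f) f := by
      rw [← ContinuousLinearMap.adjoint_inner_left, E.adjoint_proj (hs n)]
      change inner ℂ ((E.proj (s n) * E.op ((s n).indicator fun t : ℝ => (t : ℂ))) f) f = _
      rw [← ProjMeasure.op_indicator (hs n) (hb n), Set.indicator_indicator, Set.inter_self]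
    rw [h7, h6] at h5
    have h8 : ‖k n‖ * ‖k n‖ ≤ ‖k n‖ * ‖h‖ := by
      have := norm_inner_le_norm (𝕜 := ℂ) (k n) h
      rw [h5, inner_self_eq_norm_sq_to_K, norm_pow] at this
      simpa [sq] using this
    by_cases hk : ‖k n‖ = 0
    · rw [hk]; exact norm_nonneg _
    · exact le_of_mul_le_mul_left h8 (lt_of_le_of_ne (norm_nonneg _) (Ne.symm hk))

theorem mem_domain_absOp_of_mem {f h : H} (hf : (f, h) ∈ S.graph) : f ∈ (absOp S).domain := by
  obtain ⟨u, k, m, h1, h2, h3, -, -, h5, h6⟩ := exists_truncation hS hd f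
  refine h5 ⟨‖h‖, fun n => ?_⟩
  rw [norm_absOp_of_mem_adjoint_mul_self hS hd (h3 n) (h1 n) (h2 n)]
  exact h6 h hf n

/-- Along the truncations `|S| u_n` converges, so by equality of norms `S u_n` is Cauchy; closedness
of `S` puts the limit in its graph. -/
theorem exists_mem_graph_of_absOp {f m : H} (hf : (f, m) ∈ (absOp S).graph) :
    ∃ h, (f, h) ∈ S.graph ∧ ‖h‖ = ‖m‖ := by
  obtain ⟨u, k, w, h1, h2, h3, h4, h5, -, -⟩ := exists_truncation hS hd f
  have h6 := h5 m hf
  have h7 : CauchySeq k := by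
    have h8 := h6.cauchySeq
    rw [Metric.cauchySeq_iff] at h8 ⊢
    intro ε hε
    obtain ⟨N, hN⟩ := h8 ε hε
    refine ⟨N, fun i hi j hj => ?_⟩
    have := norm_absOp_of_mem_adjoint_mul_self hS hd
      ((opMul S† S).domain.sub_mem (h3 i) (h3 j)) (S.graph.sub_mem (h1 i) (h1 j))
      ((absOp S).graph.sub_mem (h2 i) (h2 j))
    rw [dist_eq_norm, ← this, ← dist_eq_norm]
    exact hN i hi j hj
  obtain ⟨y, hy⟩ := cauchySeq_tendsto_of_complete h7
  refine ⟨y, hS.mem_of_tendsto (h4.prodMk_nhds hy) (.of_forall h1), ?_⟩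
  refine tendsto_nhds_unique hy.norm (h6.norm.congr fun n => ?_)
  exact norm_absOp_of_mem_adjoint_mul_self hS hd (h3 n) (h1 n) (h2 n)

theorem domain_absOp : (absOp S).domain = S.domain := by
  refine le_antisymm (fun f hf => ?_) (fun f hf => ?_)
  · obtain ⟨m, hm⟩ := LinearPMap.mem_domain_iff.mp hf
    obtain ⟨h, hh, -⟩ := exists_mem_graph_of_absOp hS hd hm
    exact LinearPMap.mem_domain_of_mem_graph hh
  · obtain ⟨m, hm⟩ := LinearPMap.mem_domain_iff.mp hf
    exact mem_domain_absOp_of_mem hS hd hm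

theorem norm_absOp {f h m : H} (h1 : (f, h) ∈ S.graph) (h2 : (f, m) ∈ (absOp S).graph) :
    ‖h‖ = ‖m‖ := by
  obtain ⟨h', h3, h4⟩ := exists_mem_graph_of_absOp hS hd h2
  rw [LinearPMap.mem_graph_snd_inj _ h1 h3 rfl, h4]

/-- `|S|` is defined through the spectral measure of `S† S`, but its powers use the measure chosen
for `|S|` itself. The image under the square root shows that such a measure exists. -/
theorem integral_spectralMeasure_absOp :
    (spectralMeasure (absOp S)).integral (fun t => (t : ℂ)) Complex.measurable_ofReal
      = absOp S := by
  refine spectralMeasure_integral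
    ⟨(spectralMeasure (opMul S† S)).map Real.sqrt Real.continuous_sqrt.measurable, ?_⟩
  rw [ProjMeasure.integral_map]
  refine ProjMeasure.integral_congr _ _ _ fun f => ?_
  filter_upwards [ae_nonneg_adjoint_mul_self hS hd f] with t ht
  exact (csqrt_of_nonneg ht).symm

theorem ae_nonneg_absOp (f : H) : ∀ᵐ t ∂((spectralMeasure (absOp S)).scalar f), 0 ≤ t := by
  refine ProjMeasure.ae_nonneg (fun f hf => ?_) f
  have h1 := (ProjMeasure.mem_graph_integral _).mpr
    (⟨hf, rfl⟩ : _ ∧ (spectralMeasure (absOp S)).app _ Complex.measurable_ofReal f = _)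
  rw [integral_spectralMeasure_absOp hS hd] at h1
  obtain ⟨h2, h3⟩ := mem_graph_absOp.mp h1
  rw [← h3, ProjMeasure.inner_app _ _ h2]
  have : ∫ t, csqrt t ∂((spectralMeasure (opMul S† S)).scalar f)
      = ((∫ t, √t ∂((spectralMeasure (opMul S† S)).scalar f) : ℝ) : ℂ) := by
    rw [← integral_complex_ofReal]
    refine integral_congr_ae ?_
    filter_upwards [ae_nonneg_adjoint_mul_self hS hd f] with t ht
    exact csqrt_of_nonneg ht
  rw [this, Complex.ofReal_re]
  exact integral_nonneg fun t => Real.sqrt_nonneg t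

/-! ### Polar decomposition -/

theorem exists_isPolarFactor : ∃ U : H →L[ℂ] H, IsPolarFactor S U := by
  set R : Submodule ℂ H := LinearMap.range (absOp S).toFun with hR
  -- `U` must send `|S| x + y`, with `y` orthogonal to the range of `|S|`, to `S x`. Such sums are
  -- dense, and by Pythagoras `‖S x‖ = ‖|S| x‖ ≤ ‖|S| x + y‖`, so this prescription extends by
  -- continuity.
  let e : (absOp S).domain × Rᗮ →ₗ[ℂ] H := (absOp S).toFun.coprod Rᗮ.subtype
  let g : (absOp S).domain × Rᗮ →ₗ[ℂ] H :=
    S.toFun ∘ₗ (Submodule.inclusion (domain_absOp hS hd).le) ∘ₗ LinearMap.fst ℂ _ _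
  have hnorm1 : ∀ x : (absOp S).domain,
      ‖S (Submodule.inclusion (domain_absOp hS hd).le x)‖ = ‖absOp S x‖ := fun x =>
    norm_absOp hS hd (S.mem_graph _) ((absOp S).mem_graph x)
  have hdense : DenseRange e := by
    have h1 : (LinearMap.range e).topologicalClosure = ⊤ := by
      rw [Submodule.topologicalClosure_eq_top_iff, Submodule.eq_bot_iff]
      intro z hz
      rw [Submodule.mem_orthogonal] at hz
      have hzR : z ∈ Rᗮ := by
        rw [Submodule.mem_orthogonal]
        rintro _ ⟨x, rfl⟩
        exact hz _ ⟨(x, 0), by simp [e]⟩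
      exact inner_self_eq_zero.mp (hz z ⟨(0, ⟨z, hzR⟩), by simp [e]⟩)
    have h2 := congrArg (fun K : Submodule ℂ H => (K : Set H)) h1
    rw [Submodule.topologicalClosure_coe] at h2
    exact dense_iff_closure_eq.mpr h2
  have hle : ∀ x, ‖g x‖ ≤ 1 * ‖e x‖ := by
    rintro ⟨x, y⟩
    change ‖S (Submodule.inclusion (domain_absOp hS hd).le x)‖ ≤ 1 * ‖absOp S x + (y : H)‖
    rw [hnorm1, one_mul]
    have hxy : inner ℂ (absOp S x) (y : H) = 0 :=
      (Submodule.mem_orthogonal _ _).mp y.2 _ ⟨x, rfl⟩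
    have := norm_add_sq_eq_norm_sq_add_norm_sq_of_inner_eq_zero _ _ hxy
    nlinarith [norm_nonneg (absOp S x + (y : H)), norm_nonneg (absOp S x), norm_nonneg (y : H)]
  let U : H →L[ℂ] H := g.extendOfNorm e
  have hU : ∀ x, U (e x) = g x := LinearMap.extendOfNorm_eq hdense ⟨1, hle⟩
  have hUR : ∀ x : (absOp S).domain,
      U (absOp S x) = S (Submodule.inclusion (domain_absOp hS hd).le x) := fun x => by
    have := hU (x, 0)
    simpa [e, g] using! this
  have hU0 : ∀ y ∈ Rᗮ, U y = 0 := fun y hy => by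
    have := hU (0, ⟨y, hy⟩)
    simpa [e, g] using! this
  have hiso : ∀ v ∈ R.topologicalClosure, ‖U v‖ = ‖v‖ := by
    have hcl : IsClosed {v : H | ‖U v‖ = ‖v‖} :=
      isClosed_eq U.continuous.norm continuous_norm
    intro v hv
    refine closure_minimal ?_ hcl hv
    rintro _ ⟨x, rfl⟩
    change ‖U (absOp S x)‖ = ‖absOp S x‖
    rw [hUR, hnorm1]
  have hker : ∀ f, U f = 0 ↔ f ∈ Rᗮ := by
    refine fun f => ⟨fun hf => ?_, hU0 f⟩
    obtain ⟨p, hp, y, hy, rfl⟩ := R.topologicalClosure.exists_add_mem_mem_orthogonal f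
    rw [Submodule.orthogonal_closure] at hy
    rw [map_add, hU0 y hy, add_zero] at hf
    have := hiso p hp
    rw [hf, norm_zero] at this
    rw [norm_eq_zero.mp this.symm, zero_add]
    exact hy
  have hgraph : ∀ f h, (f, h) ∈ S.graph ↔ ∃ m, (f, m) ∈ (absOp S).graph ∧ U m = h := by
    have h1 : ∀ f m, (f, m) ∈ (absOp S).graph → (f, U m) ∈ S.graph := fun f m hm => by
      obtain ⟨x, hx1, hx2⟩ := (LinearPMap.mem_graph_iff _).mp hm
      simp only at hx1 hx2
      rw [← hx2, hUR, ← hx1]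
      exact S.mem_graph (Submodule.inclusion (domain_absOp hS hd).le x)
    intro f h
    constructor
    · intro hf
      obtain ⟨m, hm⟩ := LinearPMap.mem_domain_iff.mp (mem_domain_absOp_of_mem hS hd hf)
      exact ⟨m, hm, LinearPMap.mem_graph_snd_inj _ (h1 f m hm) hf rfl⟩
    · rintro ⟨m, hm, rfl⟩
      exact h1 f m hm
  refine ⟨U, ?_, ?_, ?_⟩
  · refine LinearPMap.eq_of_eq_graph (Submodule.ext fun ⟨f, h⟩ => ?_)
    rw [mem_graph_opMul, hgraph]
    simp only [mem_graph_ofCLM]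
  · have : LinearMap.ker (U : H →ₗ[ℂ] H) = Rᗮ := Submodule.ext hker
    rw [this, Submodule.orthogonal_orthogonal_eq_closure]
    exact hiso
  · intro f
    rw [hker]
    have h1 : f ∈ Rᗮ ↔ (f, (0 : H)) ∈ (absOp S).graph := by
      rw [← adjoint_absOp hS hd, mem_graph_adjoint_iff dense_domain_absOp,
        Submodule.mem_orthogonal']
      constructor
      · intro h x
        rw [inner_zero_left]
        exact (h _ ⟨x, rfl⟩).symm
      · rintro h _ ⟨x, rfl⟩
        have := h x
        rw [inner_zero_left] at this
        exact this.symm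
    rw [h1]
    constructor
    · intro h
      obtain ⟨k, hk, hk'⟩ := exists_mem_graph_of_absOp hS hd h
      rw [norm_zero, norm_eq_zero] at hk'
      subst hk'
      obtain ⟨x, hx1, hx2⟩ := (LinearPMap.mem_graph_iff _).mp hk
      simp only at hx1 hx2
      subst hx1
      exact ⟨x.2, hx2⟩
    · rintro ⟨h2, h3⟩
      have h4 := S.mem_graph ⟨f, h2⟩
      rw [h3] at h4
      obtain ⟨m, hm⟩ := LinearPMap.mem_domain_iff.mp (mem_domain_absOp_of_mem hS hd h4)
      have := norm_absOp hS hd h4 hm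
      rw [norm_zero] at this
      rw [norm_eq_zero.mp this.symm] at hm
      exact hm

theorem isPolarFactor_polarFactor : IsPolarFactor S (polarFactor S) := by
  have h := exists_isPolarFactor hS hd
  rw [polarFactor, dif_pos h]
  exact h.choose_spec

theorem mem_graph_iff_absOp {f h : H} :
    (f, h) ∈ S.graph ↔ ∃ m, (f, m) ∈ (absOp S).graph ∧ polarFactor S m = h := by
  conv_lhs => rw [← (isPolarFactor_polarFactor hS hd).mul_abs]
  rw [mem_graph_opMul]
  simp only [mem_graph_ofCLM]

/-- The range of `|S|` is orthogonal to `ker |S| = ker S = ker U`, so only the component of `f` in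
`(ker U)ᗮ` matters, and there `U` is isometric. -/
theorem inner_polarFactor {f u m : H} (hu : (u, m) ∈ (absOp S).graph) :
    inner ℂ (polarFactor S f) (polarFactor S m) = inner ℂ f m := by
  set U := polarFactor S
  have hP := isPolarFactor_polarFactor hS hd
  have hclosed : IsClosed (LinearMap.ker (U : H →ₗ[ℂ] H) : Set H) :=
    ContinuousLinearMap.isClosed_ker U
  have : CompleteSpace (LinearMap.ker (U : H →ₗ[ℂ] H)) := hclosed.completeSpace_coe
  have hm : m ∈ (LinearMap.ker (U : H →ₗ[ℂ] H))ᗮ := by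
    rw [Submodule.mem_orthogonal]
    intro v hv
    obtain ⟨h1, h2⟩ := (hP.ker_eq v).mp hv
    have h3 := S.mem_graph ⟨v, h1⟩
    rw [h2] at h3
    obtain ⟨k, hk⟩ := LinearPMap.mem_domain_iff.mp (mem_domain_absOp_of_mem hS hd h3)
    have h4 := norm_absOp hS hd h3 hk
    rw [norm_zero] at h4
    rw [norm_eq_zero.mp h4.symm] at hk
    have := inner_absOp hS hd hu hk
    rw [inner_zero_left] at this
    exact this.symm
  obtain ⟨p, hp, y, hy, rfl⟩ :=
    (LinearMap.ker (U : H →ₗ[ℂ] H)).exists_add_mem_mem_orthogonal f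
  have hp' : U p = 0 := hp
  let V : ((LinearMap.ker (U : H →ₗ[ℂ] H))ᗮ : Submodule ℂ H) →ₗᵢ[ℂ] H :=
    ⟨(U : H →ₗ[ℂ] H) ∘ₗ Submodule.subtype _, fun x => hP.isometric x x.2⟩
  have h5 := V.inner_map_map ⟨y, hy⟩ ⟨m, hm⟩
  rw [map_add, hp', zero_add, inner_add_left, (Submodule.mem_orthogonal _ _).mp hm p hp, zero_add]
  exact h5

/-- For `f` in `dom |S|` one has `S† U f = |S| f`, because `⟨U f, U |S| x⟩ = ⟨f, |S| x⟩`. Applying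
`S = U |S|` once more gives `S S† U f = U S† S f`. -/
theorem intertwines_polarFactor (hd' : Dense (S†.domain : Set H)) :
    Intertwines (polarFactor S) (opMul S† S) (opMul S†† S†) := by
  intro f h hf
  obtain ⟨m, h1, h2⟩ := mem_graph_absOp_sq hS hd hf
  rw [mem_graph_opMul, adjoint_adjoint_of_isClosed hS hd hd']
  refine ⟨m, ?_, (mem_graph_iff_absOp hS hd).mpr ⟨h, h2, rfl⟩⟩
  rw [mem_graph_adjoint_iff hd]
  intro x
  obtain ⟨k, hk1, hk2⟩ := (mem_graph_iff_absOp hS hd).mp (S.mem_graph x)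
  rw [← hk2, inner_polarFactor hS hd hk1]
  exact inner_absOp hS hd hk1 h1

/-- `U_S |S|^z ⊆ |S†|^z U_S`. -/
theorem intertwines_opPow_absOp (hd' : Dense (S†.domain : Set H)) (z : ℂ) :
    Intertwines (polarFactor S) (opPow (absOp S) z) (opPow (absOp S†) z) := by
  have hSa : S†.IsClosed := LinearPMap.adjoint_isClosed hd
  have hda : Dense (S††.domain : Set H) := by rwa [adjoint_adjoint_of_isClosed hS hd hd']
  have h1 := intertwines_polarFactor hS hd hd'
  rw [← integral_spectralMeasure_adjoint_mul_self hS hd,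
    ← integral_spectralMeasure_adjoint_mul_self hSa hd'] at h1
  -- Two passages through spectral projections are needed: from `S† S` to `|S|`, and then from `|S|`
  -- to its powers, since the spectral measure of `|S|` is chosen separately.
  have h2 : Intertwines (polarFactor S) (absOp S) (absOp S†) :=
    ProjMeasure.intertwines_integral (fun s hs => ProjMeasure.mul_proj_of_intertwines h1 hs)
      measurable_csqrt
  rw [← integral_spectralMeasure_absOp hS hd, ← integral_spectralMeasure_absOp hSa hd'] at h2
  exact ProjMeasure.intertwines_integral
    (fun s hs => ProjMeasure.mul_proj_of_intertwines h2 hs) (measurable_cpow_ofReal z)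

end AbsoluteValue

/-! ### Three lines -/

theorem linear_le_quadratic {c k : ℝ} (hc : 0 ≤ c) (hk : 0 < k) (y : ℝ) :
    c * |y| ≤ k * y ^ 2 + k⁻¹ * c ^ 2 := by
  have h1 : 0 ≤ k⁻¹ * (k * |y| - c) ^ 2 := by positivity
  have h2 : k⁻¹ * (k * |y| - c) ^ 2 = k * y ^ 2 - 2 * (c * |y|) + k⁻¹ * c ^ 2 := by
    rw [← sq_abs y]; field_simp; ring
  have h3 : 0 ≤ c * |y| := by positivity
  linarith

/-- The three lines theorem for functions of exponential growth on the strip. -/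
theorem norm_le_interp_of_exp_growth {V : Type*} [NormedAddCommGroup V] [NormedSpace ℂ V]
    {F : ℂ → V} (hF : Differentiable ℂ F) {a b c M : ℝ} (ha : 0 ≤ a) (hb : 0 ≤ b) (hc : 0 ≤ c)
    (hM : ∀ z : ℂ, 0 ≤ z.re → z.re ≤ 1 → ‖F z‖ ≤ M * Real.exp (c * |z.im|))
    (h0 : ∀ z : ℂ, z.re = 0 → ‖F z‖ ≤ a * Real.exp (c * |z.im|))
    (h1 : ∀ z : ℂ, z.re = 1 → ‖F z‖ ≤ b * Real.exp (c * |z.im|)) {k : ℝ} (hk : 0 < k) {z : ℂ}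
    (hz0 : 0 ≤ z.re) (hz1 : z.re ≤ 1) :
    ‖F z‖ ≤ a ^ (1 - z.re) * b ^ z.re *
      Real.exp (k * |z.im| ^ 2 + k * z.re * (1 - z.re) + k⁻¹ * c ^ 2) := by
  set D := Real.exp (k⁻¹ * c ^ 2) with hD
  have hM0 : 0 ≤ M := by
    have := (norm_nonneg _).trans (hM 0 le_rfl zero_le_one)
    simpa using this
  -- With `z = x + iy`, the factor has modulus `e^{-k y² - k x(1-x)}`. The Gaussian decay absorbs
  -- `e^{c|y|}` at the cost of `e^{c²/k}`, and the choice `z² - z` makes the modulus the same on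
  -- both boundary lines.
  let G : ℂ → V := fun z => Complex.exp (k * (z ^ 2 - z)) • F z
  have hnorm : ∀ z : ℂ, ‖G z‖
      = Real.exp (-(k * z.im ^ 2) - k * z.re * (1 - z.re)) * ‖F z‖ := fun z => by
    rw [norm_smul, Complex.norm_exp]
    congr 2
    simp [sq]
    ring
  have hG : ∀ (z : ℂ) (m : ℝ), 0 ≤ m → 0 ≤ z.re → z.re ≤ 1 → ‖F z‖ ≤ m * Real.exp (c * |z.im|) →
      ‖G z‖ ≤ m * D := fun z m hm hz0 hz1 h => by
    rw [hnorm]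
    calc _ ≤ Real.exp (-(k * z.im ^ 2) - k * z.re * (1 - z.re))
          * (m * Real.exp (c * |z.im|)) := by gcongr
      _ = m * Real.exp (-(k * z.im ^ 2) - k * z.re * (1 - z.re) + c * |z.im|) := by
          rw [Real.exp_add]; ring
      _ ≤ m * D := by
          refine mul_le_mul_of_nonneg_left (Real.exp_le_exp.mpr ?_) hm
          have := linear_le_quadratic hc hk z.im
          have h2 : 0 ≤ k * z.re * (1 - z.re) :=
            mul_nonneg (mul_nonneg hk.le hz0) (sub_nonneg.mpr hz1)
          linarith
  have hGd : Differentiable ℂ G := by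
    refine Differentiable.smul ?_ hF
    fun_prop
  have key := Complex.HadamardThreeLines.norm_le_interp_of_mem_verticalClosedStrip₀₁' G (z := z)
    (a := a * D) (b := b * D) ⟨hz0, hz1⟩ hGd.diffContOnCl
    ⟨M * D, by
      rintro _ ⟨w, hw, rfl⟩
      exact hG w M hM0 hw.1 hw.2 (hM w hw.1 hw.2)⟩
    (fun w hw => by
      have hw : w.re = 0 := hw
      exact hG w a ha hw.ge (by rw [hw]; exact zero_le_one) (h0 w hw))
    (fun w hw => by
      have hw : w.re = 1 := hw
      exact hG w b hb (by rw [hw]; exact zero_le_one) hw.le (h1 w hw))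
  have hD0 : 0 < D := Real.exp_pos _
  rw [Real.mul_rpow ha hD0.le, Real.mul_rpow hb hD0.le,
    show a ^ (1 - z.re) * D ^ (1 - z.re) * (b ^ z.re * D ^ z.re)
      = a ^ (1 - z.re) * b ^ z.re * (D ^ (1 - z.re) * D ^ z.re) by ring,
    ← Real.rpow_add hD0, sub_add_cancel, Real.rpow_one, hnorm] at key
  have h2 : Real.exp (k * |z.im| ^ 2 + k * z.re * (1 - z.re) + k⁻¹ * c ^ 2)
      = Real.exp (k * z.im ^ 2 + k * z.re * (1 - z.re)) * D := by
    rw [← Real.exp_add, sq_abs]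
  have h3 : ‖F z‖ = Real.exp (k * z.im ^ 2 + k * z.re * (1 - z.re))
      * (Real.exp (-(k * z.im ^ 2) - k * z.re * (1 - z.re)) * ‖F z‖) := by
    rw [← mul_assoc, ← Real.exp_add]
    ring_nf
    simp
  rw [h3, h2]
  calc _ ≤ Real.exp (k * z.im ^ 2 + k * z.re * (1 - z.re)) * (a ^ (1 - z.re) * b ^ z.re * D) := by
        gcongr
    _ = _ := by ring

/-! ### Powers -/

theorem norm_cpow_ofReal {t : ℝ} (ht : t ≠ 0) (z : ℂ) :
    ‖(t : ℂ) ^ z‖ = |t| ^ z.re * Real.exp (-(Complex.arg t * z.im)) := by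
  rw [Complex.norm_cpow_of_ne_zero (Complex.ofReal_ne_zero.mpr ht), Complex.norm_real,
    Real.norm_eq_abs, div_eq_mul_inv, ← Real.exp_neg]

theorem arg_ofReal_nonneg (t : ℝ) : 0 ≤ Complex.arg t := by
  rw [Complex.arg_nonneg_iff]; simp

theorem norm_cpow_ofReal_le {t : ℝ} (ht : t ≠ 0) (z : ℂ) :
    ‖(t : ℂ) ^ z‖ ≤ |t| ^ z.re * Real.exp (Real.pi * |z.im|) := by
  rw [norm_cpow_ofReal ht]
  gcongr
  have h1 := arg_ofReal_nonneg t
  have h2 := Complex.arg_le_pi t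
  calc -(Complex.arg t * z.im) ≤ |Complex.arg t * z.im| := neg_le_abs _
    _ = Complex.arg t * |z.im| := by rw [abs_mul, abs_of_nonneg h1]
    _ ≤ _ := by gcongr

/-- The set `{1/(n+1) ≤ |t| ≤ n+1}`. -/
def band (n : ℕ) : Set ℝ := {t | 1 / ((n : ℝ) + 1) ≤ |t| ∧ |t| ≤ n + 1}

theorem measurableSet_band (n : ℕ) : MeasurableSet (band n) := by
  have h1 : MeasurableSet {t : ℝ | 1 / ((n : ℝ) + 1) ≤ |t|} :=
    measurableSet_le measurable_const (by fun_prop)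
  have h2 : MeasurableSet {t : ℝ | |t| ≤ (n : ℝ) + 1} :=
    measurableSet_le (by fun_prop) measurable_const
  exact h1.inter h2

theorem ne_zero_of_mem_band {n : ℕ} {t : ℝ} (ht : t ∈ band n) : t ≠ 0 := by
  rintro rfl
  have h1 := ht.1
  rw [abs_zero] at h1
  have : (0 : ℝ) < 1 / ((n : ℝ) + 1) := by positivity
  linarith

theorem eventually_mem_band {t : ℝ} (ht : t ≠ 0) : ∀ᶠ n in atTop, t ∈ band n := by
  obtain ⟨N, hN⟩ := exists_nat_one_div_lt (abs_pos.mpr ht)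
  obtain ⟨M, hM⟩ := exists_nat_ge |t|
  filter_upwards [eventually_ge_atTop N, eventually_ge_atTop M] with n hn hm
  have h1 : (N : ℝ) ≤ n := Nat.cast_le.mpr hn
  have h2 : (M : ℝ) ≤ n := Nat.cast_le.mpr hm
  refine ⟨le_trans ?_ hN.le, by linarith⟩
  exact one_div_le_one_div_of_le (by positivity) (by linarith)

theorem abs_rpow_le_of_mem_band {n : ℕ} {t : ℝ} (ht : t ∈ band n) (x : ℝ) :
    |t| ^ x ≤ ((n : ℝ) + 1) ^ |x| := by
  have hn : (0 : ℝ) < n + 1 := by positivity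
  have ht0 : 0 < |t| := abs_pos.mpr (ne_zero_of_mem_band ht)
  rcases le_total 0 x with hx | hx
  · rw [abs_of_nonneg hx]
    exact Real.rpow_le_rpow ht0.le ht.2 hx
  · rw [abs_of_nonpos hx]
    have h1 := Real.rpow_le_rpow_of_nonpos (by positivity) ht.1 hx
    rw [one_div, Real.inv_rpow hn.le, ← Real.rpow_neg hn.le] at h1
    exact h1

/-- `t ↦ t^z`, cut off to `band n`. -/
def bandPow (n : ℕ) (z : ℂ) : ℝ → ℂ := (band n).indicator fun t => (t : ℂ) ^ z

theorem norm_bandPow_le (n : ℕ) (z : ℂ) (t : ℝ) :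
    ‖bandPow n z t‖ ≤ ((n : ℝ) + 1) ^ |z.re| * Real.exp (Real.pi * |z.im|) := by
  by_cases ht : t ∈ band n
  · rw [bandPow, Set.indicator_of_mem ht]
    refine (norm_cpow_ofReal_le (ne_zero_of_mem_band ht) z).trans ?_
    gcongr
    exact abs_rpow_le_of_mem_band ht _
  · rw [bandPow, Set.indicator_of_notMem ht, norm_zero]
    positivity

theorem bddMeas_bandPow (n : ℕ) (z : ℂ) : BddMeas (bandPow n z) :=
  ⟨(measurable_cpow_ofReal z).indicator (measurableSet_band n), _, norm_bandPow_le n z⟩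

theorem bandPow_mul (n : ℕ) (z w : ℂ) : bandPow n z * bandPow n w = bandPow n (z + w) := by
  ext t
  by_cases ht : t ∈ band n
  · simp only [bandPow, Pi.mul_apply, Set.indicator_of_mem ht]
    rw [Complex.cpow_add _ _ (Complex.ofReal_ne_zero.mpr (ne_zero_of_mem_band ht))]
  · simp only [bandPow, Pi.mul_apply, Set.indicator_of_notMem ht, mul_zero]

theorem bandPow_zero (n : ℕ) : bandPow n 0 = (band n).indicator 1 := by
  ext t
  by_cases ht : t ∈ band n <;> simp [bandPow, ht]

theorem bandPow_one (n : ℕ) : bandPow n 1 = (band n).indicator fun t => (t : ℂ) := by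
  ext t
  by_cases ht : t ∈ band n <;> simp [bandPow, ht]

namespace ProjMeasure

variable {E : ProjMeasure H}

theorem op_smul (c : ℂ) {g : ℝ → ℂ} (hg : BddMeas g) :
    E.op (fun t => c * g t) = c • E.op g := by
  have := op_mul (E := E) (BddMeas.const c) hg
  rw [op_const, smul_mul_assoc, one_mul] at this
  exact this

theorem op_bandPow_mul (n : ℕ) (z w : ℂ) :
    E.op (bandPow n z) * E.op (bandPow n w) = E.op (bandPow n (z + w)) := by
  rw [← op_mul (bddMeas_bandPow n z) (bddMeas_bandPow n w), bandPow_mul]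

theorem op_bandPow_zero (n : ℕ) : E.op (bandPow n 0) = E.proj (band n) := by
  rw [bandPow_zero, op_indicator_one (measurableSet_band n)]

theorem norm_op_bandPow_le (n : ℕ) (z : ℂ) :
    ‖E.op (bandPow n z)‖ ≤ ((n : ℝ) + 1) ^ |z.re| * Real.exp (Real.pi * |z.im|) :=
  norm_op_le (bddMeas_bandPow n z) (fun _ => .of_forall (norm_bandPow_le n z)) (by positivity)

theorem norm_proj_le {s : Set ℝ} (hs : MeasurableSet s) : ‖E.proj s‖ ≤ 1 :=
  (E.isStarProjection _ hs).norm_le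

/-- On a band `log λ` is bounded, so the derivative is the integral of `λ^z log λ` there; the
remainder is quadratic, uniformly in `λ`, by `|e^w - 1 - w| ≤ |w|²` for `|w| ≤ 1`. -/
theorem differentiable_op_bandPow (n : ℕ) : Differentiable ℂ fun z => E.op (bandPow n z) := by
  intro z
  have hn : (0 : ℝ) < n + 1 := by positivity
  let L : ℝ := Real.log (n + 1) + Real.pi
  have hlog : ∀ t ∈ band n, ‖Complex.log t‖ ≤ L := fun t ht => by
    have ht0 : 0 < |t| := abs_pos.mpr (ne_zero_of_mem_band ht)
    refine (Complex.norm_le_abs_re_add_abs_im _).trans ?_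
    rw [Complex.log_re, Complex.log_im, Complex.norm_real, Real.norm_eq_abs]
    refine add_le_add ?_ (Complex.abs_arg_le_pi _)
    rw [abs_le]
    refine ⟨?_, Real.log_le_log ht0 ht.2⟩
    have := Real.log_le_log (by positivity) ht.1
    rwa [one_div, Real.log_inv] at this
  have hL : 0 ≤ L := add_nonneg (Real.log_nonneg (by linarith [n.cast_nonneg (α := ℝ)]))
    Real.pi_pos.le
  let ℓ : ℝ → ℂ := (band n).indicator fun t => Complex.log t
  have hℓ : BddMeas ℓ := BddMeas.indicator_of_le
    (Complex.measurable_log.comp Complex.measurable_ofReal) (measurableSet_band n) L hlog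
  have hd := (bddMeas_bandPow n z).mul hℓ
  refine HasDerivAt.differentiableAt (f' := E.op (bandPow n z * ℓ)) ?_
  rw [hasDerivAt_iff_isLittleO_nhds_zero]
  refine Asymptotics.IsBigO.trans_isLittleO (g := fun h : ℂ => h ^ 2) ?_
    (Asymptotics.isLittleO_pow_id one_lt_two)
  set C := ((n : ℝ) + 1) ^ |z.re| * Real.exp (Real.pi * |z.im|) with hC
  have hC0 : 0 ≤ C := by positivity
  refine Asymptotics.IsBigO.of_bound (C * L ^ 2) ?_
  have hball : ∀ᶠ h : ℂ in 𝓝 0, ‖h‖ < 1 / (L + 1) := by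
    have := Metric.ball_mem_nhds (0 : ℂ) (show 0 < 1 / (L + 1) by positivity)
    filter_upwards [this] with h hh
    simpa using hh
  filter_upwards [hball] with h hh
  have hb1 : BddMeas fun t => (-1 : ℂ) * bandPow n z t :=
    (BddMeas.const (-1)).mul (bddMeas_bandPow n z)
  have hb2 : BddMeas fun t => (-h) * (bandPow n z * ℓ) t := (BddMeas.const (-h)).mul hd
  have h1 : E.op (bandPow n (z + h)) - E.op (bandPow n z) - h • E.op (bandPow n z * ℓ)
      = E.op ((bandPow n (z + h) + fun t => (-1 : ℂ) * bandPow n z t)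
        + fun t => (-h) * (bandPow n z * ℓ) t) := by
    rw [op_add ((bddMeas_bandPow n _).add hb1) hb2, op_add (bddMeas_bandPow n _) hb1,
      op_smul _ (bddMeas_bandPow n z), op_smul _ hd]
    rw [neg_smul, neg_smul, one_smul, sub_eq_add_neg, sub_eq_add_neg]
  rw [h1, norm_pow]
  refine norm_op_le (((bddMeas_bandPow n _).add hb1).add hb2) (fun f => .of_forall fun t => ?_)
    (by positivity)
  by_cases ht : t ∈ band n
  · have ht0 : (t : ℂ) ≠ 0 := Complex.ofReal_ne_zero.mpr (ne_zero_of_mem_band ht)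
    have h2 : ((bandPow n (z + h) + fun t => (-1 : ℂ) * bandPow n z t)
        + fun t => (-h) * (bandPow n z * ℓ) t) t
        = bandPow n z t * (Complex.exp (Complex.log t * h) - 1 - Complex.log t * h) := by
      simp only [Pi.add_apply, Pi.mul_apply, bandPow, ℓ, Set.indicator_of_mem ht]
      rw [Complex.cpow_add _ _ ht0, Complex.cpow_def_of_ne_zero ht0 h]
      ring
    have h3 : ‖Complex.log t * h‖ ≤ L * ‖h‖ := by
      rw [norm_mul]
      exact mul_le_mul_of_nonneg_right (hlog t ht) (norm_nonneg _)
    have h4 : L * ‖h‖ ≤ 1 := by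
      have : ‖h‖ * (L + 1) ≤ 1 := (le_div_iff₀ (by positivity)).mp hh.le
      nlinarith [norm_nonneg h]
    rw [h2, norm_mul]
    have h5 := Complex.norm_exp_sub_one_sub_id_le (h3.trans h4)
    calc _ ≤ C * ‖Complex.log t * h‖ ^ 2 := by
          gcongr
          exact norm_bandPow_le n z t
      _ ≤ C * (L * ‖h‖) ^ 2 := by gcongr
      _ = _ := by ring
  · simp only [Pi.add_apply, Pi.mul_apply, bandPow, Set.indicator_of_notMem ht]
    simp only [mul_zero, zero_mul, add_zero, norm_zero]
    positivity

end ProjMeasure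

/-! ### Bounded operators as partial operators -/

theorem opMul_ofCLM (A B : H →L[ℂ] H) : opMul (ofCLM A) (ofCLM B) = ofCLM (A * B) := by
  refine LinearPMap.eq_of_eq_graph (Submodule.ext fun ⟨f, h⟩ => ?_)
  simp only [mem_graph_opMul, mem_graph_ofCLM, exists_eq_left']
  rfl

theorem adjoint_ofCLM (A : H →L[ℂ] H) : (ofCLM A)† = ofCLM (ContinuousLinearMap.adjoint A) := by
  have hd : Dense ((ofCLM A).domain : Set H) := by
    change Dense ((⊤ : Submodule ℂ H) : Set H)
    exact dense_univ
  refine LinearPMap.eq_of_eq_graph (Submodule.ext fun ⟨u, w⟩ => ?_)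
  rw [mem_graph_adjoint_iff hd, mem_graph_ofCLM]
  constructor
  · intro h
    refine ext_inner_right ℂ fun v => ?_
    rw [ContinuousLinearMap.adjoint_inner_left]
    exact (h ⟨v, trivial⟩).symm
  · rintro rfl x
    rw [ContinuousLinearMap.adjoint_inner_left]
    rfl

/-- The closed graph theorem for the product of a closed and a bounded operator. -/
theorem exists_opMul_eq_ofCLM {A : H →ₗ.[ℂ] H} (hA : A.IsClosed) (V : H →L[ℂ] H)
    (hV : ∀ f, V f ∈ A.domain) : ∃ W : H →L[ℂ] H, opMul A (ofCLM V) = ofCLM W := by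
  let L : H →ₗ[ℂ] H :=
    { toFun := fun f => A ⟨V f, hV f⟩
      map_add' := fun f g => by
        rw [← A.map_add]; congr 1; exact Subtype.ext (map_add V f g)
      map_smul' := fun c f => by
        rw [RingHom.id_apply, ← A.map_smul]; congr 1; exact Subtype.ext (map_smul V c f) }
  have hL : ∀ f h, L f = h ↔ (V f, h) ∈ A.graph := fun f h => by
    rw [LinearPMap.mem_graph_iff]
    constructor
    · rintro rfl; exact ⟨⟨V f, hV f⟩, rfl, rfl⟩
    · rintro ⟨y, hy, rfl⟩
      exact congrArg A (Subtype.ext hy.symm)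
  have hc : Continuous L := by
    refine L.continuous_of_isClosed_graph ?_
    have h1 : (L.graph : Set (H × H)) = (fun p : H × H => (V p.1, p.2)) ⁻¹' (A.graph : Set (H × H)) := by
      ext ⟨f, h⟩
      simp only [SetLike.mem_coe, LinearMap.mem_graph_iff, Set.mem_preimage]
      rw [← hL]
      exact eq_comm
    rw [h1]
    exact IsClosed.preimage (by fun_prop) hA
  refine ⟨⟨L, hc⟩, LinearPMap.eq_of_eq_graph (Submodule.ext fun ⟨f, h⟩ => ?_)⟩
  simp only [mem_graph_opMul, mem_graph_ofCLM, exists_eq_left']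
  exact (hL f h).symm

theorem isClosed_ofCLM (K : H →L[ℂ] H) : (ofCLM K).IsClosed := by
  have h1 : ((ofCLM K).graph : Set (H × H)) = {p | K p.1 = p.2} := by
    ext ⟨f, h⟩
    exact mem_graph_ofCLM
  change IsClosed ((ofCLM K).graph : Set (H × H))
  rw [h1]
  exact isClosed_eq (by fun_prop) (by fun_prop)

/-- A densely defined operator that agrees with a bounded one is closable, and the closure is
that bounded operator. -/
theorem isClosable_and_closure_eq_ofCLM {D : H →ₗ.[ℂ] H} (hD : Dense (D.domain : Set H))
    {K : H →L[ℂ] H} (h : ∀ f g, (f, g) ∈ D.graph → K f = g) :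
    D.IsClosable ∧ D.closure = ofCLM K := by
  have hle : D ≤ ofCLM K := LinearPMap.le_of_le_graph fun ⟨f, g⟩ hp =>
    mem_graph_ofCLM.mpr (h f g hp)
  have hcl : D.IsClosable := (isClosed_ofCLM K).isClosable.leIsClosable hle
  refine ⟨hcl, LinearPMap.eq_of_eq_graph ?_⟩
  rw [← hcl.graph_closure_eq_closure_graph]
  refine le_antisymm (Submodule.topologicalClosure_minimal _ (LinearPMap.le_graph_of_le hle)
    (isClosed_ofCLM K)) ?_
  rintro ⟨f, g⟩ hp
  obtain rfl := mem_graph_ofCLM.mp hp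
  obtain ⟨u, hu, hlim⟩ := mem_closure_iff_seq_limit.mp (hD f)
  change (f, K f) ∈ closure (D.graph : Set (H × H))
  refine mem_closure_of_tendsto (hlim.prodMk_nhds ((K.continuous.tendsto f).comp hlim))
    (.of_forall fun n => ?_)
  obtain ⟨y, hy⟩ := LinearPMap.mem_domain_iff.mp (hu n)
  have := h _ _ hy
  simpa [this] using hy

/-! ### Powers of an operator with a spectral gap -/

/-- `t ↦ t^z`, cut off to `|t| ≥ δ`. -/
def gapPow (δ : ℝ) (z : ℂ) : ℝ → ℂ := {t : ℝ | δ ≤ |t|}.indicator fun t => (t : ℂ) ^ z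

theorem measurableSet_le_abs (δ : ℝ) : MeasurableSet {t : ℝ | δ ≤ |t|} :=
  measurableSet_le measurable_const (by fun_prop)

theorem bddMeas_gapPow {δ : ℝ} (hδ : 0 < δ) {z : ℂ} (hz : z.re ≤ 0) : BddMeas (gapPow δ z) := by
  refine BddMeas.indicator_of_le (measurable_cpow_ofReal z) (measurableSet_le_abs δ)
    (δ ^ z.re * Real.exp (Real.pi * |z.im|)) fun t ht => ?_
  have ht : δ ≤ |t| := ht
  refine (norm_cpow_ofReal_le (abs_pos.mp (hδ.trans_le ht)) z).trans ?_
  gcongr ?_ * _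
  exact Real.rpow_le_rpow_of_nonpos hδ ht hz

/-- The bound keeps the sign of `Im z`: since `arg t ≥ 0`, only negative `Im z` costs anything. In a
product of the powers `-z` and `z` only one factor then grows, which gives `e^{c|Im z|}` instead of
`e^{2c|Im z|}`. The value `c = π` always works, and `c = 0` for nonnegative spectrum. -/
theorem norm_bandPow_le_of_arg_le {c : ℝ} (n : ℕ) (z : ℂ) {t : ℝ} (ht : Complex.arg t ≤ c) :
    ‖bandPow n z t‖ ≤ ((n : ℝ) + 1) ^ |z.re| * Real.exp (c * max 0 (-z.im)) := by
  by_cases hb : t ∈ band n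
  · rw [bandPow, Set.indicator_of_mem hb, norm_cpow_ofReal (ne_zero_of_mem_band hb)]
    have h0 := arg_ofReal_nonneg t
    have h1 : -(Complex.arg t * z.im) ≤ c * max 0 (-z.im) := by
      calc -(Complex.arg t * z.im) = Complex.arg t * (-z.im) := by ring
        _ ≤ Complex.arg t * max 0 (-z.im) := by gcongr; exact le_max_right _ _
        _ ≤ _ := by gcongr
    gcongr
    exact abs_rpow_le_of_mem_band hb _
  · rw [bandPow, Set.indicator_of_notMem hb, norm_zero]
    positivity

namespace ProjMeasure

variable {E : ProjMeasure H}

theorem norm_op_bandPow_le_of_arg_le {c : ℝ} (hc : ∀ f, ∀ᵐ t ∂(E.scalar f), Complex.arg (t : ℝ) ≤ c)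
    (n : ℕ) (z : ℂ) :
    ‖E.op (bandPow n z)‖ ≤ ((n : ℝ) + 1) ^ |z.re| * Real.exp (c * max 0 (-z.im)) :=
  norm_op_le (bddMeas_bandPow n z)
    (fun f => (hc f).mono fun _ ht => norm_bandPow_le_of_arg_le n z ht) (by positivity)

variable {δ : ℝ} (hδ : 0 < δ) (hE : ∀ f, ∀ᵐ t ∂(E.scalar f), δ ≤ |t|)
include hδ hE

theorem integral_cpow_eq_ofCLM {z : ℂ} (hz : z.re ≤ 0) :
    E.integral (fun t => (t : ℂ) ^ z) (measurable_cpow_ofReal z) = ofCLM (E.op (gapPow δ z)) := by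
  rw [← integral_eq_ofCLM (bddMeas_gapPow hδ hz)]
  refine integral_congr _ _ _ fun f => ?_
  filter_upwards [hE f] with t ht
  exact (Set.indicator_of_mem (s := {t : ℝ | δ ≤ |t|}) ht fun t : ℝ => (t : ℂ) ^ z).symm

theorem op_gapPow_mul {z w : ℂ} (hz : z.re ≤ 0) (hw : w.re ≤ 0) :
    E.op (gapPow δ z) * E.op (gapPow δ w) = E.op (gapPow δ (z + w)) := by
  have hzw : (z + w).re ≤ 0 := by rw [Complex.add_re]; linarith
  rw [← op_mul (bddMeas_gapPow hδ hz) (bddMeas_gapPow hδ hw)]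
  refine op_congr ((bddMeas_gapPow hδ hz).mul (bddMeas_gapPow hδ hw)) (bddMeas_gapPow hδ hzw)
    fun f => ?_
  filter_upwards [hE f] with t ht
  simp only [gapPow, Pi.mul_apply, Set.indicator_of_mem (s := {t : ℝ | δ ≤ |t|}) ht]
  rw [Complex.cpow_add _ _ (Complex.ofReal_ne_zero.mpr (abs_pos.mp (hδ.trans_le ht)))]

theorem op_gapPow_mul_bandPow {w : ℂ} (hw : w.re ≤ 0) (n : ℕ) (z : ℂ) :
    E.op (gapPow δ w) * E.op (bandPow n z) = E.op (bandPow n (w + z)) := by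
  rw [← op_mul (bddMeas_gapPow hδ hw) (bddMeas_bandPow n z)]
  refine op_congr ((bddMeas_gapPow hδ hw).mul (bddMeas_bandPow n z)) (bddMeas_bandPow n _)
    fun f => ?_
  filter_upwards [hE f] with t ht
  by_cases hb : t ∈ band n
  · simp only [gapPow, bandPow, Pi.mul_apply, Set.indicator_of_mem (s := {t : ℝ | δ ≤ |t|}) ht,
      Set.indicator_of_mem hb]
    rw [Complex.cpow_add _ _ (Complex.ofReal_ne_zero.mpr (ne_zero_of_mem_band hb))]
  · simp only [bandPow, Pi.mul_apply, Set.indicator_of_notMem hb, mul_zero]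

theorem op_bandPow_mul_gapPow {w : ℂ} (hw : w.re ≤ 0) (n : ℕ) (z : ℂ) :
    E.op (bandPow n z) * E.op (gapPow δ w) = E.op (bandPow n (w + z)) := by
  rw [op_mul_comm (bddMeas_bandPow n z) (bddMeas_gapPow hδ hw), op_gapPow_mul_bandPow hδ hE hw]

theorem op_gapPow_mul_proj {w : ℂ} (hw : w.re ≤ 0) (n : ℕ) :
    E.op (gapPow δ w) * E.proj (band n) = E.op (bandPow n w) := by
  rw [← op_bandPow_zero, op_gapPow_mul_bandPow hδ hE hw, add_zero]

theorem proj_mul_op_gapPow {w : ℂ} (hw : w.re ≤ 0) (n : ℕ) :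
    E.proj (band n) * E.op (gapPow δ w) = E.op (bandPow n w) := by
  rw [← op_bandPow_zero, op_bandPow_mul_gapPow hδ hE hw, add_zero]

theorem tendsto_proj_band (f : H) : Tendsto (fun n => E.proj (band n) f) atTop (𝓝 f) := by
  refine tendsto_proj measurableSet_band ?_
  filter_upwards [hE f] with t ht
  exact eventually_mem_band (abs_pos.mp (hδ.trans_le ht))

/-- A form of the Heinz inequality: if `A = ∫ λ dG` is bounded relative to `∫ λ dE`, then the power
`A^x` is bounded relative to the power with exponent `x` of `∫ λ dE`. -/
theorem memLp_cpow_of_memLp {G : ProjMeasure H} {C : H →L[ℂ] H}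
    (hG : ∀ f, MemLp (fun t : ℝ => (t : ℂ)) 2 (G.scalar (E.op (gapPow δ (-1)) f)) ∧
      G.app (fun t : ℝ => (t : ℂ)) Complex.measurable_ofReal (E.op (gapPow δ (-1)) f) = C f)
    {x : ℝ} (hx0 : 0 ≤ x) (hx1 : x ≤ 1) (f : H) :
    MemLp (fun t : ℝ => (t : ℂ) ^ (x : ℂ)) 2 (G.scalar (E.op (gapPow δ (-x)) f)) := by
  -- The case `x = 0` is separate because `0^0 = 1`, whereas the band cut-offs vanish at `0`.
  rcases hx0.eq_or_lt with rfl | hx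
  · simpa using memLp_const (1 : ℂ)
  have hxre : (-(x : ℂ)).re ≤ 0 := by simpa using hx0
  -- The three lines bound with `k = 1` and growth rate `2π`. Only its independence of `m` and `n`
  -- is needed, so the crude rate is enough.
  set Q : ℝ := ‖C‖ ^ x * Real.exp (x * (1 - x) + (2 * Real.pi) ^ 2) with hQ
  have hnorm : ∀ (m n : ℕ), ‖G.op (bandPow n x) * E.op (bandPow m (-x))‖ ≤ Q := fun m n => by
    have hπ := Real.pi_pos.le
    have hexp : ∀ y : ℝ, Real.exp (Real.pi * |y|) * Real.exp (Real.pi * |y|)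
        = Real.exp (2 * Real.pi * |y|) := fun y => by rw [← Real.exp_add]; ring_nf
    have key := norm_le_interp_of_exp_growth
      (F := fun z => G.op (bandPow n z) * E.op (bandPow m (-z))) ?_ (a := 1) (b := ‖C‖)
      (c := 2 * Real.pi) (M := ((n : ℝ) + 1) * ((m : ℝ) + 1)) zero_le_one (norm_nonneg _)
      (by positivity) ?_ ?_ ?_ one_pos (z := x) (by simpa using hx0) (by simpa using hx1)
    · simpa [hQ] using key
    · have h1 := differentiable_op_bandPow (E := G) n
      have h2 := (differentiable_op_bandPow (E := E) m).comp differentiable_neg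
      exact h1.mul h2
    · intro z hz0 hz1
      have h1 := norm_op_bandPow_le (E := G) n z
      have h2 := norm_op_bandPow_le (E := E) m (-z)
      simp only [Complex.neg_re, Complex.neg_im, abs_neg, abs_of_nonneg hz0] at h1 h2
      have h3 : ∀ k : ℕ, ((k : ℝ) + 1) ^ z.re ≤ k + 1 := fun k => by
        conv_rhs => rw [← Real.rpow_one ((k : ℝ) + 1)]
        exact Real.rpow_le_rpow_of_exponent_le (by linarith [k.cast_nonneg (α := ℝ)]) hz1
      calc _ ≤ ‖G.op (bandPow n z)‖ * ‖E.op (bandPow m (-z))‖ := norm_mul_le _ _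
        _ ≤ (((n : ℝ) + 1) * Real.exp (Real.pi * |z.im|))
            * (((m : ℝ) + 1) * Real.exp (Real.pi * |z.im|)) := by
          gcongr
          · exact h1.trans (by gcongr; exact h3 n)
          · exact h2.trans (by gcongr; exact h3 m)
        _ = _ := by rw [← hexp]; ring
    · intro z hz
      have h1 := norm_op_bandPow_le (E := G) n z
      have h2 := norm_op_bandPow_le (E := E) m (-z)
      simp only [Complex.neg_re, Complex.neg_im, abs_neg, hz, abs_zero, neg_zero, Real.rpow_zero,
        one_mul] at h1 h2
      calc _ ≤ ‖G.op (bandPow n z)‖ * ‖E.op (bandPow m (-z))‖ := norm_mul_le _ _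
        _ ≤ Real.exp (Real.pi * |z.im|) * Real.exp (Real.pi * |z.im|) := by gcongr
        _ = _ := by rw [hexp, one_mul]
    · intro z hz
      have hw : (z - 1).re = 0 := by simp [hz]
      have h0 : G.op (bandPow n 1) * E.op (gapPow δ (-1)) = G.proj (band n) * C := by
        ext f
        change G.op (bandPow n 1) (E.op (gapPow δ (-1)) f) = G.proj (band n) (C f)
        rw [← (hG f).2, ← op_indicator_one (measurableSet_band n),
          op_app (BddMeas.indicator_one (measurableSet_band n)) _ (hG f).1,
          op_apply (bddMeas_bandPow n 1)]
        congr 1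
        rw [bandPow_one]
        ext t
        by_cases ht : t ∈ band n <;> simp [ht]
      -- On `Re z = 1`, split off the exponents `1` and `-1`; they combine to the bounded operator
      -- `C`, and the remaining exponents `±(z - 1)` are imaginary.
      have h1 : G.op (bandPow n z) * E.op (bandPow m (-z))
          = G.op (bandPow n (z - 1)) * (G.proj (band n) * C) * E.op (bandPow m (-(z - 1))) := by
        rw [← h0, ← mul_assoc, op_bandPow_mul, mul_assoc,
          op_gapPow_mul_bandPow hδ hE (by simp)]
        congr 3 <;> ring
      have h2 := norm_op_bandPow_le (E := G) n (z - 1)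
      have h3 := norm_op_bandPow_le (E := E) m (-(z - 1))
      have him : (z - 1).im = z.im := by simp
      simp only [Complex.neg_re, Complex.neg_im, abs_neg, hw, abs_zero, neg_zero, Real.rpow_zero,
        one_mul, him] at h2 h3
      have h4 : ‖G.proj (band n) * C‖ ≤ ‖C‖ := by
        refine (norm_mul_le _ _).trans ?_
        have := norm_proj_le (E := G) (measurableSet_band n)
        nlinarith [norm_nonneg C]
      change ‖G.op (bandPow n z) * E.op (bandPow m (-z))‖ ≤ _
      rw [h1]
      calc _ ≤ ‖G.op (bandPow n (z - 1))‖ * ‖G.proj (band n) * C‖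
            * ‖E.op (bandPow m (-(z - 1)))‖ :=
            (norm_mul_le _ _).trans (by gcongr; exact norm_mul_le _ _)
        _ ≤ Real.exp (Real.pi * |z.im|) * ‖C‖ * Real.exp (Real.pi * |z.im|) := by gcongr
        _ = _ := by rw [← hexp]; ring
  refine memLp_of_tendsto (g := fun n => bandPow n x) (fun n => bddMeas_bandPow n x)
    (measurable_cpow_ofReal _) (C := Q * ‖f‖) (fun n => ?_) (.of_forall fun t => ?_)
  · have hlim : Tendsto (fun m => ‖(G.op (bandPow n x) * E.op (bandPow m (-x))) f‖) atTop
        (𝓝 ‖G.op (bandPow n x) (E.op (gapPow δ (-x)) f)‖) := by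
      refine (((G.op (bandPow n x)).continuous.tendsto _).comp
        (tendsto_proj_band hδ hE (E.op (gapPow δ (-x)) f))).norm.congr fun m => ?_
      rw [← proj_mul_op_gapPow hδ hE hxre]
      rfl
    exact le_of_tendsto hlim (.of_forall fun m =>
      (ContinuousLinearMap.le_opNorm _ _).trans (by gcongr; exact hnorm m n))
  · rcases eq_or_ne t 0 with rfl | ht
    · have h1 : ∀ n : ℕ, bandPow n x 0 = 0 := fun n =>
        Set.indicator_of_notMem (fun h => ne_zero_of_mem_band h rfl) _
      have h2 : ((0 : ℝ) : ℂ) ^ (x : ℂ) = 0 := by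
        rw [Complex.ofReal_zero, Complex.zero_cpow (Complex.ofReal_ne_zero.mpr hx.ne')]
      simp only [h1, h2]
      exact tendsto_const_nhds
    · refine tendsto_const_nhds.congr' ?_
      filter_upwards [eventually_mem_band ht] with n hn
      exact (Set.indicator_of_mem hn fun t : ℝ => (t : ℂ) ^ (x : ℂ)).symm

end ProjMeasure

theorem opMul_assoc (A B C : H →ₗ.[ℂ] H) : opMul A (opMul B C) = opMul (opMul A B) C := by
  refine LinearPMap.eq_of_eq_graph (Submodule.ext fun ⟨f, h⟩ => ?_)
  simp only [mem_graph_opMul]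
  constructor
  · rintro ⟨k, ⟨l, h1, h2⟩, h3⟩; exact ⟨l, h1, k, h2, h3⟩
  · rintro ⟨l, h1, k, h2, h3⟩; exact ⟨k, ⟨l, h1, h2⟩, h3⟩

theorem conj_cpow_ofReal_of_nonneg {t : ℝ} (ht : 0 ≤ t) (x : ℝ) :
    starRingEnd ℂ ((t : ℂ) ^ (x : ℂ)) = (t : ℂ) ^ (x : ℂ) := by
  rw [← Complex.ofReal_cpow ht, Complex.conj_ofReal]

theorem cpow_mul_cpow_one_sub (t x : ℝ) :
    (t : ℂ) ^ (x : ℂ) * (t : ℂ) ^ (1 - x : ℂ) = t := by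
  rcases eq_or_ne t 0 with rfl | ht
  · rw [Complex.ofReal_zero]
    rcases eq_or_ne x 0 with rfl | hx
    · simp
    · rw [Complex.zero_cpow (Complex.ofReal_ne_zero.mpr hx), zero_mul]
  · rw [← Complex.cpow_add _ _ (Complex.ofReal_ne_zero.mpr ht), add_sub_cancel, Complex.cpow_one]

/-! ### The spectral measure of a self-adjoint operator with bounded inverse -/

section BoundedInverse

theorem mem_graph_iff_of_inverse {T : H →ₗ.[ℂ] H} (hker : LinearMap.ker T.toFun = ⊥)
    {R : H →L[ℂ] H} (hR : T.inverse = ofCLM R) {f h : H} : (f, h) ∈ T.graph ↔ R h = f := by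
  have h1 := LinearPMap.inverse_graph hker
  rw [← mem_graph_ofCLM, ← hR, h1, Submodule.mem_map]
  constructor
  · exact fun hp => ⟨(f, h), hp, rfl⟩
  · rintro ⟨⟨a, b⟩, hp, h2⟩
    have h3 : (b, a) = (h, f) := h2
    obtain ⟨rfl, rfl⟩ := Prod.mk.inj h3
    exact hp

variable {T : H →ₗ.[ℂ] H} {R : H →L[ℂ] H} (hT : IsSelfAdjoint T)
  (hR : ∀ f h, (f, h) ∈ T.graph ↔ R h = f)
include hT hR

theorem isSelfAdjoint_of_mem_graph_iff : IsSelfAdjoint R := by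
  rw [ContinuousLinearMap.isSelfAdjoint_iff_isSymmetric]
  intro f g
  have h1 : (R f, f) ∈ T.graph := (hR _ _).mpr rfl
  have h2 : (R g, g) ∈ T†.graph := by
    rw [LinearPMap.isSelfAdjoint_def.mp hT]; exact (hR _ _).mpr rfl
  have h3 := inner_of_mem_graph hT.dense_domain h1 h2
  change inner ℂ (R f) g = inner ℂ f (R g)
  rw [← inner_conj_symm, h3, inner_conj_symm]

theorem integral_spectralMeasure_of_inverse :
    (spectralMeasure T).integral (fun t => (t : ℂ)) Complex.measurable_ofReal = T :=
  spectralMeasure_integral <| exists_projMeasure_of_resolvent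
    (isSelfAdjoint_of_mem_graph_iff hT hR) 0 fun f h => by simpa using hR f h

theorem mem_graph_iff_spectralMeasure {f h : H} : (f, h) ∈ T.graph ↔
    MemLp (fun t : ℝ => (t : ℂ)) 2 ((spectralMeasure T).scalar f) ∧
      (spectralMeasure T).app (fun t : ℝ => (t : ℂ)) Complex.measurable_ofReal f = h := by
  rw [← ProjMeasure.mem_graph_integral, integral_spectralMeasure_of_inverse hT hR]

/-- On the spectral subspace of `|λ| < δ` the operator `T` has norm at most `δ`, so `‖u‖ ≤ ‖R‖ δ
‖u‖` there. The `+ 1` makes `‖R‖ δ` strictly less than `1` and avoids a vanishing denominator. -/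
theorem ae_le_abs_spectralMeasure (f : H) :
    ∀ᵐ t ∂((spectralMeasure T).scalar f), 1 / (‖R‖ + 1) ≤ |t| := by
  set E := spectralMeasure T
  set δ := 1 / (‖R‖ + 1) with hδ
  have hδ0 : 0 < δ := by positivity
  have hs : MeasurableSet {t : ℝ | ¬ δ ≤ |t|} := (measurableSet_le_abs δ).compl
  rw [ae_iff, E.scalar_eq_zero_iff hs]
  set s := {t : ℝ | ¬ δ ≤ |t|}
  set u := E.proj s f
  have hle : ∀ t ∈ s, ‖(t : ℂ)‖ ≤ δ := fun t ht => by
    rw [Complex.norm_real, Real.norm_eq_abs]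
    exact (not_le.mp ht).le
  have hb : BddMeas (s.indicator fun t => (t : ℂ)) :=
    BddMeas.indicator_of_le Complex.measurable_ofReal hs δ hle
  have hu : E.proj s u = u := by
    change (E.proj s * E.proj s) f = E.proj s f
    rw [E.proj_mul_self hs]
  have h1 := E.proj_mem_domain Complex.measurable_ofReal hs hb u
  rw [hu] at h1
  have h2 : R (E.op (s.indicator fun t => (t : ℂ)) u) = u :=
    (hR _ _).mp ((mem_graph_iff_spectralMeasure hT hR).mpr h1)
  have h3 : ‖E.op (s.indicator fun t => (t : ℂ)) u‖ ≤ δ * ‖u‖ := by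
    refine ProjMeasure.norm_op_apply_le hb u (.of_forall fun t => ?_) hδ0.le
    by_cases ht : t ∈ s
    · simpa [ht] using hle t ht
    · simpa [ht] using hδ0.le
  have h4 : ‖u‖ ≤ ‖R‖ * (δ * ‖u‖) := by
    conv_lhs => rw [← h2]
    exact (R.le_opNorm _).trans (by gcongr)
  have h5 : ‖R‖ * δ = 1 - δ := by
    rw [hδ]; field_simp; ring
  rw [← mul_assoc, h5] at h4
  have h6 : δ * ‖u‖ ≤ 0 := by linarith
  have : ‖u‖ ≤ 0 := by
    by_contra hcon
    exact absurd (mul_pos hδ0 (not_le.mp hcon)) (not_lt.mpr h6)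
  simpa using this

theorem op_gapPow_neg_one {δ : ℝ} (hδ : 0 < δ)
    (hE : ∀ f, ∀ᵐ t ∂((spectralMeasure T).scalar f), δ ≤ |t|) :
    (spectralMeasure T).op (gapPow δ (-1)) = R := by
  ext f
  obtain ⟨h1, h2⟩ := (mem_graph_iff_spectralMeasure hT hR).mp ((hR (R f) f).mpr rfl)
  have hb : BddMeas (gapPow δ (-1)) := bddMeas_gapPow hδ (by simp)
  conv_lhs => rw [← h2]
  rw [ProjMeasure.op_app hb _ h1]
  have h3 : (gapPow δ (-1) * fun t : ℝ => (t : ℂ))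
      =ᵐ[(spectralMeasure T).scalar (R f)] fun _ => (1 : ℂ) := by
    filter_upwards [hE (R f)] with t ht
    have ht0 : (t : ℂ) ≠ 0 := Complex.ofReal_ne_zero.mpr (abs_pos.mp (hδ.trans_le ht))
    simp only [gapPow, Pi.mul_apply, Set.indicator_of_mem (s := {t : ℝ | δ ≤ |t|}) ht]
    rw [Complex.cpow_neg_one, inv_mul_cancel₀ ht0]
  rw [ProjMeasure.app_congr _ _ (BddMeas.const 1).meas h3 (hb.memLp_mul h1),
    ← ProjMeasure.op_apply (BddMeas.const 1), ProjMeasure.op_const, one_smul]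
  rfl

theorem ae_nonneg_of_isNonneg (hpos : IsNonneg T) (f : H) :
    ∀ᵐ t ∂((spectralMeasure T).scalar f), 0 ≤ t := by
  refine ProjMeasure.ae_nonneg (fun f hf => ?_) f
  obtain ⟨y, hy1, hy2⟩ := (LinearPMap.mem_graph_iff _).mp
    ((mem_graph_iff_spectralMeasure hT hR).mpr ⟨hf, rfl⟩)
  have := hpos y
  simp only at hy1 hy2
  rwa [hy1, hy2] at this

end BoundedInverse

/-! ### Interpolation -/

namespace ProjMeasure

variable {E : ProjMeasure H} {δ : ℝ} (hδ : 0 < δ) (hE : ∀ f, ∀ᵐ t ∂(E.scalar f), δ ≤ |t|)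
include hδ hE

/-- Three lines for `E_n T^{-w} A T^w E_n`, with `E_n` the band projection. `hAB` exchanges `A` for
the adjoint of `B` on the line `Re w = 1`, and `hK` identifies the limit on the range of `T⁻¹`. -/
theorem norm_le_of_interpolation {A B : H →L[ℂ] H}
    (hAB : E.op (gapPow δ (-1)) * A = ContinuousLinearMap.adjoint B * E.op (gapPow δ (-1)))
    (hR : DenseRange (E.op (gapPow δ (-1)))) {c : ℝ} (hc0 : 0 ≤ c)
    (hc : ∀ f, ∀ᵐ t ∂(E.scalar f), Complex.arg (t : ℝ) ≤ c)
    {z : ℂ} (hz0 : 0 ≤ z.re) (hz1 : z.re ≤ 1) {K : H →L[ℂ] H}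
    (hK : K * E.op (gapPow δ (-1)) = E.op (gapPow δ (-z)) * A * E.op (gapPow δ (-1 + z)))
    {k : ℝ} (hk : 0 < k) :
    ‖K‖ ≤ ‖A‖ ^ (1 - z.re) * ‖B‖ ^ z.re *
      Real.exp (k * |z.im| ^ 2 + k * z.re * (1 - z.re) + k⁻¹ * c ^ 2) := by
  set R := E.op (gapPow δ (-1)) with hRdef
  have hm : (-1 : ℂ).re ≤ 0 := by simp
  have hexp : ∀ y : ℝ, Real.exp (c * max 0 y) * Real.exp (c * max 0 (-y))
      = Real.exp (c * |y|) := fun y => by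
    rw [← Real.exp_add, ← mul_add]
    congr 2
    rcases le_total 0 y with h | h
    · rw [max_eq_right h, max_eq_left (by linarith), abs_of_nonneg h, add_zero]
    · rw [max_eq_left h, max_eq_right (by linarith), abs_of_nonpos h, zero_add]
  have hnorm : ∀ (n : ℕ) (V : H →L[ℂ] H) (w : ℂ),
      ‖E.op (bandPow n (-w)) * V * E.op (bandPow n w)‖
        ≤ (((n : ℝ) + 1) ^ |w.re|) ^ 2 * ‖V‖ * Real.exp (c * |w.im|) := fun n V w => by
    have h1 := norm_op_bandPow_le_of_arg_le hc n (-w)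
    have h2 := norm_op_bandPow_le_of_arg_le hc n w
    rw [Complex.neg_re, Complex.neg_im, neg_neg, abs_neg] at h1
    calc _ ≤ ‖E.op (bandPow n (-w))‖ * ‖V‖ * ‖E.op (bandPow n w)‖ :=
          (norm_mul_le _ _).trans (by gcongr; exact norm_mul_le _ _)
      _ ≤ (((n : ℝ) + 1) ^ |w.re| * Real.exp (c * max 0 w.im)) * ‖V‖
          * (((n : ℝ) + 1) ^ |w.re| * Real.exp (c * max 0 (-w.im))) := by gcongr
      _ = _ := by rw [← hexp]; ring
  have key : ∀ n : ℕ, ‖E.op (bandPow n (-z)) * A * E.op (bandPow n z)‖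
      ≤ ‖A‖ ^ (1 - z.re) * ‖B‖ ^ z.re *
      Real.exp (k * |z.im| ^ 2 + k * z.re * (1 - z.re) + k⁻¹ * c ^ 2) := fun n => by
    -- The a priori constant `(n + 1)² ‖A‖` depends on `n`, but it enters only as a qualitative
    -- hypothesis; the resulting bound does not contain it.
    refine norm_le_interp_of_exp_growth
      (F := fun z => E.op (bandPow n (-z)) * A * E.op (bandPow n z)) ?_ (norm_nonneg _)
      (norm_nonneg _) hc0 (M := ((n : ℝ) + 1) ^ 2 * ‖A‖) ?_ ?_ ?_ hk hz0 hz1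
    · have h1 := differentiable_op_bandPow (E := E) n
      exact ((h1.comp differentiable_neg).mul_const A).mul h1
    · intro w hw0 hw1
      refine (hnorm n A w).trans ?_
      rw [abs_of_nonneg hw0]
      gcongr
      conv_rhs => rw [← Real.rpow_one ((n : ℝ) + 1)]
      exact Real.rpow_le_rpow_of_exponent_le (by linarith [n.cast_nonneg (α := ℝ)]) hw1
    · intro w hw
      simpa [hw] using hnorm n A w
    · intro w hw
      have h1 : E.op (bandPow n (-w)) * A * E.op (bandPow n w)
          = E.op (bandPow n (-(w - 1))) * ContinuousLinearMap.adjoint B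
            * E.op (bandPow n (w - 1)) := by
        calc E.op (bandPow n (-w)) * A * E.op (bandPow n w)
            = E.op (bandPow n (-(w - 1))) * (R * A) * E.op (bandPow n w) := by
              rw [← mul_assoc, op_bandPow_mul_gapPow hδ hE hm]
              congr 4; ring
          _ = E.op (bandPow n (-(w - 1))) * ContinuousLinearMap.adjoint B
            * (R * E.op (bandPow n w)) := by rw [hAB]; simp only [mul_assoc]
          _ = _ := by
              rw [op_gapPow_mul_bandPow hδ hE hm]
              congr 3; ring
      have h2 := hnorm n (ContinuousLinearMap.adjoint B) (w - 1)
      rw [← h1, LinearIsometryEquiv.norm_map] at h2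
      simpa [hw] using h2
  set Q := ‖A‖ ^ (1 - z.re) * ‖B‖ ^ z.re *
      Real.exp (k * |z.im| ^ 2 + k * z.re * (1 - z.re) + k⁻¹ * c ^ 2)
  have hz : (-z).re ≤ 0 := by simpa using hz0
  have hz' : (-1 + z).re ≤ 0 := by simpa using hz1
  have hbound : ∀ u, ‖K u‖ ≤ Q * ‖u‖ := by
    refine isClosed_property hR (isClosed_le (by fun_prop) (by fun_prop)) fun g => ?_
    set L := E.op (gapPow δ (-z)) * A * E.op (gapPow δ (-1 + z)) with hL
    -- Applied to `R g`, the exponent `z` becomes `-1 + z`, with nonpositive real part, so the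
    -- truncated operator is a compression of the bounded operator `L` and converges strongly.
    have h1 : ∀ n, (E.op (bandPow n (-z)) * A * E.op (bandPow n z)) (R g)
        = E.proj (band n) (L (E.proj (band n) g)) := fun n => by
      change ((E.op (bandPow n (-z)) * A * E.op (bandPow n z)) * R) g
        = (E.proj (band n) * (L * E.proj (band n))) g
      congr 1
      rw [hL, mul_assoc _ _ R, op_bandPow_mul_gapPow hδ hE hm, ← op_gapPow_mul_proj hδ hE hz',
        ← proj_mul_op_gapPow hδ hE hz]
      simp only [mul_assoc]
    have hLn : Tendsto (fun n => L (E.proj (band n) g)) atTop (𝓝 (L g)) :=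
      (L.continuous.tendsto g).comp (tendsto_proj_band hδ hE g)
    have hlim : Tendsto (fun n => E.proj (band n) (L (E.proj (band n) g))) atTop (𝓝 (L g)) := by
      have h2 : Tendsto (fun n => E.proj (band n) (L (E.proj (band n) g) - L g)) atTop (𝓝 0) := by
        refine squeeze_zero_norm (fun n => ?_)
          (tendsto_zero_iff_norm_tendsto_zero.mp (by simpa using hLn.sub_const (L g)))
        refine (ContinuousLinearMap.le_opNorm _ _).trans ?_
        exact mul_le_of_le_one_left (norm_nonneg _) (norm_proj_le (measurableSet_band n))
      have h3 := h2.add (tendsto_proj_band hδ hE (L g))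
      simpa using h3
    have h4 : K (R g) = L g := congrArg (fun V : H →L[ℂ] H => V g) hK
    rw [h4]
    refine le_of_tendsto hlim.norm (.of_forall fun n => ?_)
    rw [← h1 n]
    exact (ContinuousLinearMap.le_opNorm _ _).trans (by gcongr; exact key n)
  exact ContinuousLinearMap.opNorm_le_bound _ (by positivity) hbound

/-- As `dom |S| = dom S`, the operator `|S| T⁻¹` is everywhere defined, hence bounded by the closed
graph theorem, and the Heinz inequality applies. -/
theorem op_gapPow_mem_domain_opPow_absOp {S : H →ₗ.[ℂ] H} (hS : S.IsClosed)
    (hd : Dense (S.domain : Set H)) (hdom : ∀ f, E.op (gapPow δ (-1)) f ∈ S.domain) {x : ℝ}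
    (hx0 : 0 ≤ x) (hx1 : x ≤ 1) (f : H) :
    E.op (gapPow δ (-x)) f ∈ (opPow (absOp S) x).domain := by
  have hcl : (absOp S).IsClosed := isClosed_integral _
  obtain ⟨C, hC⟩ := exists_opMul_eq_ofCLM hcl (E.op (gapPow δ (-1)))
    fun f => by rw [domain_absOp hS hd]; exact hdom f
  refine memLp_cpow_of_memLp (C := C) hδ hE (fun f => ?_) hx0 hx1 f
  rw [← mem_graph_integral, integral_spectralMeasure_absOp hS hd]
  have h1 : (f, C f) ∈ (opMul (absOp S) (ofCLM (E.op (gapPow δ (-1))))).graph := by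
    rw [hC, mem_graph_ofCLM]
  obtain ⟨k, h2, h3⟩ := mem_graph_opMul.mp h1
  rwa [mem_graph_ofCLM.mp h2]

/-- The conjugate of `λ^w` differs from `λ^w` by a phase, so the range of the adjoint power lies in
the range of the power itself. This carries the domain statement over to `(T^{-x})*` when `T` has
negative spectrum. -/
theorem adjoint_op_gapPow {w : ℂ} (hw : w.re ≤ 0) : ∃ V : H →L[ℂ] H,
    ContinuousLinearMap.adjoint (E.op (gapPow δ w)) = E.op (gapPow δ w) * V := by
  have hb := bddMeas_gapPow hδ hw
  let φ : ℝ → ℂ := fun t => starRingEnd ℂ (gapPow δ w t) / gapPow δ w t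
  have hφ : BddMeas φ := by
    refine ⟨(measurable_conj hb.meas).div hb.meas, 1, fun t => ?_⟩
    rw [norm_div, RCLike.norm_conj]
    exact div_self_le_one _
  refine ⟨E.op φ, ?_⟩
  rw [op_conj hb, ← op_mul hb hφ]
  refine op_congr hb.conj (hb.mul hφ) fun f => ?_
  filter_upwards [hE f] with t ht
  have h0 : gapPow δ w t ≠ 0 := by
    simp only [gapPow, Set.indicator_of_mem (s := {t : ℝ | δ ≤ |t|}) ht]
    exact fun h => abs_pos.mp (hδ.trans_le ht)
      (Complex.ofReal_eq_zero.mp ((Complex.cpow_eq_zero_iff _ _).mp h).1)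
  simp only [Pi.mul_apply, φ]
  rw [mul_div_cancel₀ _ h0]

end ProjMeasure

/-! ### Fractional powers of `|S|` -/

section AbsoluteValuePowers

variable {S : H →ₗ.[ℂ] H} (hS : S.IsClosed) (hd : Dense (S.domain : Set H))
include hS hd

theorem adjoint_opPow_absOp (x : ℝ) : (opPow (absOp S) x)† = opPow (absOp S) x := by
  rw [opPow, ProjMeasure.adjoint_integral]
  refine ProjMeasure.integral_congr _ _ _ fun f => ?_
  filter_upwards [ae_nonneg_absOp hS hd f] with t ht
  exact conj_cpow_ofReal_of_nonneg ht x

theorem mem_graph_opPow_absOp_of_mem {x : ℝ} {f q m : H}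
    (hq : (f, q) ∈ (opPow (absOp S) (1 - x)).graph) (hm : (f, m) ∈ (absOp S).graph) :
    (q, m) ∈ (opPow (absOp S) x).graph := by
  rw [← integral_spectralMeasure_absOp hS hd, ProjMeasure.mem_graph_integral] at hm
  obtain ⟨h1, rfl⟩ := (ProjMeasure.mem_graph_integral _).mp hq
  refine (ProjMeasure.mem_graph_integral _).mpr ?_
  have hmul : (fun t : ℝ => (t : ℂ) ^ (x : ℂ)) * (fun t : ℝ => (t : ℂ) ^ (1 - x : ℂ))
      = fun t : ℝ => (t : ℂ) := funext fun t => cpow_mul_cpow_one_sub t x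
  have h2 : MemLp ((fun t : ℝ => (t : ℂ) ^ (x : ℂ)) * (fun t : ℝ => (t : ℂ) ^ (1 - x : ℂ))) 2
      ((spectralMeasure (absOp S)).scalar f) := by rw [hmul]; exact hm.1
  refine ⟨(ProjMeasure.memLp_scalar_app _ _ (measurable_cpow_ofReal _) h1).mpr h2, ?_⟩
  rw [ProjMeasure.app_app _ _ _ h1 h2, ← hm.2]
  congr 1

end AbsoluteValuePowers

/-! ### The factorization -/

/-- The factorized operator is bounded, and agrees on the range of `∫ λ⁻¹ dE` with the
operator to be interpolated. -/
theorem exists_factorization {E : ProjMeasure H} {δ : ℝ} (hδ : 0 < δ)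
    (hE : ∀ f, ∀ᵐ t ∂(E.scalar f), δ ≤ |t|) {S : H →ₗ.[ℂ] H} (hS : S.IsClosed)
    (hd : Dense (S.domain : Set H)) (hd' : Dense (S†.domain : Set H))
    (hdom : ∀ f, E.op (gapPow δ (-1)) f ∈ S.domain)
    (hdom' : ∀ f, E.op (gapPow δ (-1)) f ∈ S†.domain) {A : H →L[ℂ] H}
    (hA : ∀ f, (E.op (gapPow δ (-1)) f, A f) ∈ S.graph) {z : ℂ} (hz0 : 0 ≤ z.re)
    (hz1 : z.re ≤ 1) :
    ∃ K : H →L[ℂ] H,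
      K * E.op (gapPow δ (-1)) = E.op (gapPow δ (-z)) * A * E.op (gapPow δ (-1 + z)) ∧
      opMul (ofCLM (E.op (gapPow δ (-(Complex.I * z.im))))) (opMul (opMul (opPow (absOp S†) z.re)
        (ofCLM (ContinuousLinearMap.adjoint (E.op (gapPow δ (-z.re))))))†
        (opMul (ofCLM (polarFactor S)) (opMul (opPow (absOp S) (1 - z.re))
        (opMul (ofCLM (E.op (gapPow δ (-1 + z.re))))
        (ofCLM (E.op (gapPow δ (Complex.I * z.im)))))))) = ofCLM K := by
  set P : ℂ → H →L[ℂ] H := fun w => E.op (gapPow δ w) with hP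
  set U := polarFactor S
  have hx : (-(z.re : ℂ)).re ≤ 0 := by simpa using hz0
  have hx' : (-1 + (z.re : ℂ)).re ≤ 0 := by simpa using hz1
  have hy : (Complex.I * z.im).re ≤ 0 := by simp
  have hy' : (-(Complex.I * z.im)).re ≤ 0 := by simp
  have hm : (-1 : ℂ).re ≤ 0 := by simp
  have hz : (-z).re ≤ 0 := by simpa using hz0
  have hz' : (-1 + z).re ≤ 0 := by simpa using hz1
  have hzre : (z.re : ℂ) + Complex.I * z.im = z := by
    rw [mul_comm]; exact Complex.re_add_im z
  -- `C` is the bounded operator `|S|^{1-x} T^{-1+x}`, with `x = Re z`; below, `D` is `|S†|^x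
  -- (T^{-x})*`.
  obtain ⟨C, hC⟩ := exists_opMul_eq_ofCLM
    (A := opPow (absOp S) (1 - z.re)) (ProjMeasure.isClosed_integral _) (P (-1 + z.re)) (by
      have := ProjMeasure.op_gapPow_mem_domain_opPow_absOp hδ hE hS hd hdom (x := 1 - z.re)
        (by linarith) (by linarith)
      push_cast at this
      rwa [show -(1 - (z.re : ℂ)) = -1 + z.re by ring] at this)
  obtain ⟨V, hV⟩ := ProjMeasure.adjoint_op_gapPow hδ hE hx
  have hSa : S†.IsClosed := LinearPMap.adjoint_isClosed hd
  obtain ⟨D, hD⟩ := exists_opMul_eq_ofCLM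
    (A := opPow (absOp S†) z.re) (ProjMeasure.isClosed_integral _)
    (ContinuousLinearMap.adjoint (P (-z.re))) (fun f => by
      rw [hV]
      exact ProjMeasure.op_gapPow_mem_domain_opPow_absOp hδ hE hSa hd' hdom' hz0 hz1 (V f))
  refine ⟨P (-(Complex.I * z.im)) * (ContinuousLinearMap.adjoint D
    * (U * (C * P (Complex.I * z.im)))), ?_, ?_⟩
  · ext g
    set v := P (-1 + z) g with hv
    have hcomm : P (-1 + z.re) (P (Complex.I * z.im) (P (-1) g)) = P (-1) v := by
      change (P (-1 + z.re) * (P (Complex.I * z.im) * P (-1))) g = (P (-1) * P (-1 + z)) g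
      congr 1
      simp only [hP]
      rw [ProjMeasure.op_gapPow_mul hδ hE hy hm, ProjMeasure.op_gapPow_mul hδ hE hx' (by simp),
        ProjMeasure.op_gapPow_mul hδ hE hm hz']
      congr 2
      rw [← hzre]
      simp
      ring
    set q := C (P (Complex.I * z.im) (P (-1) g)) with hq
    obtain ⟨m, hm1, hm2⟩ := (mem_graph_iff_absOp hS hd).mp (hA v)
    have h1 : (P (-1) v, q) ∈ (opPow (absOp S) (1 - z.re)).graph := by
      have h2 : (P (Complex.I * z.im) (P (-1) g), q) ∈
          (opMul (opPow (absOp S) (1 - z.re)) (ofCLM (P (-1 + z.re)))).graph := by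
        rw [hC, mem_graph_ofCLM]
      obtain ⟨l, h3, h4⟩ := mem_graph_opMul.mp h2
      rwa [← mem_graph_ofCLM.mp h3, hcomm] at h4
    have h5 := intertwines_opPow_absOp hS hd hd' z.re _ _
      (mem_graph_opPow_absOp_of_mem hS hd h1 hm1)
    rw [hm2] at h5
    -- Here `q = |S|^{1-x} T⁻¹ v`. The intertwining relation gives `|S†|^x U q = U |S|^x q = U |S|
    -- T⁻¹ v = A v`; pairing with `f` moves the self-adjoint operator `|S†|^x` onto `(T^{-x})* f`,
    -- where it forms `D f`.
    have h6 : ContinuousLinearMap.adjoint D (U q) = P (-z.re) (A v) := by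
      refine ext_inner_left ℂ fun f => ?_
      rw [ContinuousLinearMap.adjoint_inner_right,
        ← ContinuousLinearMap.adjoint_inner_left (P (-z.re)) (A v) f]
      have h7 : (f, D f) ∈ (opMul (opPow (absOp S†) z.re)
          (ofCLM (ContinuousLinearMap.adjoint (P (-z.re))))).graph := by
        rw [hD, mem_graph_ofCLM]
      obtain ⟨l, h8, h9⟩ := mem_graph_opMul.mp h7
      obtain rfl := mem_graph_ofCLM.mp h8
      rw [← adjoint_opPow_absOp hSa hd'] at h9
      exact inner_of_mem_graph (ProjMeasure.dense_domain_integral _) h5 h9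
    change P (-(Complex.I * z.im)) (ContinuousLinearMap.adjoint D (U q)) = P (-z) (A v)
    rw [h6]
    change (P (-(Complex.I * z.im)) * P (-z.re)) (A v) = P (-z) (A v)
    congr 1
    simp only [hP]
    rw [ProjMeasure.op_gapPow_mul hδ hE hy' hx]
    congr 2
    conv_rhs => rw [← hzre]
    ring
  · rw [hD, adjoint_ofCLM, opMul_assoc (opPow (absOp S) _), hC]
    simp only [opMul_ofCLM]
    rfl

/-! ### Choice of the parameter `k`, and the theorem -/

theorem le_of_forall_mul_exp {a Q M : ℝ} (h : ∀ k : ℝ, 0 < k → a ≤ Q * Real.exp (k * M)) :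
    a ≤ Q := by
  have h1 : Tendsto (fun k : ℝ => Q * Real.exp (k * M)) (𝓝[>] 0) (𝓝 Q) := by
    have : Continuous fun k : ℝ => Q * Real.exp (k * M) := by fun_prop
    have h2 := (this.tendsto 0).mono_left (nhdsWithin_le_nhds (s := Set.Ioi 0))
    simpa using h2
  exact ge_of_tendsto h1 (eventually_nhdsWithin_of_forall fun k hk => h k hk)

/-- The exponent `k X + p²/k` is minimal at `k = p/√X`, with value `2p√X`. For `X = 0` the infimum
is not attained, and `k → ∞` is used instead. -/
theorem le_mul_exp_sqrt {a Q X p : ℝ} (hX : 0 ≤ X) (hp : 0 < p)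
    (h : ∀ k : ℝ, 0 < k → a ≤ Q * Real.exp (k * X + k⁻¹ * p ^ 2)) :
    a ≤ Q * Real.exp (2 * p * √X) := by
  rcases hX.eq_or_lt with rfl | hX
  · rw [Real.sqrt_zero, mul_zero, Real.exp_zero, mul_one]
    refine le_of_forall_mul_exp (M := p ^ 2) fun k hk => ?_
    simpa using h k⁻¹ (inv_pos.mpr hk)
  · have hs : 0 < √X := Real.sqrt_pos.mpr hX
    have h1 := h (p / √X) (by positivity)
    have h2 : p / √X * X + (p / √X)⁻¹ * p ^ 2 = 2 * p * √X := by
      have : X = √X * √X := (Real.mul_self_sqrt hX.le).symm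
      rw [this, Real.sqrt_mul_self hs.le]
      field_simp
      ring
    rwa [h2] at h1

theorem mem_graph_of_opMul_ofCLM {A : H →ₗ.[ℂ] H} {V W : H →L[ℂ] H}
    (h : opMul A (ofCLM V) = ofCLM W) (f : H) : (V f, W f) ∈ A.graph := by
  have h1 : (f, W f) ∈ (opMul A (ofCLM V)).graph := by rw [h, mem_graph_ofCLM]
  obtain ⟨k, h2, h3⟩ := mem_graph_opMul.mp h1
  rwa [mem_graph_ofCLM.mp h2]

theorem adjoint_opPow_of_ae_nonneg {T : H →ₗ.[ℂ] H}
    (hT : ∀ f, ∀ᵐ t ∂((spectralMeasure T).scalar f), 0 ≤ t) (x : ℝ) :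
    (opPow T (-x))† = opPow T (-x) := by
  rw [opPow, ProjMeasure.adjoint_integral]
  refine ProjMeasure.integral_congr _ _ _ fun f => ?_
  filter_upwards [hT f] with t ht
  have := conj_cpow_ofReal_of_nonneg ht (-x)
  rwa [Complex.ofReal_neg] at this

end

theorem theorem2p7 {H : Type*} [NormedAddCommGroup H] [InnerProductSpace ℂ H] [CompleteSpace H]
    (T S : H →ₗ.[ℂ] H) (hT : IsSelfAdjoint T) (hTinv : HasBoundedInverse T)
    (hS : S.IsClosed) (hdom : T.domain ≤ S.domain ⊓ S†.domain) :
    ∃ A B : H →L[ℂ] H, opMul S T.inverse = ofCLM A ∧ opMul S† T.inverse = ofCLM B ∧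
      (∀ z : ℂ, 0 ≤ z.re → z.re ≤ 1 →
        T.domain ≤ (sandwichMax S T z).domain ∧
        (sandwich S T z).IsClosable ∧
        ∃ K : H →L[ℂ] H, (sandwich S T z).closure = ofCLM K ∧
          factorized S T (opPow T (-z.re))† z = ofCLM K ∧
          (IsNonneg T → factorized S T (opPow T (-z.re)) z = ofCLM K) ∧
          (∀ k : ℝ, 0 < k → ‖K‖ ≤ ‖A‖ ^ (1 - z.re) * ‖B‖ ^ z.re *
            Real.exp (k * |z.im| ^ 2 + k * z.re * (1 - z.re) + k⁻¹ * Real.pi ^ 2)) ∧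
          (IsNonneg T → ‖K‖ ≤ ‖A‖ ^ (1 - z.re) * ‖B‖ ^ z.re)) ∧
      (∀ x : ℝ, 0 ≤ x → x ≤ 1 →
        ∃ K : H →L[ℂ] H, (sandwich S T x).closure = ofCLM K ∧
          ‖K‖ ≤ ‖A‖ ^ (1 - x) * ‖B‖ ^ x * Real.exp (2 * Real.pi * √(x * (1 - x))) ∧
          (IsNonneg T → ‖K‖ ≤ ‖A‖ ^ (1 - x) * ‖B‖ ^ x)) := by
  obtain ⟨hker, R, hTR⟩ := hTinv
  have hR : ∀ f h, (f, h) ∈ T.graph ↔ R h = f := fun f h => mem_graph_iff_of_inverse hker hTR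
  have hTd : Dense (T.domain : Set H) := hT.dense_domain
  have hRT : ∀ f, R f ∈ T.domain := fun f => LinearPMap.mem_domain_of_mem_graph ((hR _ f).mpr rfl)
  have hd : Dense (S.domain : Set H) := hTd.mono fun f hf => (hdom hf).1
  have hd' : Dense (S†.domain : Set H) := hTd.mono fun f hf => (hdom hf).2
  obtain ⟨A, hA⟩ := exists_opMul_eq_ofCLM hS R fun f => (hdom (hRT f)).1
  obtain ⟨B, hB⟩ := exists_opMul_eq_ofCLM (LinearPMap.adjoint_isClosed hd) R
    fun f => (hdom (hRT f)).2
  set E := spectralMeasure T with hEdef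
  set δ : ℝ := 1 / (‖R‖ + 1) with hδdef
  have hδ : 0 < δ := by positivity
  have hE : ∀ f, ∀ᵐ t ∂(E.scalar f), δ ≤ |t| := ae_le_abs_spectralMeasure hT hR
  have hPR : E.op (gapPow δ (-1)) = R := op_gapPow_neg_one hT hR hδ hE
  have hpow : ∀ w : ℂ, w.re ≤ 0 → opPow T w = ofCLM (E.op (gapPow δ w)) := fun w hw =>
    ProjMeasure.integral_cpow_eq_ofCLM hδ hE hw
  have hrange : DenseRange R := hTd.mono fun f hf => by
    obtain ⟨h, hh⟩ := LinearPMap.mem_domain_iff.mp hf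
    exact ⟨h, (hR f h).mp hh⟩
  -- This is `⟨R g, S R f⟩ = ⟨S† R g, R f⟩`, read with `R` self-adjoint.
  have hAB : R * A = ContinuousLinearMap.adjoint B * R := by
    ext f
    refine ext_inner_left ℂ fun g => ?_
    have h1 := inner_of_mem_graph hd (mem_graph_of_opMul_ofCLM hA f)
      (mem_graph_of_opMul_ofCLM hB g)
    have h2 := (ContinuousLinearMap.isSelfAdjoint_iff_isSymmetric.mp
      (isSelfAdjoint_of_mem_graph_iff hT hR)) g (A f)
    change inner ℂ (R g) (A f) = inner ℂ g (R (A f)) at h2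
    change inner ℂ g (R (A f)) = inner ℂ g (ContinuousLinearMap.adjoint B (R f))
    rw [ContinuousLinearMap.adjoint_inner_right, h1, h2]
  have hmain : ∀ z : ℂ, 0 ≤ z.re → z.re ≤ 1 →
      T.domain ≤ (sandwichMax S T z).domain ∧
      (sandwich S T z).IsClosable ∧
      ∃ K : H →L[ℂ] H, (sandwich S T z).closure = ofCLM K ∧
        factorized S T (opPow T (-z.re))† z = ofCLM K ∧
        (IsNonneg T → factorized S T (opPow T (-z.re)) z = ofCLM K) ∧
        (∀ k : ℝ, 0 < k → ‖K‖ ≤ ‖A‖ ^ (1 - z.re) * ‖B‖ ^ z.re *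
          Real.exp (k * |z.im| ^ 2 + k * z.re * (1 - z.re) + k⁻¹ * Real.pi ^ 2)) ∧
        (IsNonneg T → ‖K‖ ≤ ‖A‖ ^ (1 - z.re) * ‖B‖ ^ z.re) := by
    intro z hz0 hz1
    have hz : (-z).re ≤ 0 := by simpa using hz0
    have hz' : (-1 + z).re ≤ 0 := by simpa using hz1
    obtain ⟨K, hK, hfac⟩ := exists_factorization hδ hE hS hd hd'
      (fun f => by rw [hPR]; exact (hdom (hRT f)).1) (fun f => by rw [hPR]; exact (hdom (hRT f)).2)
      (A := A) (fun f => by rw [hPR]; exact mem_graph_of_opMul_ofCLM hA f) hz0 hz1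
    have hcomm : ∀ g, E.op (gapPow δ (-1 + z)) (R g) = R (E.op (gapPow δ (-1 + z)) g) := fun g => by
      rw [← hPR]
      exact congrArg (fun V : H →L[ℂ] H => V g)
        (ProjMeasure.op_mul_comm (bddMeas_gapPow hδ hz') (bddMeas_gapPow hδ (by simp)))
    -- The power `T^{-1+z}` commutes with `R`, so it maps `dom T` into itself and thus into `dom S`;
    -- this makes the product defined on all of `dom T`.
    have hmax : ∀ g, (R g, K (R g)) ∈ (sandwichMax S T z).graph := fun g => by
      have h1 : K (R g) = E.op (gapPow δ (-z)) (A (E.op (gapPow δ (-1 + z)) g)) := by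
        rw [hPR] at hK
        exact congrArg (fun V : H →L[ℂ] H => V g) hK
      rw [h1, sandwichMax, hpow _ hz, hpow _ hz']
      refine mem_graph_opMul.mpr ⟨A (E.op (gapPow δ (-1 + z)) g),
        mem_graph_opMul.mpr ⟨_, mem_graph_ofCLM.mpr rfl, ?_⟩, mem_graph_ofCLM.mpr rfl⟩
      rw [hcomm]
      exact mem_graph_of_opMul_ofCLM hA _
    have hdomain : T.domain ≤ (sandwichMax S T z).domain := fun f hf => by
      obtain ⟨h, hh⟩ := LinearPMap.mem_domain_iff.mp hf
      rw [← (hR f h).mp hh]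
      exact LinearPMap.mem_domain_of_mem_graph (hmax h)
    have hclosure : (sandwich S T z).IsClosable ∧ (sandwich S T z).closure = ofCLM K := by
      refine isClosable_and_closure_eq_ofCLM ?_ fun f g hfg => ?_
      · have : (sandwich S T z).domain = T.domain := inf_eq_left.mpr hdomain
        rw [this]
        exact hTd
      · have hf : f ∈ T.domain := (LinearPMap.mem_domain_of_mem_graph hfg).1
        have hfg' : (f, g) ∈ (sandwichMax S T z).graph :=
          LinearPMap.le_graph_of_le LinearPMap.domRestrict_le hfg
        obtain ⟨h, hh⟩ := LinearPMap.mem_domain_iff.mp hf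
        obtain rfl := (hR f h).mp hh
        exact LinearPMap.mem_graph_snd_inj _ (hmax h) hfg' rfl
    have hfac' : factorized S T (opPow T (-z.re))† z = ofCLM K := by
      rw [factorized, hpow (-(Complex.I * z.im)) (by simp), hpow (-z.re) (by simpa using hz0),
        hpow (-1 + z.re) (by simpa using hz1), hpow (Complex.I * z.im) (by simp), adjoint_ofCLM]
      exact hfac
    refine ⟨hdomain, hclosure.1, K, hclosure.2, hfac', fun hpos => ?_, fun k hk => ?_,
      fun hpos => ?_⟩
    · rw [← adjoint_opPow_of_ae_nonneg (ae_nonneg_of_isNonneg hT hR hpos)]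
      exact hfac'
    · exact ProjMeasure.norm_le_of_interpolation hδ hE (by rw [hPR]; exact hAB)
        (by rw [hPR]; exact hrange) Real.pi_pos.le
        (fun f => .of_forall fun t => Complex.arg_le_pi t) hz0 hz1 hK hk
    -- For `T ≥ 0` the argument of `λ` vanishes, so the growth rate is `c = 0`; the term with `k⁻¹`
    -- disappears and `k → 0` removes the whole exponential.
    · refine le_of_forall_mul_exp (M := |z.im| ^ 2 + z.re * (1 - z.re)) fun k hk => ?_
      have h1 := ProjMeasure.norm_le_of_interpolation hδ hE (by rw [hPR]; exact hAB)
        (by rw [hPR]; exact hrange) le_rfl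
        (fun f => (ae_nonneg_of_isNonneg hT hR hpos f).mono fun t ht =>
          (Complex.arg_ofReal_of_nonneg ht).le) hz0 hz1 hK hk
      convert h1 using 3
      ring
  refine ⟨A, B, by rw [hTR, hA], by rw [hTR, hB], hmain, fun x hx0 hx1 => ?_⟩
  obtain ⟨-, -, K, hK, -, -, hk, hpos⟩ := hmain x (by simpa using hx0) (by simpa using hx1)
  simp only [Complex.ofReal_re, Complex.ofReal_im] at hk hpos
  refine ⟨K, hK, le_mul_exp_sqrt (mul_nonneg hx0 (sub_nonneg.mpr hx1)) Real.pi_pos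
    fun k hk0 => ?_, hpos⟩
  convert hk k hk0 using 3
  simp
  ring
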